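/- Let $\mathbb F$ be $\mathbb R$ or $\mathbb C$. All algebras are associative $\mathbb F$-algebras, not necessarily unital or commutative. \emph{Conventions.} For a smooth Hausdorff manifold $M$ let $C_c^\infty(M)$ be the algebra of smooth $\mathbb F$-valued functions with compact support and $C^\infty(M)_x$ the algebra of germs at $x\in M$ of smooth functions. Let $A_0$ be a commutative algebra. A \emph{left $A_0$-coalgebra} is a left $A_0$-module $C$ in which any finitely many elements are fixed by a common element of $A_0$, with $A_0$-linear maps $\Delta:C\to C\otimes_{A_0}C$ and $\epsilon:C\to A_0$ that are coassociative and counital. An \emph{$A_0$-bialgebroid} is an algebra $A$ containing $A_0$ as a subalgebra, such that any finitely many elements $a_i$ of $A$ admit $a_0\in A_0$ with $a_0a_i=a_ia_0=a_i$, together with a left $A_0$-coalgebra structure on $A$ such that: $\epsilon|_{A_0}=\mathrm{id}$; $\Delta(a_0)=a_0\otimes e$ whenever $a_0,e\in A_0$ and $ea_0=a_0$; the two right $A_0$-actions on $A\otimes_{A_0}A$ (the tensor product with respect to the left actions) coincide on $\Delta(A)$; $\epsilon(ab)=\epsilon(a\epsilon(b))$; and $\Delta(ab)=\Delta(a)\Delta(b)$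 (componentwise product). A \emph{Hopf $A_0$-algebroid} is an $A_0$-bialgebroid with a linear involution $S$ on $A$ such that $S|_{A_0}=\mathrm{id}$, $S(ab)=S(b)S(a)$ and $\sum S(a')a''=\epsilon(S(a))$ if $\Delta(a)=\sum a'\otimes a''$. A \emph{smooth Hopf algebroid} $(A,M)$ is a Hopf $C_c^\infty(M)$-algebroid $A$, where $M$ is a smooth Hausdorff manifold. For an $A_0$-bialgebroid $A$ and a $B_0$-bialgebroid $B$, a \emph{preprincipal $A$-$B$-bimodule} is an $A$-$B$-bimodule $\mathcal M$, in which any finitely many elements are fixed by a common element of $A_0$ on the left and by a common element of $B_0$ on the right, with a left $A_0$-coalgebra structure such that the two right $B_0$-actions on $\mathcal M\otimes_{A_0}\mathcal M$ coincide on $\Delta(\mathcal M)$, $\epsilon(mb)=\epsilon(m\epsilon(b))$, $\epsilon(am)=\epsilon(a\epsilon(m))$, $\Delta(am)=\Delta(a)\Delta(m)$ and $\Delta(mb)=\Delta(m)\Delta(b)$. It is \emph{principal} if $\epsilon$ is surjective and the map $\mathcal M\otimes_{B_0}B\to\mathcal M\otimes_{A_0}\mathcal M$, $m\otimes b\mapsto\Delta(m)(b_0\otimes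 b)$ (where $b_0\in B_0$ is any element with $b_0b=b$) is an isomorphism. A bialgebroid $A$ is \emph{principal} if it is principal as an $A$-$A$-bimodule. Isomorphisms of bimodules are required to respect both actions, $\Delta$ and $\epsilon$. The tensor product $\mathcal M\otimes_B\mathcal N$ carries the structure $a(m\otimes n)=am\otimes n$, $(m\otimes n)c=m\otimes nc$, $\epsilon(m\otimes n)=\epsilon(m\epsilon(n))$, $\Delta(m\otimes n)=\sum_{i,j}(m_i'\otimes n_j')\otimes(m_i''\otimes n_j'')$ for $\Delta(m)=\sum_i m_i'\otimes m_i''$ and $\Delta(n)=\sum_j n_j'\otimes n_j''$. For a left $C_c^\infty(M)$-coalgebra $C$ and $x\in M$ let $C_x=C/\{c: fc=0\text{ for some }f\in C_c^\infty(M)\text{ with germ }f_x=1\}$, with the induced $C^\infty(M)_x$-coalgebra structure $(\Delta_x,\epsilon_x)$, let $c_x$ be the class of $c$, and let $G(C_x)=\{\zeta\in C_x:\Delta_x(\zeta)=\zeta\otimes\zeta,\ \epsilon_x(\zeta)=1\}$. For a smooth Hopf algebroid $(A,M)$ and $y\in M$ let $G^S(A_y)$ be the set of all $a_y$, where $a\in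 A$ satisfies $\epsilon(a)_y=1$ and there is $a'\in A$ with $\Delta(a)=a\otimes a'$ and $\Delta(S(a))=S(a')\otimes S(a)$. The smooth Hopf algebroid $(A,M)$ is \emph{locally grouplike} if, for every $y\in M$, the $C^\infty(M)_y$-module $A_y$ is freely generated by $G^S(A_y)$. A principal $A$-$B$-bimodule $\mathcal M$ over locally grouplike Hopf algebroids $(A,M)$ and $(B,N)$ is \emph{locally grouplike} if, for every $x\in M$, the $C^\infty(M)_x$-module $\mathcal M_x$ is freely generated by $G(\mathcal M_x)$. \textbf{Proposition.} Principal smooth Hopf algebroids as objects and isomorphism classes of principal $A$-$B$-bimodules as morphisms from $(A,M)$ to $(B,N)$, with the composition induced by the tensor product $\otimes_B$ and with the class of the $A$-$A$-bimodule $A$ as the identity of $(A,M)$, form a category $\mathsf{PrHoALGD}^\infty$, and the locally grouplike Hopf algebroids together with the isomorphism classes of locally grouplike principal bimodules form a subcategory $\mathsf{LgHoALGD}$ of it. That is: 1. every locally grouplike Hopf algebroid is principal; 2. a principal bimodule isomorphic to a locally grouplike one is locally grouplike; 3. if $(A,M)$ is locally grouplike, then the $A$-$A$-bimodule $A$ is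 locally grouplike; 4. if $(A,M)$, $(B,N)$, $(C,N')$ are locally grouplike Hopf algebroids, $\mathcal M$ is a locally grouplike principal $A$-$B$-bimodule and $\mathcal N$ is a locally grouplike principal $B$-$C$-bimodule, then $\mathcal M\otimes_B\mathcal N$ is a locally grouplike principal $A$-$C$-bimodule. -/

import Mathlib

open scoped TensorProduct Manifold ContDiff

namespace Algd

/-! ## Tensor products over an algebra that need not be unital or commutative -/

section Balanced

variable {F : Type*} [Field F] {S M N M' N' P : Type*}
  [AddCommGroup M] [Module F M] [AddCommGroup N] [Module F N]
  [AddCommGroup M'] [Module F M'] [AddCommGroup N'] [Module F N']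
  [AddCommGroup P] [Module F P]

/-- The relations `m s ⊗ n = m ⊗ s n`, for a family `ρ` of operators `m ↦ m s` and a family `l` of
operators `n ↦ s n`. -/
def balSub (ρ : S → Module.End F M) (l : S → Module.End F N) : Submodule F (M ⊗[F] N) :=
  Submodule.span F {z | ∃ s m n, z = (ρ s m) ⊗ₜ[F] n - m ⊗ₜ[F] (l s n)}

/-- The balanced tensor product `M ⊗_S N`. For `M ⊗_B N` one takes for `ρ` the right action of `B`
on `M` and for `l` the left action of `B` on `N`; for the tensor product over a commutative algebra
with respect to two left actions, `ρ` is the left action on `M`. -/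
abbrev Bal (ρ : S → Module.End F M) (l : S → Module.End F N) : Type _ :=
  (M ⊗[F] N) ⧸ balSub ρ l

namespace Bal

/-- The projection `M ⊗_F N → M ⊗_S N`. -/
def mk (ρ : S → Module.End F M) (l : S → Module.End F N) : (M ⊗[F] N) →ₗ[F] Bal ρ l :=
  (balSub ρ l).mkQ

/-- The elementary tensors `m ⊗ n` in `M ⊗_S N`, as a bilinear map. -/
def tmul (ρ : S → Module.End F M) (l : S → Module.End F N) : M →ₗ[F] N →ₗ[F] Bal ρ l :=
  (TensorProduct.mk F M N).compr₂ (mk ρ l)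

theorem tmul_bal (ρ : S → Module.End F M) (l : S → Module.End F N) (s : S) (m : M) (n : N) :
    tmul ρ l (ρ s m) n = tmul ρ l m (l s n) := by
  refine (Submodule.Quotient.eq (balSub ρ l)).2 ?_
  exact Submodule.subset_span ⟨s, m, n, rfl⟩

/-- The linear map out of `M ⊗_S N` induced by a balanced bilinear map. -/
def lift (ρ : S → Module.End F M) (l : S → Module.End F N) (f : M →ₗ[F] N →ₗ[F] P)
    (h : ∀ s m n, f (ρ s m) n = f m (l s n)) : Bal ρ l →ₗ[F] P :=
  (balSub ρ l).liftQ (TensorProduct.lift f) (by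
    refine Submodule.span_le.2 ?_
    rintro _ ⟨s, m, n, rfl⟩
    simp [h s m n])

@[simp]
theorem lift_tmul (ρ : S → Module.End F M) (l : S → Module.End F N) (f : M →ₗ[F] N →ₗ[F] P)
    (h : ∀ s m n, f (ρ s m) n = f m (l s n)) (m : M) (n : N) :
    lift ρ l f h (tmul ρ l m n) = f m n := by
  exact TensorProduct.lift.tmul m n

theorem hom_ext {ρ : S → Module.End F M} {l : S → Module.End F N} {f g : Bal ρ l →ₗ[F] P}
    (h : ∀ m n, f (tmul ρ l m n) = g (tmul ρ l m n)) : f = g := by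
  apply Submodule.linearMap_qext
  apply TensorProduct.ext'
  exact h

/-- The map `f ⊗ g : M ⊗_S N → M' ⊗_S N'`. -/
def map {ρ : S → Module.End F M} {l : S → Module.End F N}
    {ρ' : S → Module.End F M'} {l' : S → Module.End F N'}
    (f : M →ₗ[F] M') (g : N →ₗ[F] N')
    (hf : ∀ s m, f (ρ s m) = ρ' s (f m)) (hg : ∀ s n, g (l s n) = l' s (g n)) :
    Bal ρ l →ₗ[F] Bal ρ' l' :=
  lift ρ l ((tmul ρ' l').compl₁₂ f g) (by
    intro s m n
    simp only [LinearMap.compl₁₂_apply]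
    rw [hf, hg, tmul_bal])

@[simp]
theorem map_tmul {ρ : S → Module.End F M} {l : S → Module.End F N}
    {ρ' : S → Module.End F M'} {l' : S → Module.End F N'}
    (f : M →ₗ[F] M') (g : N →ₗ[F] N')
    (hf : ∀ s m, f (ρ s m) = ρ' s (f m)) (hg : ∀ s n, g (l s n) = l' s (g n)) (m : M) (n : N) :
    map f g hf hg (tmul ρ l m n) = tmul ρ' l' (f m) (g n) := by
  simp [map]

end Bal

end Balanced

/-! ## Coalgebras over a commutative algebra -/

section Coalgebra

variable {F : Type*} [Field F]
  {R : Type*} [NonUnitalCommRing R] [Module F R]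
  {C : Type*} [AddCommGroup C] [Module F C]

theorem act_comm (act : R →ₙₐ[F] Module.End F C) (r s : R) (c : C) :
    act r (act s c) = act s (act r c) := by
  rw [← Module.End.mul_apply, ← map_mul, mul_comm, map_mul, Module.End.mul_apply]

/-- The map `f ⊗ g` on `C ⊗_R C`, for two `R`-linear operators `f` and `g` on `C`. -/
def endMap (act : R →ₙₐ[F] Module.End F C) (f g : Module.End F C)
    (hf : ∀ r c, f (act r c) = act r (f c)) (hg : ∀ r c, g (act r c) = act r (g c)) :
    Module.End F (Bal act act) :=
  Bal.map f g hf hg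

/-- The left action `r (c ⊗ c') = r c ⊗ c'` of `R` on `C ⊗_R C`. -/
def balAct (act : R →ₙₐ[F] Module.End F C) (r : R) : Module.End F (Bal act act) :=
  endMap act (act r) LinearMap.id (fun s c => act_comm act r s c) (fun _ _ => rfl)

theorem balAct_tmul (act : R →ₙₐ[F] Module.End F C) (r : R) (c c' : C) :
    balAct act r (Bal.tmul act act c c') = Bal.tmul act act (act r c) c' := by
  simp [balAct, endMap]

/-- `ε ⊗ id : C ⊗_R C → C`, `c ⊗ c' ↦ ε(c) c'`. -/
def counitFst (act : R →ₙₐ[F] Module.End F C) (ε : C →ₗ[F] R)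
    (hε : ∀ r c, ε (act r c) = r * ε c) : Bal act act →ₗ[F] C :=
  Bal.lift act act ((act : R →ₗ[F] Module.End F C) ∘ₗ ε) (by
    intro r c c'
    simp [hε, act_comm act r])

/-- `id ⊗ ε : C ⊗_R C → C`, `c ⊗ c' ↦ ε(c') c`. -/
def counitSnd (act : R →ₙₐ[F] Module.End F C) (ε : C →ₗ[F] R)
    (hε : ∀ r c, ε (act r c) = r * ε c) : Bal act act →ₗ[F] C :=
  Bal.lift act act (((act : R →ₗ[F] Module.End F C) ∘ₗ ε).flip) (by
    intro r c c'
    simp [hε, act_comm act r])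

theorem counitFst_tmul (act : R →ₙₐ[F] Module.End F C) (ε : C →ₗ[F] R)
    (hε : ∀ r c, ε (act r c) = r * ε c) (c c' : C) :
    counitFst act ε hε (Bal.tmul act act c c') = act (ε c) c' :=
  Bal.lift_tmul _ _ _ _ _ _

theorem counitSnd_tmul (act : R →ₙₐ[F] Module.End F C) (ε : C →ₗ[F] R)
    (hε : ∀ r c, ε (act r c) = r * ε c) (c c' : C) :
    counitSnd act ε hε (Bal.tmul act act c c') = act (ε c') c :=
  Bal.lift_tmul _ _ _ _ _ _

/-- The associativity map `(C ⊗_R C) ⊗_R C → C ⊗_R (C ⊗_R C)`. -/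
def assocMap (act : R →ₙₐ[F] Module.End F C) :
    Bal (balAct act) act →ₗ[F] Bal act (balAct act) :=
  Bal.lift _ _
    (Bal.lift act act
      (LinearMap.mk₂ F
        (fun c c' => (Bal.tmul act (balAct act) c) ∘ₗ (Bal.tmul act act c'))
        (by intros; ext; simp) (by intros; ext; simp) (by intros; ext; simp)
        (by intros; ext; simp))
      (by
        intro r c c'
        ext c''
        simp only [LinearMap.mk₂_apply, LinearMap.comp_apply, Bal.tmul_bal, balAct_tmul]))
    (by
      intro r z c''
      have key : ∀ (f g : Bal act act →ₗ[F] Bal act (balAct act)), f = g → f z = g z := by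
        intro f g h; rw [h]
      refine key ((LinearMap.flip (Bal.lift act act _ _) c'') ∘ₗ balAct act r)
        (LinearMap.flip (Bal.lift act act _ _) (act r c'')) ?_
      refine Bal.hom_ext fun c c' => ?_
      simp only [LinearMap.comp_apply, balAct_tmul, LinearMap.flip_apply, Bal.lift_tmul,
        LinearMap.mk₂_apply, Bal.tmul_bal])

theorem assocMap_tmul (act : R →ₙₐ[F] Module.End F C) (c c' c'' : C) :
    assocMap act (Bal.tmul (balAct act) act (Bal.tmul act act c c') c'') =
      Bal.tmul act (balAct act) c (Bal.tmul act act c' c'') := by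
  refine (Bal.lift_tmul _ _ _ _ _ _).trans ?_
  refine (congrArg (fun f : C →ₗ[F] Bal act (balAct act) => f c'')
    (Bal.lift_tmul _ _ _ _ _ _)).trans ?_
  rfl

/-- A left coalgebra over the commutative (not necessarily unital) algebra `R`; the left action of
`R` on the underlying space `C` is `act`. -/
structure LeftCoalgebra (act : R →ₙₐ[F] Module.End F C) where
  unitary : ∀ s : Finset C, ∃ r : R, ∀ c ∈ s, act r c = c
  comul : C →ₗ[F] Bal act act
  counit : C →ₗ[F] R
  comul_act : ∀ r c, comul (act r c) = balAct act r (comul c)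
  counit_act : ∀ r c, counit (act r c) = r * counit c
  counit_comul : ∀ c, counitFst act counit counit_act (comul c) = c
  comul_counit : ∀ c, counitSnd act counit counit_act (comul c) = c
  coassoc : ∀ c,
    assocMap act
      (Bal.map (ρ' := balAct act) (l' := act) comul LinearMap.id comul_act (fun _ _ => rfl)
        (comul c)) =
      Bal.map (ρ' := act) (l' := balAct act) LinearMap.id comul (fun _ _ => rfl) comul_act (comul c)

/-- The tensor `t = ∑ c'ᵢ ⊗ c''ᵢ` over `F` represents `Δ(c)`. -/
def LeftCoalgebra.IsRep {act : R →ₙₐ[F] Module.End F C} (K : LeftCoalgebra act) (c : C)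
    (t : C ⊗[F] C) : Prop :=
  Bal.mk act act t = K.comul c

end Coalgebra

/-! ## Bialgebroids, Hopf algebroids and principal bimodules -/

section Bialgebroid

/-- An `R`-bialgebroid structure on the algebra `A`, where the commutative algebra `R` is
identified with a subalgebra of `A` by the embedding `ι`. -/
structure Bialgebroid (F : Type*) [Field F]
    (R : Type*) [NonUnitalCommRing R] [Module F R]
    (A : Type*) [NonUnitalRing A] [Module F A] [IsScalarTower F A A] [SMulCommClass F A A] where
  ι : R →ₙₐ[F] A
  ι_injective : Function.Injective ι
  localIdentities : ∀ s : Finset A, ∃ r : R, ∀ a ∈ s, ι r * a = a ∧ a * ι r = a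
  coalg : LeftCoalgebra ((NonUnitalAlgHom.lmul F A).comp ι)
  counit_ι : ∀ r, coalg.counit (ι r) = r
  /-- On `R`, the comultiplication is the embedding `r ↦ r ⊗ e`, where `e ∈ R` satisfies
  `e r = r`. -/
  comul_ι : ∀ r e, e * r = r → coalg.IsRep (ι r) (ι r ⊗ₜ[F] ι e)
  /-- The two right `R`-actions on `A ⊗_R A` coincide on `Δ(A)`. -/
  comul_right : ∀ (r : R) (a : A),
    endMap _ (LinearMap.mulRight F (ι r)) LinearMap.id
        (fun s a => by simp [mul_assoc]) (fun _ _ => rfl) (coalg.comul a) =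
      endMap _ LinearMap.id (LinearMap.mulRight F (ι r))
        (fun _ _ => rfl) (fun s a => by simp [mul_assoc]) (coalg.comul a)
  counit_mul : ∀ a b, coalg.counit (a * b) = coalg.counit (a * ι (coalg.counit b))
  /-- `Δ(ab) = Δ(a)Δ(b)`, the product being the componentwise one, computed on arbitrary
  representatives of `Δ(a)` and `Δ(b)`. -/
  comul_mul : ∀ (a b : A) (t u : A ⊗[F] A), coalg.IsRep a t → coalg.IsRep b u →
    coalg.IsRep (a * b) (TensorProduct.map₂ (LinearMap.mul F A) (LinearMap.mul F A) t u)

variable {F : Type*} [Field F]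
  {R : Type*} [NonUnitalCommRing R] [Module F R]
  {A : Type*} [NonUnitalRing A] [Module F A] [IsScalarTower F A A] [SMulCommClass F A A]
  {R' : Type*} [NonUnitalCommRing R'] [Module F R']
  {B : Type*} [NonUnitalRing B] [Module F B] [IsScalarTower F B B] [SMulCommClass F B B]
  {R'' : Type*} [NonUnitalCommRing R''] [Module F R'']
  {C : Type*} [NonUnitalRing C] [Module F C] [IsScalarTower F C C] [SMulCommClass F C C]

/-- The left action of `R` on an `R`-bialgebroid. -/
abbrev Bialgebroid.act (X : Bialgebroid F R A) : R →ₙₐ[F] Module.End F A :=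
  (NonUnitalAlgHom.lmul F A).comp X.ι

/-- The tensor product of two copies of `A` with respect to the right action of `R` on the first
and the left action on the second. -/
abbrev Bialgebroid.TensorRL (X : Bialgebroid F R A) : Type _ :=
  Bal (fun r => LinearMap.mulRight F (X.ι r)) X.act

/-- A bialgebroid is principal if the map `a ⊗ b ↦ Δ(a)(a₀ ⊗ b)`, where `a₀ ∈ R` is any element with
`a₀ b = b`, is an isomorphism from `A ⊗^{rl} A` to `A ⊗^{ll} A`. -/
def Bialgebroid.IsPrincipal (X : Bialgebroid F R A) : Prop :=
  ∃ φ : X.TensorRL ≃ₗ[F] Bal X.act X.act,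
    ∀ (a b : A) (r : R), X.ι r * b = b →
      φ (Bal.tmul _ _ a b) =
        endMap X.act (LinearMap.mulRight F (X.ι r)) (LinearMap.mulRight F b)
          (fun s a => by simp [mul_assoc]) (fun s a => by simp [mul_assoc]) (X.coalg.comul a)

/-- A Hopf algebroid: a bialgebroid with an antipode. -/
structure HopfAlgebroid (F : Type*) [Field F]
    (R : Type*) [NonUnitalCommRing R] [Module F R]
    (A : Type*) [NonUnitalRing A] [Module F A] [IsScalarTower F A A] [SMulCommClass F A A]
    extends Bialgebroid F R A where
  antipode : A →ₗ[F] A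
  antipode_antipode : ∀ a, antipode (antipode a) = a
  antipode_ι : ∀ r, antipode (ι r) = ι r
  antipode_mul : ∀ a b, antipode (a * b) = antipode b * antipode a
  /-- `μ ∘ (S ⊗ id) ∘ Δ = ε ∘ S`. -/
  mul_antipode_comul : ∀ a,
    Bal.lift _ _ ((LinearMap.mul F A) ∘ₗ antipode)
        (fun r a b => by simp [antipode_mul, antipode_ι, mul_assoc]) (coalg.comul a) =
      ι (coalg.counit (antipode a))

universe u

/-- A preprincipal `A`-`B`-bimodule, for bialgebroids `A` and `B`. -/
structure PreprincipalBimodule (X : Bialgebroid F R A) (Y : Bialgebroid F R' B) where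
  carrier : Type u
  [addCommGroup : AddCommGroup carrier]
  [module : Module F carrier]
  /-- `smulL a m` is `a m`. -/
  smulL : A →ₙₐ[F] Module.End F carrier
  /-- `smulR b m` is `m b`. -/
  smulR : B →ₗ[F] Module.End F carrier
  smulR_mul : ∀ b b' m, smulR (b * b') m = smulR b' (smulR b m)
  smul_comm : ∀ a b m, smulL a (smulR b m) = smulR b (smulL a m)
  unitaryR : ∀ s : Finset carrier, ∃ r : R', ∀ m ∈ s, smulR (Y.ι r) m = m
  coalg : LeftCoalgebra (smulL.comp X.ι)
  /-- The two right actions of `R'` on `M ⊗_R M` coincide on `Δ(M)`. -/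
  comul_right : ∀ (r : R') (m : carrier),
    endMap _ (smulR (Y.ι r)) LinearMap.id
        (fun s m => (smul_comm (X.ι s) (Y.ι r) m).symm) (fun _ _ => rfl) (coalg.comul m) =
      endMap _ LinearMap.id (smulR (Y.ι r))
        (fun _ _ => rfl) (fun s m => (smul_comm (X.ι s) (Y.ι r) m).symm) (coalg.comul m)
  counit_smulR : ∀ b m, coalg.counit (smulR b m) = coalg.counit (smulR (Y.ι (Y.coalg.counit b)) m)
  counit_smulL : ∀ a m, coalg.counit (smulL a m) = X.coalg.counit (a * X.ι (coalg.counit m))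
  /-- `Δ(am) = Δ(a)Δ(m)`, computed on arbitrary representatives. -/
  comul_smulL : ∀ (a : A) (m : carrier) (t : A ⊗[F] A) (u : carrier ⊗[F] carrier),
    X.coalg.IsRep a t → coalg.IsRep m u →
    coalg.IsRep (smulL a m) (TensorProduct.map₂ (smulL : A →ₗ[F] Module.End F carrier)
      (smulL : A →ₗ[F] Module.End F carrier) t u)
  /-- `Δ(mb) = Δ(m)Δ(b)`, computed on arbitrary representatives. -/
  comul_smulR : ∀ (b : B) (m : carrier) (t : B ⊗[F] B) (u : carrier ⊗[F] carrier),
    Y.coalg.IsRep b t → coalg.IsRep m u →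
    coalg.IsRep (smulR b m) (TensorProduct.map₂ smulR smulR t u)

attribute [instance] PreprincipalBimodule.addCommGroup PreprincipalBimodule.module

namespace PreprincipalBimodule

variable {X : Bialgebroid F R A} {Y : Bialgebroid F R' B} {Z : Bialgebroid F R'' C}

/-- The left action of `R` on an `A`-`B`-bimodule. -/
abbrev act (M : PreprincipalBimodule.{u} X Y) : R →ₙₐ[F] Module.End F M.carrier :=
  M.smulL.comp X.ι

/-- A preprincipal bimodule is principal if its counit is surjective and the map
`M ⊗_{R'} B → M ⊗_R M`, `m ⊗ b ↦ Δ(m)(b₀ ⊗ b)`, where `b₀ ∈ R'` is any element with `b₀ b = b`, is an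
isomorphism. -/
def IsPrincipal (M : PreprincipalBimodule.{u} X Y) : Prop :=
  Function.Surjective M.coalg.counit ∧
  ∃ φ : Bal (fun r => M.smulR (Y.ι r)) Y.act ≃ₗ[F] Bal M.act M.act,
    ∀ (m : M.carrier) (b : B) (r : R'), Y.ι r * b = b →
      φ (Bal.tmul _ _ m b) =
        endMap M.act (M.smulR (Y.ι r)) (M.smulR b)
          (fun s m => (M.smul_comm (X.ι s) (Y.ι r) m).symm)
          (fun s m => (M.smul_comm (X.ι s) b m).symm) (M.coalg.comul m)

/-- Isomorphisms of preprincipal bimodules: isomorphisms of bimodules and of coalgebras. -/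
structure Iso (M N : PreprincipalBimodule.{u} X Y) where
  toEquiv : M.carrier ≃ₗ[F] N.carrier
  map_smulL : ∀ a m, toEquiv (M.smulL a m) = N.smulL a (toEquiv m)
  map_smulR : ∀ b m, toEquiv (M.smulR b m) = N.smulR b (toEquiv m)
  map_counit : ∀ m, N.coalg.counit (toEquiv m) = M.coalg.counit m
  map_comul : ∀ m, N.coalg.comul (toEquiv m) =
    Bal.map (ρ' := N.act) (l' := N.act) toEquiv.toLinearMap toEquiv.toLinearMap
      (fun s m => map_smulL (X.ι s) m) (fun s m => map_smulL (X.ι s) m) (M.coalg.comul m)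

/-- `P` is (a copy of) the tensor product `M ⊗_B N` with its natural structure: the underlying space
is the balanced tensor product, `a (m ⊗ n) = am ⊗ n`, `(m ⊗ n) c = m ⊗ nc`,
`ε(m ⊗ n) = ε(m ε(n))` and, for any representatives `∑ m'ᵢ ⊗ m''ᵢ` of `Δ(m)` and `∑ n'ⱼ ⊗ n''ⱼ` of
`Δ(n)`, `Δ(m ⊗ n) = ∑ (m'ᵢ ⊗ n'ⱼ) ⊗ (m''ᵢ ⊗ n''ⱼ)`. -/
structure TensorIso (M : PreprincipalBimodule.{u} X Y) (N : PreprincipalBimodule.{u} Y Z)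
    (P : PreprincipalBimodule.{u} X Z) where
  toEquiv : Bal M.smulR N.smulL ≃ₗ[F] P.carrier
  map_smulL : ∀ a m n, P.smulL a (toEquiv (Bal.tmul _ _ m n)) =
    toEquiv (Bal.tmul _ _ (M.smulL a m) n)
  map_smulR : ∀ c m n, P.smulR c (toEquiv (Bal.tmul _ _ m n)) =
    toEquiv (Bal.tmul _ _ m (N.smulR c n))
  map_counit : ∀ m n, P.coalg.counit (toEquiv (Bal.tmul _ _ m n)) =
    M.coalg.counit (M.smulR (Y.ι (N.coalg.counit n)) m)
  map_comul : ∀ (m : M.carrier) (n : N.carrier) (t : M.carrier ⊗[F] M.carrier)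
    (u : N.carrier ⊗[F] N.carrier),
    M.coalg.IsRep m t → N.coalg.IsRep n u →
    P.coalg.IsRep (toEquiv (Bal.tmul _ _ m n))
      (TensorProduct.map₂
        ((Bal.tmul M.smulR N.smulL).compr₂ toEquiv.toLinearMap)
        ((Bal.tmul M.smulR N.smulL).compr₂ toEquiv.toLinearMap) t u)

end PreprincipalBimodule

/-- A bialgebroid `A`, viewed as an `A`-`A`-bimodule. -/
def Bialgebroid.toBimodule {A : Type u} [NonUnitalRing A] [Module F A] [IsScalarTower F A A]
    [SMulCommClass F A A] (X : Bialgebroid F R A) : PreprincipalBimodule.{u} X X where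
  carrier := A
  smulL := NonUnitalAlgHom.lmul F A
  smulR := (LinearMap.mul F A).flip
  smulR_mul := fun b b' m => by simp [mul_assoc]
  smul_comm := fun a b m => by simp [mul_assoc]
  unitaryR := fun s => by
    obtain ⟨r, hr⟩ := X.localIdentities s
    exact ⟨r, fun m hm => by simpa using (hr m hm).2⟩
  coalg := X.coalg
  comul_right := X.comul_right
  counit_smulR := fun b m => by simpa using X.counit_mul m b
  counit_smulL := fun a m => by simpa using X.counit_mul a m
  comul_smulL := fun a m t u ht hu => X.comul_mul a m t u ht hu
  comul_smulR := fun b m t u ht hu => by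
    have h := X.comul_mul m b u t hu ht
    simp only [LinearMap.flip_apply, LinearMap.mul_apply']
    convert h using 1
    clear h ht hu
    induction t with
    | zero => simp
    | add x y hx hy => simp [hx, hy]
    | tmul x y =>
      induction u with
      | zero => simp
      | add x y hx hy => simp only [map_add, LinearMap.add_apply, hx, hy]
      | tmul x y => simp

theorem Bialgebroid.toBimodule_isPrincipal {A : Type u} [NonUnitalRing A] [Module F A]
    [IsScalarTower F A A] [SMulCommClass F A A] (X : Bialgebroid F R A) (h : X.IsPrincipal) :
    X.toBimodule.IsPrincipal :=
  ⟨fun r => ⟨X.ι r, X.counit_ι r⟩, h⟩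

end Bialgebroid

/-! ## Smooth functions with compact support and their germs -/

section Smooth

variable (F : Type) [RCLike F] (d : ℕ) (M : Type*) [TopologicalSpace M]
  [ChartedSpace (EuclideanSpace ℝ (Fin d)) M]

variable {F d M} in
theorem contMDiffAt_mul {f g : M → F} {x : M} (hf : ContMDiffAt (𝓡 d) 𝓘(ℝ, F) ∞ f x)
    (hg : ContMDiffAt (𝓡 d) 𝓘(ℝ, F) ∞ g x) :
    ContMDiffAt (𝓡 d) 𝓘(ℝ, F) ∞ (fun y => f y * g y) x :=
  (contDiff_mul (𝕜 := ℝ) (𝔸 := F)).contMDiff.contMDiffAt.comp x (hf.prodMk_space hg)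

/-- The algebra of smooth `F`-valued functions with compact support on the manifold `M`. -/
def Cc : NonUnitalSubalgebra F (M → F) where
  carrier := {f | ContMDiff (𝓡 d) 𝓘(ℝ, F) ∞ f ∧ HasCompactSupport f}
  add_mem' := fun hf hg => ⟨hf.1.add hg.1, hf.2.add hg.2⟩
  zero_mem' := ⟨contMDiff_const, HasCompactSupport.zero⟩
  mul_mem' := fun hf hg => ⟨fun x => contMDiffAt_mul (hf.1 x) (hg.1 x), hf.2.mul_right⟩
  smul_mem' := fun c _f hf =>
    ⟨fun x => contMDiffAt_mul contMDiffAt_const (hf.1 x), HasCompactSupport.mul_left (f := fun _ => c) hf.2⟩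

/-- The algebra of germs at `x` of smooth `F`-valued functions, defined on neighbourhoods of `x`. -/
def Stalk {M : Type*} [TopologicalSpace M] [ChartedSpace (EuclideanSpace ℝ (Fin d)) M] (x : M) :
    Subring (Filter.Germ (nhds x) F) where
  carrier := {g | ∃ f : M → F, (∀ᶠ y in nhds x, ContMDiffAt (𝓡 d) 𝓘(ℝ, F) ∞ f y) ∧
    g = (f : Filter.Germ (nhds x) F)}
  zero_mem' := ⟨0, Filter.Eventually.of_forall fun _ => contMDiffAt_const, rfl⟩
  one_mem' := ⟨1, Filter.Eventually.of_forall fun _ => contMDiffAt_const, rfl⟩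
  add_mem' := by
    rintro _ _ ⟨f, hf, rfl⟩ ⟨g, hg, rfl⟩
    exact ⟨f + g, by filter_upwards [hf, hg] with y h h' using h.add h', rfl⟩
  mul_mem' := by
    rintro _ _ ⟨f, hf, rfl⟩ ⟨g, hg, rfl⟩
    exact ⟨f * g, by filter_upwards [hf, hg] with y h h' using contMDiffAt_mul h h', rfl⟩
  neg_mem' := by
    rintro _ ⟨f, hf, rfl⟩
    exact ⟨-f, by filter_upwards [hf] with y h using h.neg, rfl⟩

variable {F d M}

/-- The germ `f_x` at `x` of a smooth function with compact support. -/
def germ (x : M) (f : Cc F d M) : Stalk F d x :=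
  ⟨((f : M → F) : Filter.Germ (nhds x) F), f, Filter.Eventually.of_forall fun y => f.2.1 y, rfl⟩

theorem germ_eq_iff (x : M) (f g : Cc F d M) :
    germ x f = germ x g ↔ (f : M → F) =ᶠ[nhds x] (g : M → F) := by
  rw [Subtype.ext_iff]
  exact Filter.Germ.coe_eq

theorem germ_add (x : M) (f g : Cc F d M) : germ x (f + g) = germ x f + germ x g := rfl

theorem germ_mul (x : M) (f g : Cc F d M) : germ x (f * g) = germ x f * germ x g := rfl

theorem germ_zero (x : M) : germ x (0 : Cc F d M) = 0 := rfl

variable [T2Space M] [IsManifold (𝓡 d) ∞ M]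

/-- For a neighbourhood `U` of `x` there is a function with compact support in `U`, equal to `1` near
`x`, such that its product with any function smooth on `U` is smooth. -/
theorem exists_bump (x : M) (U : Set M) (hU : U ∈ nhds x) :
    ∃ h : Cc F d M, germ x h = 1 ∧ tsupport (h : M → F) ⊆ U ∧
      ∀ f : M → F, (∀ y ∈ U, ContMDiffAt (𝓡 d) 𝓘(ℝ, F) ∞ f y) →
        (fun y => (h : M → F) y * f y) ∈ Cc F d M := by
  obtain ⟨b, -, hb⟩ := (SmoothBumpFunction.nhds_basis_tsupport (I := 𝓡 d) x).mem_iff.1 hU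
  have hsub : tsupport (fun y => ((b y : ℝ) : F)) ⊆ tsupport b :=
    closure_mono fun y hy h0 => hy (by simp [h0])
  have hsm : ContMDiff (𝓡 d) 𝓘(ℝ, F) ∞ (fun y => ((b y : ℝ) : F)) :=
    (RCLike.ofRealCLM (K := F)).contMDiff.comp b.contMDiff
  have hc : HasCompactSupport (fun y => ((b y : ℝ) : F)) :=
    b.hasCompactSupport.comp_left (g := fun r : ℝ => (r : F)) (by simp)
  refine ⟨⟨fun y => ((b y : ℝ) : F), hsm, hc⟩, ?_, hsub.trans hb, ?_⟩
  · refine Subtype.ext (Filter.Germ.coe_eq.2 ?_)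
    filter_upwards [b.eventuallyEq_one] with y hy
    simp [hy]
  · intro f hf
    refine ⟨contMDiff_of_tsupport fun y hy => ?_, hc.mul_right⟩
    have hy' : y ∈ tsupport (fun y => ((b y : ℝ) : F)) :=
      closure_mono (fun z (hz : _ * _ ≠ (0 : F)) => left_ne_zero_of_mul hz) hy
    exact contMDiffAt_mul (hsm y) (hf y (hb (hsub hy')))

theorem germ_surjective (x : M) : Function.Surjective (germ x : Cc F d M → Stalk F d x) := by
  rintro ⟨_, f, hf, rfl⟩
  obtain ⟨h, h1, -, h2⟩ := exists_bump (F := F) (d := d) x _ hf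
  refine ⟨⟨_, h2 f fun y hy => hy⟩, Subtype.ext (Filter.Germ.coe_eq.2 ?_)⟩
  have h3 := Filter.Germ.coe_eq.1 (Subtype.ext_iff.1 h1)
  filter_upwards [h3] with y hy
  simp [hy]

/-- If two functions have the same germ at `x`, they become equal after multiplication with some
function that is `1` near `x`. -/
theorem exists_mul_eq (x : M) (f g : Cc F d M) (hfg : germ x f = germ x g) :
    ∃ h : Cc F d M, germ x h = 1 ∧ h * f = h * g := by
  obtain ⟨h, h1, h2, -⟩ := exists_bump (F := F) (d := d) x _ ((germ_eq_iff x f g).1 hfg)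
  refine ⟨h, h1, Subtype.ext (funext fun y => ?_)⟩
  by_cases hy : (h : M → F) y = 0
  · simp [hy]
  · have : (f : M → F) y = (g : M → F) y := h2 (subset_tsupport _ hy)
    simp [this]

theorem exists_mul_left_eq (x : M) (f : Cc F d M) (hf : germ x f = 1) :
    ∃ h : Cc F d M, germ x h = 1 ∧ h * f = h := by
  obtain ⟨h, h1, h2, -⟩ := exists_bump (F := F) (d := d) x {y | (f : M → F) y = 1}
    (Filter.Germ.coe_eq.1 (Subtype.ext_iff.1 hf))
  refine ⟨h, h1, Subtype.ext (funext fun y => ?_)⟩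
  by_cases hy : (h : M → F) y = 0
  · simp [hy]
  · have : (f : M → F) y = 1 := h2 (subset_tsupport _ hy)
    simp [this]

end Smooth

/-! ## Local coalgebras and grouplike elements -/

section Local

set_option linter.unusedSectionVars false

variable {F : Type} [RCLike F] {d : ℕ} {M : Type*} [TopologicalSpace M]
  [ChartedSpace (EuclideanSpace ℝ (Fin d)) M] [T2Space M] [IsManifold (𝓡 d) ∞ M]
  {C : Type*} [AddCommGroup C] [Module F C]

/-- The submodule `N_x(C)` of elements that are annihilated by a function equal to `1` near `x`. -/
def nullSub (act : Cc F d M →ₙₐ[F] Module.End F C) (x : M) : Submodule F C where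
  carrier := {c | ∃ f : Cc F d M, germ x f = 1 ∧ act f c = 0}
  zero_mem' := by
    obtain ⟨f, hf⟩ := germ_surjective (F := F) (d := d) x 1
    exact ⟨f, hf, map_zero _⟩
  add_mem' := by
    rintro a b ⟨f, hf, hfa⟩ ⟨g, hg, hgb⟩
    refine ⟨f * g, by rw [germ_mul, hf, hg, one_mul], ?_⟩
    rw [map_mul, Module.End.mul_apply, map_add, map_add, hgb, map_zero, add_zero, act_comm, hfa,
      map_zero]
  smul_mem' := by
    rintro k a ⟨f, hf, hfa⟩
    exact ⟨f, hf, by rw [map_smul, hfa, smul_zero]⟩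

/-- The localization `C_x = C / N_x(C)`. -/
def LocalMod (act : Cc F d M →ₙₐ[F] Module.End F C) (x : M) : Type _ := C ⧸ nullSub act x

namespace LocalMod

variable (act : Cc F d M →ₙₐ[F] Module.End F C) (x : M)

instance : AddCommGroup (LocalMod act x) := inferInstanceAs (AddCommGroup (C ⧸ nullSub act x))

instance : Module F (LocalMod act x) := inferInstanceAs (Module F (C ⧸ nullSub act x))

/-- The projection `c ↦ c_x` from `C` to `C_x`. -/
def mk : C →ₗ[F] LocalMod act x := (nullSub act x).mkQ

theorem mk_surjective : Function.Surjective (mk act x) := (nullSub act x).mkQ_surjective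

theorem mk_eq_zero_iff (c : C) : mk act x c = 0 ↔ ∃ f : Cc F d M, germ x f = 1 ∧ act f c = 0 :=
  Submodule.Quotient.mk_eq_zero (nullSub act x)

/-- The operator on `C_x` given by a function. -/
def op (f : Cc F d M) : Module.End F (LocalMod act x) :=
  (nullSub act x).mapQ (nullSub act x) (act f) (by
    rintro c ⟨g, hg, hgc⟩
    exact ⟨g, hg, by rw [act_comm, hgc, map_zero]⟩)

theorem op_mk (f : Cc F d M) (c : C) : op act x f (mk act x c) = mk act x (act f c) := rfl

theorem op_congr (f g : Cc F d M) (h : germ x f = germ x g) : op act x f = op act x g := by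
  obtain ⟨k, hk, hkfg⟩ := exists_mul_eq x f g h
  ext z
  obtain ⟨c, rfl⟩ := mk_surjective act x z
  rw [op_mk, op_mk, ← sub_eq_zero, ← map_sub, mk_eq_zero_iff]
  refine ⟨k, hk, ?_⟩
  rw [map_sub, ← Module.End.mul_apply, ← map_mul, hkfg, map_mul, Module.End.mul_apply, sub_self]

/-- The action of germs on `C_x`: `f_x c_x = (f c)_x`. -/
noncomputable instance : SMul (Stalk F d x) (LocalMod act x) where
  smul g z := op act x (Function.surjInv (germ_surjective x) g) z

theorem germ_smul (f : Cc F d M) (z : LocalMod act x) : germ x f • z = op act x f z := by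
  have h : op act x (Function.surjInv (germ_surjective x) (germ x f)) = op act x f :=
    op_congr act x _ _ (Function.surjInv_eq _ _)
  exact congrArg (fun k : Module.End F (LocalMod act x) => k z) h

theorem germ_smul_mk (f : Cc F d M) (c : C) : germ x f • mk act x c = mk act x (act f c) := by
  rw [germ_smul, op_mk]

noncomputable instance : Module (Stalk F d x) (LocalMod act x) where
  one_smul := by
    intro z
    obtain ⟨f, hf⟩ := germ_surjective (F := F) (d := d) x 1
    obtain ⟨c, rfl⟩ := mk_surjective act x z
    rw [← hf, germ_smul_mk, ← sub_eq_zero, ← map_sub, mk_eq_zero_iff]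
    obtain ⟨h, h1, h2⟩ := exists_mul_left_eq x f hf
    refine ⟨h, h1, ?_⟩
    rw [map_sub, ← Module.End.mul_apply, ← map_mul, h2, sub_self]
  mul_smul := by
    intro g g' z
    obtain ⟨f, rfl⟩ := germ_surjective x g
    obtain ⟨f', rfl⟩ := germ_surjective x g'
    obtain ⟨c, rfl⟩ := mk_surjective act x z
    rw [← germ_mul, germ_smul_mk, germ_smul_mk, germ_smul_mk, map_mul, Module.End.mul_apply]
  smul_zero := by
    intro g
    obtain ⟨f, rfl⟩ := germ_surjective x g
    rw [germ_smul, map_zero]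
  smul_add := by
    intro g z z'
    obtain ⟨f, rfl⟩ := germ_surjective x g
    rw [germ_smul, germ_smul, germ_smul, map_add]
  add_smul := by
    intro g g' z
    obtain ⟨f, rfl⟩ := germ_surjective x g
    obtain ⟨f', rfl⟩ := germ_surjective x g'
    obtain ⟨c, rfl⟩ := mk_surjective act x z
    rw [← germ_add, germ_smul_mk, germ_smul_mk, germ_smul_mk, map_add, LinearMap.add_apply, map_add]
  zero_smul := by
    intro z
    obtain ⟨c, rfl⟩ := mk_surjective act x z
    rw [← germ_zero, germ_smul_mk, map_zero, LinearMap.zero_apply, map_zero]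

instance : SMulCommClass (Stalk F d x) F (LocalMod act x) where
  smul_comm := by
    intro g k z
    obtain ⟨f, rfl⟩ := germ_surjective x g
    rw [germ_smul, germ_smul, map_smul]

theorem exists_smul_eq (k : F) : ∃ s : Stalk F d x, ∀ z : LocalMod act x, s • z = k • z := by
  obtain ⟨f, hf⟩ := germ_surjective (F := F) (d := d) x 1
  refine ⟨germ x (k • f), fun z => ?_⟩
  obtain ⟨c, rfl⟩ := mk_surjective act x z
  rw [germ_smul_mk, map_smul, LinearMap.smul_apply, map_smul, ← germ_smul_mk, hf, one_smul]

/-- The projection `C ⊗_{C_c(M)} C → C_x ⊗ C_x`. -/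
noncomputable def projTensor :
    Bal act act →ₗ[F] TensorProduct (Stalk F d x) (LocalMod act x) (LocalMod act x) :=
  Bal.lift act act
    (LinearMap.mk₂ F (fun c c' => mk act x c ⊗ₜ[Stalk F d x] mk act x c')
      (fun c c' c'' => by rw [map_add, TensorProduct.add_tmul])
      (fun k c c' => by rw [map_smul, TensorProduct.smul_tmul'])
      (fun c c' c'' => by rw [map_add, TensorProduct.tmul_add])
      (fun k c c' => by
        obtain ⟨s, hs⟩ := exists_smul_eq act x k
        rw [map_smul, ← hs, ← TensorProduct.smul_tmul, hs, TensorProduct.smul_tmul']))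
    (by
      intro f c c'
      simp only [LinearMap.mk₂_apply]
      rw [← germ_smul_mk, ← germ_smul_mk, TensorProduct.smul_tmul])

theorem projTensor_tmul (c c' : C) : projTensor act x (Bal.tmul act act c c') =
    mk act x c ⊗ₜ[Stalk F d x] mk act x c' := by
  simp [projTensor]

theorem projTensor_balAct (f : Cc F d M) (z : Bal act act) :
    projTensor act x (balAct act f z) = germ x f • projTensor act x z := by
  obtain ⟨t, rfl⟩ := (balSub act act).mkQ_surjective z
  induction t with
  | zero => simp
  | add t u ht hu => rw [map_add, map_add, map_add, map_add, smul_add, ht, hu]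
  | tmul c c' =>
    change projTensor act x (balAct act f (Bal.tmul act act c c')) =
      germ x f • projTensor act x (Bal.tmul act act c c')
    rw [balAct_tmul, projTensor_tmul, projTensor_tmul, ← germ_smul_mk, TensorProduct.smul_tmul']

end LocalMod

variable {act : Cc F d M →ₙₐ[F] Module.End F C}

namespace LeftCoalgebra

/-- The comultiplication `Δ_x : C_x → C_x ⊗ C_x` induced by `Δ`. -/
noncomputable def localComul (K : LeftCoalgebra act) (x : M) :
    LocalMod act x →ₗ[F] TensorProduct (Stalk F d x) (LocalMod act x) (LocalMod act x) :=
  (nullSub act x).liftQ (LocalMod.projTensor act x ∘ₗ K.comul) (by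
    rintro c ⟨f, hf, hfc⟩
    rw [LinearMap.mem_ker, LinearMap.comp_apply, ← one_smul (Stalk F d x) (LocalMod.projTensor _ _ _),
      ← hf, ← LocalMod.projTensor_balAct, ← K.comul_act, hfc, map_zero, map_zero])

/-- The counit `ε_x` induced by `ε`; it takes values in the algebra of germs at `x`. -/
noncomputable def localCounit (K : LeftCoalgebra act) (x : M) : LocalMod act x →+ Stalk F d x :=
  QuotientAddGroup.lift (nullSub act x).toAddSubgroup
    { toFun := fun c => germ x (K.counit c)
      map_zero' := by rw [map_zero, germ_zero]
      map_add' := fun c c' => by rw [map_add, germ_add] }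
    (by
      rintro c ⟨f, hf, hfc⟩
      change germ x (K.counit c) = 0
      rw [← one_mul (germ x (K.counit c)), ← hf, ← germ_mul, ← K.counit_act, hfc, map_zero,
        germ_zero])

theorem localComul_mk (K : LeftCoalgebra act) (x : M) (c : C) :
    K.localComul x (LocalMod.mk act x c) = LocalMod.projTensor act x (K.comul c) := rfl

theorem localCounit_mk (K : LeftCoalgebra act) (x : M) (c : C) :
    K.localCounit x (LocalMod.mk act x c) = germ x (K.counit c) := rfl

/-- The set `G(C_x)` of grouplike elements of the local coalgebra `C_x`. -/
def grouplike (K : LeftCoalgebra act) (x : M) : Set (LocalMod act x) :=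
  {ζ | K.localComul x ζ = ζ ⊗ₜ[Stalk F d x] ζ ∧ K.localCounit x ζ = 1}

end LeftCoalgebra

/-- The set `G` freely generates the module `E` over the commutative ring `S`. -/
def FreelyGenerates (S : Type*) [CommRing S] {E : Type*} [AddCommGroup E] [Module S E]
    (G : Set E) : Prop :=
  LinearIndependent S (Subtype.val : G → E) ∧ Submodule.span S G = ⊤

end Local

/-! ## The Morita category of principal smooth Hopf algebroids -/

section Morita

universe u v

/-- A smooth Hopf algebroid `(A, M)`: a Hopf algebroid `A` over `C_c^∞(M)`, for a Hausdorff
manifold `M`. -/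
structure SmoothHopfAlgebroid (F : Type) [RCLike F] where
  dim : ℕ
  base : Type v
  [topologicalSpace : TopologicalSpace base]
  [chartedSpace : ChartedSpace (EuclideanSpace ℝ (Fin dim)) base]
  [t2Space : T2Space base]
  [isManifold : IsManifold (𝓡 dim) ∞ base]
  carrier : Type u
  [nonUnitalRing : NonUnitalRing carrier]
  [module : Module F carrier]
  [isScalarTower : IsScalarTower F carrier carrier]
  [smulCommClass : SMulCommClass F carrier carrier]
  hopf : HopfAlgebroid F (Cc F dim base) carrier

attribute [instance] SmoothHopfAlgebroid.topologicalSpace SmoothHopfAlgebroid.chartedSpace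
  SmoothHopfAlgebroid.t2Space SmoothHopfAlgebroid.isManifold SmoothHopfAlgebroid.nonUnitalRing
  SmoothHopfAlgebroid.module SmoothHopfAlgebroid.isScalarTower SmoothHopfAlgebroid.smulCommClass

variable {F : Type} [RCLike F]

namespace SmoothHopfAlgebroid

/-- The underlying bialgebroid. -/
abbrev bialg (X : SmoothHopfAlgebroid.{u, v} F) : Bialgebroid F (Cc F X.dim X.base) X.carrier :=
  X.hopf.toBialgebroid

/-- An element `a` is an `S`-invariant weakly grouplike element if there is `a'` with
`Δ(a) = a ⊗ a'` and `Δ(S(a)) = S(a') ⊗ S(a)`. -/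
def IsInvariantWeaklyGrouplike (X : SmoothHopfAlgebroid.{u, v} F) (a : X.carrier) : Prop :=
  ∃ a' : X.carrier, X.bialg.coalg.IsRep a (a ⊗ₜ[F] a') ∧
    X.bialg.coalg.IsRep (X.hopf.antipode a) (X.hopf.antipode a' ⊗ₜ[F] X.hopf.antipode a)

/-- The set `G^S(A_y)` of arrows of `A` with target `y`. -/
def arrows (X : SmoothHopfAlgebroid.{u, v} F) (y : X.base) : Set (LocalMod X.bialg.act y) :=
  {ζ | ∃ a, X.IsInvariantWeaklyGrouplike a ∧ germ y (X.bialg.coalg.counit a) = 1 ∧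
    ζ = LocalMod.mk X.bialg.act y a}

/-- A smooth Hopf algebroid is locally grouplike if each `A_y` is freely generated, over the algebra
of germs at `y`, by the arrows with target `y`. -/
def IsLocallyGrouplike (X : SmoothHopfAlgebroid.{u, v} F) : Prop :=
  ∀ y : X.base, FreelyGenerates (Stalk F X.dim y) (X.arrows y)

end SmoothHopfAlgebroid

/-- The objects of the Morita category of principal smooth Hopf algebroids. -/
structure PrHoALGD (F : Type) [RCLike F] extends SmoothHopfAlgebroid.{u, v} F where
  isPrincipal : hopf.toBialgebroid.IsPrincipal

namespace PrHoALGD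

/-- Principal `A`-`B`-bimodules. -/
structure PrincipalBimodule (X Y : PrHoALGD.{u, v} F) where
  bimod : PreprincipalBimodule.{u} X.bialg Y.bialg
  isPrincipal : bimod.IsPrincipal

/-- A bimodule is locally grouplike if each `M_x` is freely generated, over the algebra of germs at
`x`, by the grouplike elements `G(M_x)`. -/
def PrincipalBimodule.IsLocallyGrouplike {X Y : PrHoALGD.{u, v} F} (M : PrincipalBimodule X Y) :
    Prop :=
  ∀ x : X.base, FreelyGenerates (Stalk F X.dim x) (M.bimod.coalg.grouplike x)

/-- The morphisms from `A` to `B`: isomorphism classes of principal `A`-`B`-bimodules, i.e. the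
quotient of the principal bimodules by the relation of being isomorphic. -/
def Hom (X Y : PrHoALGD.{u, v} F) : Type _ :=
  Quot fun M N : PrincipalBimodule X Y => Nonempty (M.bimod.Iso N.bimod)

/-- The isomorphism class of a principal bimodule. -/
def Hom.mk {X Y : PrHoALGD.{u, v} F} (M : PrincipalBimodule X Y) : Hom X Y := Quot.mk _ M

/-- The isomorphism class of the `A`-`A`-bimodule `A`. -/
def Hom.id (X : PrHoALGD.{u, v} F) : Hom X X :=
  Hom.mk ⟨X.bialg.toBimodule, X.bialg.toBimodule_isPrincipal X.isPrincipal⟩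

/-- The relation that `h` is `f` followed by `g`, composed by the tensor product: there are representatives `M` of
`f`, `N` of `g` and `P` of `h` with `P ≅ M ⊗_B N`. -/
def IsComposite {X Y Z : PrHoALGD.{u, v} F} (f : Hom X Y) (g : Hom Y Z) (h : Hom X Z) : Prop :=
  ∃ M N P, Hom.mk M = f ∧ Hom.mk N = g ∧ Hom.mk P = h ∧
    Nonempty (PreprincipalBimodule.TensorIso M.bimod N.bimod P.bimod)

/-- The operation `comp` is the composition of the Morita category: it is induced by the tensor
product, it is associative, and the classes of the bimodules `A` are units for it. -/
structure IsMoritaComposition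
    (comp : ∀ X Y Z : PrHoALGD.{u, v} F, Hom X Y → Hom Y Z → Hom X Z) : Prop where
  comp_eq_iff : ∀ {X Y Z : PrHoALGD.{u, v} F} (f : Hom X Y) (g : Hom Y Z) (h : Hom X Z),
    comp X Y Z f g = h ↔ IsComposite f g h
  id_comp : ∀ {X Y : PrHoALGD.{u, v} F} (f : Hom X Y), comp X X Y (Hom.id X) f = f
  comp_id : ∀ {X Y : PrHoALGD.{u, v} F} (f : Hom X Y), comp X Y Y f (Hom.id Y) = f
  assoc : ∀ {W X Y Z : PrHoALGD.{u, v} F} (f : Hom W X) (g : Hom X Y) (h : Hom Y Z),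
    comp W Y Z (comp W X Y f g) h = comp W X Z f (comp X Y Z g h)

/-- The Morita category of principal smooth Hopf algebroids. -/
abbrev moritaCategory
    {comp : ∀ X Y Z : PrHoALGD.{u, v} F, Hom X Y → Hom Y Z → Hom X Z}
    (h : IsMoritaComposition comp) : CategoryTheory.Category (PrHoALGD.{u, v} F) where
  Hom := Hom
  id := Hom.id
  comp := fun {X Y Z} f g => comp X Y Z f g
  id_comp := h.id_comp
  comp_id := h.comp_id
  assoc := h.assoc

/-- The objects of the subcategory: the locally grouplike Hopf algebroids. -/
def lgObj (X : PrHoALGD.{u, v} F) : Prop := X.toSmoothHopfAlgebroid.IsLocallyGrouplike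

/-- The morphisms of the subcategory: the classes of locally grouplike principal bimodules. -/
def lgHom (X Y : PrHoALGD.{u, v} F) (f : Hom X Y) : Prop :=
  ∃ M, Hom.mk M = f ∧ M.IsLocallyGrouplike

end PrHoALGD

/-- The class `P` of objects, together with the class `W` of morphisms between them, forms a
subcategory: it contains the identities of its objects and is closed under composition. -/
structure IsSubcategory {𝒞 : Type*} [CategoryTheory.Category 𝒞] (P : 𝒞 → Prop)
    (W : ∀ X Y : 𝒞, (X ⟶ Y) → Prop) : Prop where
  id_mem : ∀ X, P X → W X X (CategoryTheory.CategoryStruct.id X)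
  comp_mem : ∀ {X Y Z : 𝒞} (f : X ⟶ Y) (g : Y ⟶ Z), P X → P Y → P Z → W X Y f → W Y Z g →
    W X Z (CategoryTheory.CategoryStruct.comp f g)

end Morita

end Algd

universe u v

-- Trying these two instances first shortens the search for instances on non-unital rings.
attribute [local instance] AddCommGroup.toAddCommMonoid NonUnitalNonAssocRing.toAddCommGroup

/-! Composition. Write β_M for the canonical map m ⊗ b ↦ Δ(m)(1 ⊗ b) of a bimodule M; principality
says that ε is onto and β_M is bijective (`PreprincipalBimodule.isPrincipal_iff`). The
comultiplication of M ⊗_B N shuffles representatives of Δ(m) and Δ(n). It is well defined because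
the two right actions of the base of B agree on Δ(M) (`shuffle_congr_right`), and its
coassociativity needs the same fact for iterated comultiplications (`shuffle₃_congr_right`). If β_M
and β_N are bijective, the canonical map of M ⊗_B N is inverted by (m ⊗ n) ⊗ (m' ⊗ n') ↦ Σ mᵢ ⊗
β_N⁻¹(n ⊗ bᵢn'), where Σ mᵢ ⊗ bᵢ = β_M⁻¹(m ⊗ m'). The delicate point is that elements of B may be
moved across the first tensor m ⊗ n; this rests on the surjectivity of β_B (`pairingLift_smulR`,
`tensorCan_injective`). Associators and, thanks to local units, unit isomorphisms then turn
isomorphism classes into the morphisms of a category (`isMoritaComposition_comp`).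

Locally grouplike Hopf algebroids are principal. If Δ(a) = a ⊗ a', Δ(S(a)) = S(a') ⊗ S(a) and hε(a)
= h, then ha ⊗ b ↦ ha ⊗ a'b and ha ⊗ b ↦ ha ⊗ S(a)b are inverse to each other. The first is the
canonical map, the second the restriction of a map that the antipode defines on all of A ⊗ A. The
elements ha span A, because they do so at every point and a submodule over functions that is
everything locally is everything (`LeftCoalgebra.eq_top_of_forall_local`).

Locally grouplike bimodules. A basis of grouplike elements contains all grouplike elements, because
an algebra of germs has no idempotents except 0 and 1 (`mem_range_of_grouplike`). So for T = M ⊗_B N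
it is enough to find one grouplike basis of T_x. Pick a grouplike ζ = (m₀)_x in M_x. Since ζg ⊗ ζ =
ζ ⊗ ζg, functions g on the base of B act on ζ by germs at x. As the characters of C_c^∞ are
evaluations, this action comes from a homomorphism θ to the germs at x from the germs at one point
y, the source of ζ (`exists_source`). Now n ↦ m₀ ⊗ n induces a θ-semilinear map N_y → T_x, which
carries a grouplike basis of N_y to a basis of T_x. The images span, since surjectivity of β_M shows
that ζB generates M_x (`span_localR_eq_top`, `span_localTmulRight_eq_top`). They are independent,
since β_M⁻¹ provides dual functionals (`linearIndependent_localTmulRight`). They are grouplike by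
`localTmulRight_mem_grouplike`. -/

namespace Algd

/-! ### Balanced tensor products and their representatives -/

section Balanced

variable {F : Type*} [Field F] {S M N M' N' P : Type*}
  [AddCommGroup M] [Module F M] [AddCommGroup N] [Module F N]
  [AddCommGroup M'] [Module F M'] [AddCommGroup N'] [Module F N']
  [AddCommGroup P] [Module F P]

namespace Bal

variable (ρ : S → Module.End F M) (l : S → Module.End F N)

theorem mk_surjective : Function.Surjective (mk ρ l) := (balSub ρ l).mkQ_surjective

theorem mk_tmul (m : M) (n : N) : mk ρ l (m ⊗ₜ[F] n) = tmul ρ l m n := rfl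

variable {ρ l}

theorem map_mk {ρ' : S → Module.End F M'} {l' : S → Module.End F N'}
    (f : M →ₗ[F] M') (g : N →ₗ[F] N')
    (hf : ∀ s m, f (ρ s m) = ρ' s (f m)) (hg : ∀ s n, g (l s n) = l' s (g n)) (t : M ⊗[F] N) :
    map f g hf hg (mk ρ l t) = mk ρ' l' (TensorProduct.map f g t) := by
  induction t with
  | zero => simp
  | add x y hx hy => simp only [map_add, hx, hy]
  | tmul m n => exact map_tmul f g hf hg m n

/-- The defining relations lie in the kernel of `g`, hence so does the difference of two
representatives. Most later proofs that a formula in representatives of Δ is well defined go through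
this. -/
theorem congr_of_balanced (g : M ⊗[F] N →ₗ[F] P)
    (h : ∀ s m n, g (ρ s m ⊗ₜ n) = g (m ⊗ₜ l s n)) {t t' : M ⊗[F] N}
    (ht : mk ρ l t = mk ρ l t') : g t = g t' := by
  have h1 : t - t' ∈ balSub ρ l := (Submodule.Quotient.eq _).1 ht
  have h2 : balSub ρ l ≤ LinearMap.ker g := by
    refine Submodule.span_le.2 ?_
    rintro _ ⟨s, m, n, rfl⟩
    simp [h s m n]
  exact sub_eq_zero.1 (by rw [← map_sub]; exact h2 h1)

theorem induction_on {p : Bal ρ l → Prop} (z : Bal ρ l) (zero : p 0)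
    (tmul : ∀ m n, p (tmul ρ l m n)) (add : ∀ x y, p x → p y → p (x + y)) : p z := by
  obtain ⟨t, rfl⟩ := mk_surjective ρ l z
  induction t with
  | zero => simpa using zero
  | add x y hx hy => rw [map_add]; exact add _ _ hx hy
  | tmul m n => exact tmul m n

end Bal

end Balanced

/-! ### Coalgebras through F-linear representatives of the comultiplication -/

section Coalgebra

variable {F : Type*} [Field F]
  {R : Type*} [NonUnitalCommRing R] [Module F R]
  {C : Type*} [AddCommGroup C] [Module F C]

theorem endMap_mk (act : R →ₙₐ[F] Module.End F C) (f g : Module.End F C)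
    (hf : ∀ r c, f (act r c) = act r (f c)) (hg : ∀ r c, g (act r c) = act r (g c))
    (t : C ⊗[F] C) :
    endMap act f g hf hg (Bal.mk act act t) = Bal.mk act act (TensorProduct.map f g t) :=
  Bal.map_mk _ _ _ _ t

theorem endMap_tmul (act : R →ₙₐ[F] Module.End F C) (f g : Module.End F C)
    (hf : ∀ r c, f (act r c) = act r (f c)) (hg : ∀ r c, g (act r c) = act r (g c))
    (c c' : C) :
    endMap act f g hf hg (Bal.tmul act act c c') = Bal.tmul act act (f c) (g c') :=
  Bal.map_tmul _ _ _ _ _ _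

theorem balAct_mk (act : R →ₙₐ[F] Module.End F C) (r : R) (t : C ⊗[F] C) :
    balAct act r (Bal.mk act act t) = Bal.mk act act (TensorProduct.map (act r) LinearMap.id t) :=
  endMap_mk _ _ _ _ _ t

/-- The projection `C ⊗_F (C ⊗_F C) → C ⊗_R (C ⊗_R C)`. -/
def mk₃ (act : R →ₙₐ[F] Module.End F C) : C ⊗[F] (C ⊗[F] C) →ₗ[F] Bal act (balAct act) :=
  Bal.mk act (balAct act) ∘ₗ TensorProduct.map LinearMap.id (Bal.mk act act)

theorem mk₃_tmul (act : R →ₙₐ[F] Module.End F C) (c : C) (t : C ⊗[F] C) :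
    mk₃ act (c ⊗ₜ t) = Bal.tmul act (balAct act) c (Bal.mk act act t) := rfl

theorem assocMap_mk (act : R →ₙₐ[F] Module.End F C) (t : C ⊗[F] C) (c : C) :
    assocMap act (Bal.tmul (balAct act) act (Bal.mk act act t) c) =
      mk₃ act (TensorProduct.assoc F C C C (t ⊗ₜ c)) := by
  induction t with
  | zero => simp
  | add x y hx hy => simp only [map_add, LinearMap.add_apply, hx, hy, TensorProduct.add_tmul]
  | tmul a b => exact assocMap_tmul act a b c

/-- The triple analogue of `Bal.congr_of_balanced`: `g` descends first in the two inner legs, for a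
fixed outer element, and then in the outer leg. Both conditions involve the middle leg, because
`balAct` acts on the first factor of the inner product. -/
theorem mk₃_congr {P : Type*} [AddCommGroup P] [Module F P] (act : R →ₙₐ[F] Module.End F C)
    (g : C ⊗[F] (C ⊗[F] C) →ₗ[F] P)
    (h₁ : ∀ r a b c, g (act r a ⊗ₜ (b ⊗ₜ c)) = g (a ⊗ₜ (act r b ⊗ₜ c)))
    (h₂ : ∀ r a b c, g (a ⊗ₜ (act r b ⊗ₜ c)) = g (a ⊗ₜ (b ⊗ₜ act r c)))
    {w w' : C ⊗[F] (C ⊗[F] C)} (hw : mk₃ act w = mk₃ act w') : g w = g w' := by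
  let j : C → Bal act act →ₗ[F] P := fun a =>
    Bal.lift act act (TensorProduct.curry (TensorProduct.curry g a)) (fun r b c => by
      simpa only [TensorProduct.curry_apply] using h₂ r a b c)
  have hj : ∀ a t, j a (Bal.mk act act t) = g (a ⊗ₜ t) := by
    intro a t
    induction t with
    | zero => simp
    | add x y hx hy => simp only [map_add, TensorProduct.tmul_add, hx, hy]
    | tmul b c => exact Bal.lift_tmul _ _ _ _ _ _
  let k : C →ₗ[F] Bal act act →ₗ[F] P :=
    LinearMap.mk₂ F (fun a z => j a z)
      (fun a b z => by
        obtain ⟨t, rfl⟩ := Bal.mk_surjective _ _ z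
        simp only [hj, TensorProduct.add_tmul, map_add])
      (fun a b z => by
        obtain ⟨t, rfl⟩ := Bal.mk_surjective _ _ z
        simp only [hj, ← TensorProduct.smul_tmul', map_smul])
      (fun a z z' => map_add _ _ _) (fun a b z => map_smul _ _ _)
  have hk : ∀ a t, k a (Bal.mk act act t) = g (a ⊗ₜ t) := hj
  let G : Bal act (balAct act) →ₗ[F] P := Bal.lift act (balAct act) k (by
    intro r a z
    obtain ⟨t, rfl⟩ := Bal.mk_surjective _ _ z
    rw [balAct_mk, hk, hk]
    induction t with
    | zero => simp
    | add x y hx hy => simp only [map_add, TensorProduct.tmul_add, hx, hy]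
    | tmul b c => exact h₁ r a b c)
  have hG : ∀ w, G (mk₃ act w) = g w := by
    intro w
    induction w with
    | zero => simp
    | add x y hx hy => simp only [map_add, hx, hy]
    | tmul a t =>
      rw [mk₃_tmul, Bal.lift_tmul, hk]
  rw [← hG, hw, hG]

namespace LeftCoalgebra

variable {act : R →ₙₐ[F] Module.End F C} (K : LeftCoalgebra act)

/-- A vector space is projective, so the comultiplication lifts along the quotient map. Linearity of
the choice is what allows linear maps to be defined through representatives. -/
theorem exists_rep : ∃ D : C →ₗ[F] C ⊗[F] C, ∀ c, K.IsRep c (D c) := by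
  obtain ⟨D, hD⟩ := Module.projective_lifting_property (Bal.mk act act) K.comul
    (Bal.mk_surjective _ _)
  exact ⟨D, fun c => LinearMap.congr_fun hD c⟩

/-- A linear choice of representatives of the comultiplication. -/
noncomputable def rep : C →ₗ[F] C ⊗[F] C := K.exists_rep.choose

theorem isRep_rep (c : C) : K.IsRep c (K.rep c) := K.exists_rep.choose_spec c

theorem mk_rep (c : C) : Bal.mk act act (K.rep c) = K.comul c := K.isRep_rep c

variable {K}

theorem IsRep.eq {c : C} {t : C ⊗[F] C} (h : K.IsRep c t) : Bal.mk act act t = K.comul c := h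

theorem IsRep.counit_fst {c : C} {t : C ⊗[F] C} (h : K.IsRep c t) :
    TensorProduct.lift ((act : R →ₗ[F] Module.End F C) ∘ₗ K.counit) t = c := by
  rw [← K.counit_comul c, ← h.eq]
  rfl

theorem IsRep.counit_snd {c : C} {t : C ⊗[F] C} (h : K.IsRep c t) :
    TensorProduct.lift ((act : R →ₗ[F] Module.End F C) ∘ₗ K.counit).flip t = c := by
  rw [← K.comul_counit c, ← h.eq]
  rfl

variable (K)

theorem assocMap_comul (t : C ⊗[F] C) :
    assocMap act (Bal.map (ρ' := balAct act) (l' := act) K.comul LinearMap.id K.comul_act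
      (fun _ _ => rfl) (Bal.mk act act t)) =
      mk₃ act (TensorProduct.assoc F C C C (TensorProduct.map K.rep LinearMap.id t)) := by
  induction t with
  | zero => simp
  | add x y hx hy => simp only [map_add, hx, hy]
  | tmul a b =>
    rw [Bal.mk_tmul, Bal.map_tmul, ← K.mk_rep, LinearMap.id_apply, assocMap_mk,
      TensorProduct.map_tmul, LinearMap.id_apply]

theorem map_comul_mk (t : C ⊗[F] C) :
    Bal.map (ρ' := act) (l' := balAct act) LinearMap.id K.comul (fun _ _ => rfl) K.comul_act
      (Bal.mk act act t) = mk₃ act (TensorProduct.map LinearMap.id K.rep t) := by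
  induction t with
  | zero => simp
  | add x y hx hy => simp only [map_add, hx, hy]
  | tmul a b =>
    rw [Bal.mk_tmul, Bal.map_tmul, ← K.mk_rep, TensorProduct.map_tmul, mk₃_tmul]

/-- Coassociativity in a form to which `mk₃_congr` applies. -/
theorem coassoc_rep (c : C) :
    mk₃ act (TensorProduct.assoc F C C C (TensorProduct.map K.rep LinearMap.id (K.rep c))) =
      mk₃ act (TensorProduct.map LinearMap.id K.rep (K.rep c)) := by
  rw [← K.assocMap_comul, ← K.map_comul_mk, K.mk_rep]
  exact K.coassoc c

end LeftCoalgebra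

end Coalgebra

end Algd

/-! ### The canonical map of a bimodule and the reformulation of principality -/

namespace Algd

section Bimodule

variable {F : Type*} [Field F]
  {R : Type*} [NonUnitalCommRing R] [Module F R]
  {A : Type*} [NonUnitalRing A] [Module F A] [IsScalarTower F A A] [SMulCommClass F A A]
  {R' : Type*} [NonUnitalCommRing R'] [Module F R']
  {B : Type*} [NonUnitalRing B] [Module F B] [IsScalarTower F B B] [SMulCommClass F B B]
  {R'' : Type*} [NonUnitalCommRing R''] [Module F R'']
  {C : Type*} [NonUnitalRing C] [Module F C] [IsScalarTower F C C] [SMulCommClass F C C]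

theorem Bialgebroid.exists_mul_eq_self (X : Bialgebroid F R A) (r : R) : ∃ e : R, e * r = r := by
  obtain ⟨e, he⟩ := X.localIdentities {X.ι r}
  refine ⟨e, X.ι_injective ?_⟩
  rw [map_mul]
  exact (he _ (Finset.mem_singleton_self _)).1

variable {X : Bialgebroid F R A} {Y : Bialgebroid F R' B} {Z : Bialgebroid F R'' C}

namespace PreprincipalBimodule

section

variable (M : PreprincipalBimodule.{u} X Y)

theorem act_apply (r : R) (m : M.carrier) : M.act r m = M.smulL (X.ι r) m := rfl

theorem smulR_act (r : R) (b : B) (m : M.carrier) :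
    M.smulR b (M.act r m) = M.act r (M.smulR b m) := (M.smul_comm (X.ι r) b m).symm

theorem smulL_mul (a a' : A) (m : M.carrier) : M.smulL (a * a') m = M.smulL a (M.smulL a' m) := by
  rw [map_mul, Module.End.mul_apply]

theorem mk_map_smulR {m : M.carrier} {t : M.carrier ⊗[F] M.carrier} (h : M.coalg.IsRep m t)
    (r : R') : Bal.mk M.act M.act (TensorProduct.map (M.smulR (Y.ι r)) LinearMap.id t) =
      Bal.mk M.act M.act (TensorProduct.map LinearMap.id (M.smulR (Y.ι r)) t) := by
  have h1 := M.comul_right r m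
  rw [← h.eq] at h1
  exact (endMap_mk M.act _ _ _ _ t).symm.trans (h1.trans (endMap_mk M.act _ _ _ _ t))

/-- Applying f ⊗ g to the equality of the two right actions, an element of R' moves across the legs
of Δ(m) even underneath further R-linear operators. -/
theorem mk_map_smulR_comp {m : M.carrier} {t : M.carrier ⊗[F] M.carrier}
    (h : M.coalg.IsRep m t) (r : R') (f g : Module.End F M.carrier)
    (hf : ∀ r c, f (M.act r c) = M.act r (f c)) (hg : ∀ r c, g (M.act r c) = M.act r (g c)) :
    Bal.mk M.act M.act (TensorProduct.map (f * M.smulR (Y.ι r)) g t) =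
      Bal.mk M.act M.act (TensorProduct.map f (g * M.smulR (Y.ι r)) t) := by
  have h1 := congrArg (endMap M.act f g hf hg) (M.mk_map_smulR h r)
  rw [endMap_mk, endMap_mk, TensorProduct.map_map, TensorProduct.map_map] at h1
  exact h1

/-- Multiplicativity gives Δ(mr) = Δ(m)(r ⊗ e) with er = r; moved to the first leg, e is absorbed by
r. -/
theorem isRep_smulR_ι {m : M.carrier} {t : M.carrier ⊗[F] M.carrier} (h : M.coalg.IsRep m t)
    (r : R') : M.coalg.IsRep (M.smulR (Y.ι r) m)
      (TensorProduct.map (M.smulR (Y.ι r)) LinearMap.id t) := by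
  obtain ⟨e, he⟩ := Y.exists_mul_eq_self r
  have h1 := M.comul_smulR _ _ _ _ (Y.comul_ι r e he) h
  rw [TensorProduct.map₂_apply_tmul] at h1
  refine Eq.trans ?_ h1.eq
  have h2 := M.mk_map_smulR_comp h e (M.smulR (Y.ι r)) LinearMap.id
    (fun s c => M.smulR_act s _ c) (fun _ _ => rfl)
  have h3 : M.smulR (Y.ι r) * M.smulR (Y.ι e) = M.smulR (Y.ι r) := by
    ext m
    rw [Module.End.mul_apply, ← M.smulR_mul, ← map_mul, he]
  rw [h3] at h2
  exact h2

theorem isRep_act {m : M.carrier} {t : M.carrier ⊗[F] M.carrier} (h : M.coalg.IsRep m t)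
    (r : R) : M.coalg.IsRep (M.act r m) (TensorProduct.map (M.act r) LinearMap.id t) := by
  have h1 := M.coalg.comul_act r m
  rw [← h.eq, balAct_mk] at h1
  exact h1.symm

/-- The canonical map `m ⊗ b ↦ Δ(m)(1 ⊗ b)`. -/
def can : Bal (fun r => M.smulR (Y.ι r)) Y.act →ₗ[F] Bal M.act M.act :=
  Bal.lift _ _
    (LinearMap.mk₂ F (fun m b => endMap M.act LinearMap.id (M.smulR b) (fun _ _ => rfl)
        (fun s c => M.smulR_act s b c) (M.coalg.comul m))
      (fun m m' b => by simp only [map_add]) (fun k m b => by simp only [map_smul])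
      (fun m b b' => by
        simp only [← M.coalg.mk_rep m, endMap_mk, map_add, TensorProduct.map_add_right,
          LinearMap.add_apply])
      (fun k m b => by
        simp only [← M.coalg.mk_rep m, endMap_mk, map_smul, TensorProduct.map_smul_right,
          LinearMap.smul_apply]))
    (by
      intro r m b
      simp only [LinearMap.mk₂_apply]
      rw [← M.coalg.mk_rep m, ← (M.isRep_smulR_ι (M.coalg.isRep_rep m) r).eq, endMap_mk, endMap_mk]
      -- Balancing: Δ(mr)(1 ⊗ b) = Δ(m)(r ⊗ b), and moving r to the second leg gives Δ(m)(1 ⊗ rb).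
      have h := M.mk_map_smulR_comp (M.coalg.isRep_rep m) r LinearMap.id (M.smulR b)
        (fun _ _ => rfl) (fun s c => M.smulR_act s b c)
      rw [TensorProduct.map_map]
      refine h.trans ?_
      congr 3
      ext c
      exact (M.smulR_mul (Y.ι r) b c).symm)

theorem can_tmul {m : M.carrier} {t : M.carrier ⊗[F] M.carrier} (h : M.coalg.IsRep m t) (b : B) :
    M.can (Bal.tmul _ _ m b) =
      Bal.mk M.act M.act (TensorProduct.map LinearMap.id (M.smulR b) t) := by
  refine (Bal.lift_tmul _ _ _ _ _ _).trans ?_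
  rw [LinearMap.mk₂_apply, ← h.eq, endMap_mk]

/-- The auxiliary unit moves to the second leg, where b absorbs it. Hence the map in the definition
of principality can be written without it. -/
theorem can_tmul_eq (m : M.carrier) (b : B) (r : R') (hr : Y.ι r * b = b) :
    M.can (Bal.tmul _ _ m b) =
      endMap M.act (M.smulR (Y.ι r)) (M.smulR b)
          (fun s m => (M.smul_comm (X.ι s) (Y.ι r) m).symm)
          (fun s m => (M.smul_comm (X.ι s) b m).symm) (M.coalg.comul m) := by
  rw [M.can_tmul (M.coalg.isRep_rep m), ← M.coalg.mk_rep]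
  refine Eq.trans ?_ (endMap_mk M.act _ _ _ _ _).symm
  have h := M.mk_map_smulR_comp (M.coalg.isRep_rep m) r LinearMap.id (M.smulR b)
        (fun _ _ => rfl) (fun s c => M.smulR_act s b c)
  refine Eq.trans ?_ h.symm
  congr 3
  ext c
  rw [Module.End.mul_apply, ← M.smulR_mul, hr]

/-- Every b has a local unit in R', so the prescribed formula determines the isomorphism on
elementary tensors: it is `can`. -/
theorem isPrincipal_iff :
    M.IsPrincipal ↔ Function.Surjective M.coalg.counit ∧ Function.Bijective M.can := by
  refine and_congr_right fun _ => ⟨?_, fun h => ?_⟩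
  · rintro ⟨φ, hφ⟩
    have : φ.toLinearMap = M.can := by
      refine Bal.hom_ext fun m b => ?_
      obtain ⟨r, hr⟩ := Y.localIdentities {b}
      have hr := (hr b (Finset.mem_singleton_self _)).1
      rw [M.can_tmul_eq m b r hr]
      exact hφ m b r hr
    rw [← this]
    exact φ.bijective
  · exact ⟨LinearEquiv.ofBijective M.can h, M.can_tmul_eq⟩

/-- Right multiplication by `b` on `M ⊗_{R'} B`. -/
def canMulRight (b : B) : Module.End F (Bal (fun r => M.smulR (Y.ι r)) Y.act) :=
  Bal.map LinearMap.id (LinearMap.mulRight F b) (fun _ _ => rfl) (fun s c => mul_assoc (Y.ι s) c b)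

theorem canMulRight_tmul (b : B) (m : M.carrier) (c : B) :
    M.canMulRight b (Bal.tmul _ _ m c) = Bal.tmul _ _ m (c * b) :=
  Bal.map_tmul _ _ _ _ _ _

theorem can_mulRight (b : B) (z : Bal (fun r => M.smulR (Y.ι r)) Y.act) :
    M.can (M.canMulRight b z) =
      endMap M.act LinearMap.id (M.smulR b) (fun _ _ => rfl) (fun s c => M.smulR_act s b c)
        (M.can z) := by
  induction z using Bal.induction_on with
  | zero => simp only [map_zero]
  | add x y hx hy => simp only [map_add, hx, hy]
  | tmul m c =>
    rw [canMulRight_tmul, M.can_tmul (M.coalg.isRep_rep m), M.can_tmul (M.coalg.isRep_rep m),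
      endMap_mk, TensorProduct.map_map]
    congr 3
    ext x
    exact M.smulR_mul c b x

end

end PreprincipalBimodule

theorem Bialgebroid.isPrincipal_iff {A : Type u} [NonUnitalRing A] [Module F A]
    [IsScalarTower F A A] [SMulCommClass F A A] (X : Bialgebroid F R A) :
    X.IsPrincipal ↔ Function.Bijective X.toBimodule.can := by
  have h : Function.Surjective X.toBimodule.coalg.counit := fun r => ⟨X.ι r, X.counit_ι r⟩
  exact ⟨fun h => (X.toBimodule.isPrincipal_iff.1 (X.toBimodule_isPrincipal h)).2,
    fun h' => (X.toBimodule.isPrincipal_iff.2 ⟨h, h'⟩).2⟩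

end Bimodule
end Algd

/-! ### The tensor product of bimodules: actions, comultiplication and counit -/

namespace Algd

section Bimodule

variable {F : Type*} [Field F]
  {R : Type*} [NonUnitalCommRing R] [Module F R]
  {A : Type*} [NonUnitalRing A] [Module F A] [IsScalarTower F A A] [SMulCommClass F A A]
  {R' : Type*} [NonUnitalCommRing R'] [Module F R']
  {B : Type*} [NonUnitalRing B] [Module F B] [IsScalarTower F B B] [SMulCommClass F B B]
  {R'' : Type*} [NonUnitalCommRing R''] [Module F R'']
  {C : Type*} [NonUnitalRing C] [Module F C] [IsScalarTower F C C] [SMulCommClass F C C]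

variable {X : Bialgebroid F R A} {Y : Bialgebroid F R' B} {Z : Bialgebroid F R'' C}

namespace PreprincipalBimodule

section

variable (M : PreprincipalBimodule.{u} X Y) (N : PreprincipalBimodule.{u} Y Z)

/-- The space `M ⊗_B N`. -/
def Tensor : Type u := Bal M.smulR N.smulL

instance : AddCommGroup (Tensor M N) := inferInstanceAs (AddCommGroup (Bal M.smulR N.smulL))

instance : Module F (Tensor M N) := inferInstanceAs (Module F (Bal M.smulR N.smulL))

/-- The elementary tensors in `M ⊗_B N`. -/
def tm : M.carrier →ₗ[F] N.carrier →ₗ[F] Tensor M N := Bal.tmul M.smulR N.smulL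

theorem tm_bal (b : B) (m : M.carrier) (n : N.carrier) :
    tm M N (M.smulR b m) n = tm M N m (N.smulL b n) :=
  Bal.tmul_bal M.smulR N.smulL b m n

variable {M N} in
theorem Tensor.induction_on {p : Tensor M N → Prop} (z : Tensor M N) (zero : p 0)
    (tmul : ∀ m n, p (tm M N m n)) (add : ∀ x y, p x → p y → p (x + y)) : p z :=
  Bal.induction_on (p := p) z zero tmul add

section Lift

variable {P : Type*} [AddCommGroup P] [Module F P]

variable {M N} in
/-- The map out of `M ⊗_B N` induced by a balanced bilinear map. -/
def Tensor.lift (f : M.carrier →ₗ[F] N.carrier →ₗ[F] P)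
    (h : ∀ b m n, f (M.smulR b m) n = f m (N.smulL b n)) : Tensor M N →ₗ[F] P :=
  Bal.lift M.smulR N.smulL f h

variable {M N} in
theorem Tensor.lift_tm (f : M.carrier →ₗ[F] N.carrier →ₗ[F] P)
    (h : ∀ b m n, f (M.smulR b m) n = f m (N.smulL b n)) (m : M.carrier) (n : N.carrier) :
    Tensor.lift f h (tm M N m n) = f m n :=
  Bal.lift_tmul M.smulR N.smulL f h m n

variable {M N} in
theorem Tensor.hom_ext {f g : Tensor M N →ₗ[F] P} (h : ∀ m n, f (tm M N m n) = g (tm M N m n)) :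
    f = g :=
  Bal.hom_ext (ρ := M.smulR) (l := N.smulL) h

end Lift

/-- The operators `a ⊗ 1` on `M ⊗_B N`. -/
def tensorLMap (a : A) : Module.End F (Tensor M N) :=
  Tensor.lift ((tm M N) ∘ₗ (M.smulL a)) (fun b m n => by
    rw [LinearMap.comp_apply, M.smul_comm, tm_bal, LinearMap.comp_apply])

theorem tensorLMap_tm (a : A) (m : M.carrier) (n : N.carrier) :
    tensorLMap M N a (tm M N m n) = tm M N (M.smulL a m) n := Tensor.lift_tm _ _ _ _

/-- The left action on `M ⊗_B N`. -/
def tensorL : A →ₙₐ[F] Module.End F (Tensor M N) where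
  toFun a := tensorLMap M N a
  map_smul' k a := Tensor.hom_ext fun m n => by
    rw [tensorLMap_tm, map_smul, LinearMap.smul_apply, map_smul, LinearMap.smul_apply,
      MonoidHom.id_apply, LinearMap.smul_apply, tensorLMap_tm]
  map_zero' := Tensor.hom_ext fun m n => by
    rw [tensorLMap_tm, map_zero, LinearMap.zero_apply, map_zero, LinearMap.zero_apply,
      LinearMap.zero_apply]
  map_add' a a' := Tensor.hom_ext fun m n => by
    rw [tensorLMap_tm, map_add, LinearMap.add_apply, map_add, LinearMap.add_apply,
      LinearMap.add_apply, tensorLMap_tm, tensorLMap_tm]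
  map_mul' a a' := Tensor.hom_ext fun m n => by
    rw [tensorLMap_tm, Module.End.mul_apply, tensorLMap_tm, tensorLMap_tm, M.smulL_mul]

theorem tensorL_tm (a : A) (m : M.carrier) (n : N.carrier) :
    tensorL M N a (tm M N m n) = tm M N (M.smulL a m) n := tensorLMap_tm M N a m n

/-- The operators `1 ⊗ c` on `M ⊗_B N`. -/
def tensorRMap (c : C) : Module.End F (Tensor M N) :=
  Tensor.lift ((tm M N).compl₂ (N.smulR c)) (fun b m n => by
    rw [LinearMap.compl₂_apply, LinearMap.compl₂_apply, tm_bal, N.smul_comm])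

theorem tensorRMap_tm (c : C) (m : M.carrier) (n : N.carrier) :
    tensorRMap M N c (tm M N m n) = tm M N m (N.smulR c n) := Tensor.lift_tm _ _ _ _

/-- The right action on `M ⊗_B N`. -/
def tensorR : C →ₗ[F] Module.End F (Tensor M N) where
  toFun c := tensorRMap M N c
  map_smul' k a := Tensor.hom_ext fun m n => by
    rw [tensorRMap_tm, map_smul, LinearMap.smul_apply, map_smul,
      RingHom.id_apply, LinearMap.smul_apply, tensorRMap_tm]
  map_add' a a' := Tensor.hom_ext fun m n => by
    rw [tensorRMap_tm, map_add, LinearMap.add_apply, map_add,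
      LinearMap.add_apply, tensorRMap_tm, tensorRMap_tm]

theorem tensorR_tm (c : C) (m : M.carrier) (n : N.carrier) :
    tensorR M N c (tm M N m n) = tm M N m (N.smulR c n) := tensorRMap_tm M N c m n

/-- The action of the base algebra on `M ⊗_B N`. -/
def tensorAct : R →ₙₐ[F] Module.End F (Tensor M N) := (tensorL M N).comp X.ι

theorem tensorAct_tm (r : R) (m : M.carrier) (n : N.carrier) :
    tensorAct M N r (tm M N m n) = tm M N (M.act r m) n := tensorL_tm M N _ m n

/-- The map `(m ⊗ m', n ⊗ n') ↦ (m ⊗ n) ⊗ (m' ⊗ n')`. -/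
def shuffle : M.carrier ⊗[F] M.carrier →ₗ[F] N.carrier ⊗[F] N.carrier →ₗ[F]
    Tensor M N ⊗[F] Tensor M N :=
  TensorProduct.map₂ (tm M N) (tm M N)

theorem shuffle_tmul (m m' : M.carrier) (n n' : N.carrier) :
    shuffle M N (m ⊗ₜ m') (n ⊗ₜ n') = tm M N m n ⊗ₜ tm M N m' n' := rfl

/-- R acts on M ⊗_B N through M, so balancing in M becomes balancing in the tensor product. Unlike
in `shuffle_congr_right`, nothing about comultiplications is needed. -/
theorem shuffle_congr_left {t t' : M.carrier ⊗[F] M.carrier}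
    (h : Bal.mk M.act M.act t = Bal.mk M.act M.act t') (u : N.carrier ⊗[F] N.carrier) :
    Bal.mk (tensorAct M N) (tensorAct M N) (shuffle M N t u) =
      Bal.mk (tensorAct M N) (tensorAct M N) (shuffle M N t' u) := by
  refine Bal.congr_of_balanced
    (Bal.mk (tensorAct M N) (tensorAct M N) ∘ₗ (shuffle M N).flip u) (fun r m m' => ?_) h
  simp only [LinearMap.comp_apply, LinearMap.flip_apply]
  induction u with
  | zero => simp only [map_zero]
  | add x y hx hy => simp only [map_add, hx, hy]
  | tmul n n' =>
    rw [shuffle_tmul, shuffle_tmul, ← tensorAct_tm, ← tensorAct_tm, Bal.mk_tmul, Bal.mk_tmul,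
      Bal.tmul_bal]

theorem shuffle_map_smulR (b b' : B) (t : M.carrier ⊗[F] M.carrier)
    (u : N.carrier ⊗[F] N.carrier) :
    shuffle M N (TensorProduct.map (M.smulR b) (M.smulR b') t) u =
      shuffle M N t (TensorProduct.map (N.smulL b) (N.smulL b') u) := by
  induction t with
  | zero => simp only [map_zero, LinearMap.zero_apply]
  | add x y hx hy => simp only [map_add, LinearMap.add_apply, hx, hy]
  | tmul m m' =>
    induction u with
    | zero => simp only [map_zero]
    | add x y hx hy => simp only [map_add, hx, hy]
    | tmul n n' => simp only [TensorProduct.map_tmul, shuffle_tmul, tm_bal]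

theorem shuffle_map_smulR_left (b : B) (t : M.carrier ⊗[F] M.carrier)
    (u : N.carrier ⊗[F] N.carrier) :
    shuffle M N (TensorProduct.map (M.smulR b) LinearMap.id t) u =
      shuffle M N t (TensorProduct.map (N.smulL b) LinearMap.id u) := by
  induction t with
  | zero => simp only [map_zero, LinearMap.zero_apply]
  | add x y hx hy => simp only [map_add, LinearMap.add_apply, hx, hy]
  | tmul m m' =>
    induction u with
    | zero => simp only [map_zero]
    | add x y hx hy => simp only [map_add, hx, hy]
    | tmul n n' => simp only [TensorProduct.map_tmul, shuffle_tmul, tm_bal, LinearMap.id_apply]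

theorem shuffle_map_smulR_right (b : B) (t : M.carrier ⊗[F] M.carrier)
    (u : N.carrier ⊗[F] N.carrier) :
    shuffle M N (TensorProduct.map LinearMap.id (M.smulR b) t) u =
      shuffle M N t (TensorProduct.map LinearMap.id (N.smulL b) u) := by
  induction t with
  | zero => simp only [map_zero, LinearMap.zero_apply]
  | add x y hx hy => simp only [map_add, LinearMap.add_apply, hx, hy]
  | tmul m m' =>
    induction u with
    | zero => simp only [map_zero]
    | add x y hx hy => simp only [map_add, hx, hy]
    | tmul n n' => simp only [TensorProduct.map_tmul, shuffle_tmul, tm_bal, LinearMap.id_apply]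

theorem shuffle_map₂ (s : B ⊗[F] B) (t : M.carrier ⊗[F] M.carrier)
    (u : N.carrier ⊗[F] N.carrier) :
    shuffle M N (TensorProduct.map₂ M.smulR M.smulR s t) u =
      shuffle M N t (TensorProduct.map₂ (N.smulL : B →ₗ[F] Module.End F N.carrier)
        (N.smulL : B →ₗ[F] Module.End F N.carrier) s u) := by
  induction s with
  | zero => simp only [map_zero, LinearMap.zero_apply]
  | add x y hx hy => simp only [map_add, LinearMap.add_apply, hx, hy]
  | tmul b b' => exact shuffle_map_smulR M N b b' t u

/-- An element of R' on one leg of `u` passes across B to the same leg of `t`; there the two right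
actions agree, because `t` represents a comultiplication. -/
theorem shuffle_congr_right {m : M.carrier} {t : M.carrier ⊗[F] M.carrier}
    (ht : M.coalg.IsRep m t) {u u' : N.carrier ⊗[F] N.carrier}
    (h : Bal.mk N.act N.act u = Bal.mk N.act N.act u') :
    Bal.mk (tensorAct M N) (tensorAct M N) (shuffle M N t u) =
      Bal.mk (tensorAct M N) (tensorAct M N) (shuffle M N t u') := by
  refine Bal.congr_of_balanced
    (Bal.mk (tensorAct M N) (tensorAct M N) ∘ₗ shuffle M N t) (fun r n n' => ?_) h
  have h1 := shuffle_congr_left M N (M.mk_map_smulR ht r) (n ⊗ₜ n')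
  rw [shuffle_map_smulR_left, shuffle_map_smulR_right] at h1
  exact h1

theorem shuffle_congr {m : M.carrier} {t t' : M.carrier ⊗[F] M.carrier}
    (ht : M.coalg.IsRep m t) (ht' : M.coalg.IsRep m t') {n : N.carrier}
    {u u' : N.carrier ⊗[F] N.carrier} (hu : N.coalg.IsRep n u) (hu' : N.coalg.IsRep n u') :
    Bal.mk (tensorAct M N) (tensorAct M N) (shuffle M N t u) =
      Bal.mk (tensorAct M N) (tensorAct M N) (shuffle M N t' u') :=
  (shuffle_congr_left M N (ht.eq.trans ht'.eq.symm) u).trans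
    (shuffle_congr_right M N ht' (hu.eq.trans hu'.eq.symm))

/-- The comultiplication of `M ⊗_B N`. -/
noncomputable def tensorComul :
    Tensor M N →ₗ[F] Bal (tensorAct M N) (tensorAct M N) :=
  Tensor.lift (((shuffle M N).compl₁₂ M.coalg.rep N.coalg.rep).compr₂
      (Bal.mk (tensorAct M N) (tensorAct M N))) (by
    intro b m n
    simp only [LinearMap.compr₂_apply, LinearMap.compl₁₂_apply]
    have h1 := M.comul_smulR _ _ _ _ (Y.coalg.isRep_rep b) (M.coalg.isRep_rep m)
    have h2 := N.comul_smulL _ _ _ _ (Y.coalg.isRep_rep b) (N.coalg.isRep_rep n)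
    -- Both sides combine Δ(m), Δ(b) and Δ(n): on the left Δ(b) acts on Δ(m), on the right on Δ(n),
    -- and `shuffle_map₂` passes it across.
    refine (shuffle_congr_left M N ((M.coalg.isRep_rep _).eq.trans h1.eq.symm) _).trans ?_
    rw [shuffle_map₂]
    exact shuffle_congr_right M N (M.coalg.isRep_rep m)
      (h2.eq.trans (N.coalg.isRep_rep _).eq.symm))

theorem tensorComul_tm {m : M.carrier} {n : N.carrier} {t : M.carrier ⊗[F] M.carrier}
    {u : N.carrier ⊗[F] N.carrier} (ht : M.coalg.IsRep m t) (hu : N.coalg.IsRep n u) :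
    tensorComul M N (tm M N m n) =
      Bal.mk (tensorAct M N) (tensorAct M N) (shuffle M N t u) := by
  refine (Tensor.lift_tm _ _ _ _).trans ?_
  exact shuffle_congr M N (M.coalg.isRep_rep m) ht (N.coalg.isRep_rep n) hu

/-- The counit of `M ⊗_B N`. -/
def tensorCounit : Tensor M N →ₗ[F] R :=
  Tensor.lift (LinearMap.mk₂ F (fun m n => M.coalg.counit (M.smulR (Y.ι (N.coalg.counit n)) m))
      (fun m m' n => by simp only [map_add]) (fun k m n => by simp only [map_smul])
      (fun m n n' => by simp only [map_add, LinearMap.add_apply])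
      (fun k m n => by simp only [map_smul, LinearMap.smul_apply])) (by
    intro b m n
    simp only [LinearMap.mk₂_apply]
    rw [N.counit_smulL, ← M.counit_smulR, M.smulR_mul])

theorem tensorCounit_tm (m : M.carrier) (n : N.carrier) :
    tensorCounit M N (tm M N m n) = M.coalg.counit (M.smulR (Y.ι (N.coalg.counit n)) m) :=
  Tensor.lift_tm _ _ _ _

/-- The map `(m ⊗ (m' ⊗ m''), n ⊗ (n' ⊗ n'')) ↦ (m ⊗ n) ⊗ ((m' ⊗ n') ⊗ (m'' ⊗ n''))`. -/
def shuffle₃ : M.carrier ⊗[F] (M.carrier ⊗[F] M.carrier) →ₗ[F]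
    N.carrier ⊗[F] (N.carrier ⊗[F] N.carrier) →ₗ[F]
    Tensor M N ⊗[F] (Tensor M N ⊗[F] Tensor M N) :=
  TensorProduct.map₂ (tm M N) (shuffle M N)

theorem mk₃_shuffle₃ (a b c : M.carrier) (n n' n'' : N.carrier) :
    mk₃ (tensorAct M N) (shuffle₃ M N (a ⊗ₜ (b ⊗ₜ c)) (n ⊗ₜ (n' ⊗ₜ n''))) =
      Bal.tmul (tensorAct M N) (balAct (tensorAct M N)) (tm M N a n)
        (Bal.tmul (tensorAct M N) (tensorAct M N) (tm M N b n') (tm M N c n'')) := rfl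

theorem shuffle₃_congr_left {t t' : M.carrier ⊗[F] (M.carrier ⊗[F] M.carrier)}
    (h : mk₃ M.act t = mk₃ M.act t') (u : N.carrier ⊗[F] (N.carrier ⊗[F] N.carrier)) :
    mk₃ (tensorAct M N) (shuffle₃ M N t u) = mk₃ (tensorAct M N) (shuffle₃ M N t' u) := by
  refine mk₃_congr M.act (mk₃ (tensorAct M N) ∘ₗ (shuffle₃ M N).flip u) ?_ ?_ h
  · intro r a b c
    simp only [LinearMap.comp_apply, LinearMap.flip_apply]
    induction u with
    | zero => simp only [map_zero]
    | add x y hx hy => simp only [map_add, hx, hy]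
    | tmul n u =>
      induction u with
      | zero => simp only [map_zero, TensorProduct.tmul_zero]
      | add x y hx hy => simp only [map_add, TensorProduct.tmul_add, hx, hy]
      | tmul n' n'' =>
        have h := Bal.tmul_bal (tensorAct M N) (balAct (tensorAct M N)) r (tm M N a n)
          (Bal.tmul (tensorAct M N) (tensorAct M N) (tm M N b n') (tm M N c n''))
        simp only [balAct_tmul, tensorAct_tm] at h
        rw [mk₃_shuffle₃, mk₃_shuffle₃, h]
  · intro r a b c
    simp only [LinearMap.comp_apply, LinearMap.flip_apply]
    induction u with
    | zero => simp only [map_zero]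
    | add x y hx hy => simp only [map_add, hx, hy]
    | tmul n u =>
      induction u with
      | zero => simp only [map_zero, TensorProduct.tmul_zero]
      | add x y hx hy => simp only [map_add, TensorProduct.tmul_add, hx, hy]
      | tmul n' n'' =>
        have h := Bal.tmul_bal (tensorAct M N) (tensorAct M N) r (tm M N b n') (tm M N c n'')
        simp only [tensorAct_tm] at h
        rw [mk₃_shuffle₃, mk₃_shuffle₃, h]

end

end PreprincipalBimodule

end Bimodule
end Algd

/-! ### Coassociativity of the tensor product -/

namespace Algd

section Bimodule

variable {F : Type*} [Field F]
  {R : Type*} [NonUnitalCommRing R] [Module F R]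
  {A : Type*} [NonUnitalRing A] [Module F A] [IsScalarTower F A A] [SMulCommClass F A A]
  {R' : Type*} [NonUnitalCommRing R'] [Module F R']
  {B : Type*} [NonUnitalRing B] [Module F B] [IsScalarTower F B B] [SMulCommClass F B B]
  {R'' : Type*} [NonUnitalCommRing R''] [Module F R'']
  {C : Type*} [NonUnitalRing C] [Module F C] [IsScalarTower F C C] [SMulCommClass F C C]

variable {X : Bialgebroid F R A} {Y : Bialgebroid F R' B} {Z : Bialgebroid F R'' C}

namespace PreprincipalBimodule

section

variable (M : PreprincipalBimodule.{u} X Y) (N : PreprincipalBimodule.{u} Y Z)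

theorem mk₃_map_congr_right {D : Type*} [AddCommGroup D] [Module F D]
    (act : R →ₙₐ[F] Module.End F D) {f g : D →ₗ[F] D ⊗[F] D}
    (h : ∀ c, Bal.mk act act (f c) = Bal.mk act act (g c)) (t : D ⊗[F] D) :
    mk₃ act (TensorProduct.map LinearMap.id f t) = mk₃ act (TensorProduct.map LinearMap.id g t) := by
  induction t with
  | zero => simp only [map_zero]
  | add x y hx hy => simp only [map_add, hx, hy]
  | tmul a b => rw [TensorProduct.map_tmul, TensorProduct.map_tmul, mk₃_tmul, mk₃_tmul, h]

theorem mk₃_map_congr_left {D : Type*} [AddCommGroup D] [Module F D]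
    (act : R →ₙₐ[F] Module.End F D) {f g : D →ₗ[F] D ⊗[F] D}
    (h : ∀ c, Bal.mk act act (f c) = Bal.mk act act (g c)) (t : D ⊗[F] D) :
    mk₃ act (TensorProduct.assoc F D D D (TensorProduct.map f LinearMap.id t)) =
      mk₃ act (TensorProduct.assoc F D D D (TensorProduct.map g LinearMap.id t)) := by
  induction t with
  | zero => simp only [map_zero]
  | add x y hx hy => simp only [map_add, hx, hy]
  | tmul a b =>
    rw [TensorProduct.map_tmul, TensorProduct.map_tmul, ← assocMap_mk, ← assocMap_mk, h]

theorem assoc_shuffle (t : M.carrier ⊗[F] M.carrier) (u : N.carrier ⊗[F] N.carrier)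
    (m : M.carrier) (n : N.carrier) :
    TensorProduct.assoc F _ _ _ (shuffle M N t u ⊗ₜ tm M N m n) =
      shuffle₃ M N (TensorProduct.assoc F _ _ _ (t ⊗ₜ m))
        (TensorProduct.assoc F _ _ _ (u ⊗ₜ n)) := by
  induction t with
  | zero => simp only [map_zero, LinearMap.zero_apply, TensorProduct.zero_tmul]
  | add x y hx hy => simp only [map_add, LinearMap.add_apply, TensorProduct.add_tmul, hx, hy]
  | tmul a b =>
    induction u with
    | zero => simp only [map_zero, TensorProduct.zero_tmul]
    | add x y hx hy => simp only [map_add, TensorProduct.add_tmul, hx, hy]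
    | tmul a' b' => rfl

theorem assocMap_tensorComul (t : M.carrier ⊗[F] M.carrier) (u : N.carrier ⊗[F] N.carrier)
    (h : ∀ r z, tensorComul M N (tensorAct M N r z) = balAct (tensorAct M N) r (tensorComul M N z)) :
    assocMap (tensorAct M N) (Bal.map (ρ' := balAct (tensorAct M N)) (l' := tensorAct M N)
      (tensorComul M N) LinearMap.id h (fun _ _ => rfl)
        (Bal.mk (tensorAct M N) (tensorAct M N) (shuffle M N t u))) =
      mk₃ (tensorAct M N) (shuffle₃ M N
        (TensorProduct.assoc F _ _ _ (TensorProduct.map M.coalg.rep LinearMap.id t))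
        (TensorProduct.assoc F _ _ _ (TensorProduct.map N.coalg.rep LinearMap.id u))) := by
  induction t with
  | zero => simp only [map_zero, LinearMap.zero_apply]
  | add x y hx hy => simp only [map_add, LinearMap.add_apply, hx, hy]
  | tmul a b =>
    induction u with
    | zero => simp only [map_zero]
    | add x y hx hy => simp only [map_add, hx, hy]
    | tmul a' b' =>
      rw [shuffle_tmul, Bal.mk_tmul, Bal.map_tmul,
        tensorComul_tm M N (M.coalg.isRep_rep a) (N.coalg.isRep_rep a'), LinearMap.id_apply,
        assocMap_mk, assoc_shuffle]
      rfl

theorem map_tensorComul_mk (t : M.carrier ⊗[F] M.carrier) (u : N.carrier ⊗[F] N.carrier)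
    (h : ∀ r z, tensorComul M N (tensorAct M N r z) = balAct (tensorAct M N) r (tensorComul M N z)) :
    Bal.map (ρ' := tensorAct M N) (l' := balAct (tensorAct M N))
      LinearMap.id (tensorComul M N) (fun _ _ => rfl) h
        (Bal.mk (tensorAct M N) (tensorAct M N) (shuffle M N t u)) =
      mk₃ (tensorAct M N) (shuffle₃ M N (TensorProduct.map LinearMap.id M.coalg.rep t)
        (TensorProduct.map LinearMap.id N.coalg.rep u)) := by
  induction t with
  | zero => simp only [map_zero, LinearMap.zero_apply]
  | add x y hx hy => simp only [map_add, LinearMap.add_apply, hx, hy]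
  | tmul a b =>
    induction u with
    | zero => simp only [map_zero]
    | add x y hx hy => simp only [map_add, hx, hy]
    | tmul a' b' =>
      rw [shuffle_tmul, Bal.mk_tmul, Bal.map_tmul,
        tensorComul_tm M N (M.coalg.isRep_rep b) (N.coalg.isRep_rep b'), LinearMap.id_apply,
        ← mk₃_tmul]
      rfl

/-- Formulated for operators adjoint to each other under `tm`, so that each leg can independently
carry an element of B or the identity. -/
theorem shuffle₃_map_smulR (b b' b'' : Module.End F M.carrier) (c c' c'' : Module.End F N.carrier)
    (h : ∀ m n, tm M N (b m) n = tm M N m (c n)) (h' : ∀ m n, tm M N (b' m) n = tm M N m (c' n))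
    (h'' : ∀ m n, tm M N (b'' m) n = tm M N m (c'' n))
    (t : M.carrier ⊗[F] (M.carrier ⊗[F] M.carrier))
    (u : N.carrier ⊗[F] (N.carrier ⊗[F] N.carrier)) :
    shuffle₃ M N (TensorProduct.map b (TensorProduct.map b' b'') t) u =
      shuffle₃ M N t (TensorProduct.map c (TensorProduct.map c' c'') u) := by
  have key : ∀ (m m' m'' : M.carrier) (n n' n'' : N.carrier),
      shuffle₃ M N (m ⊗ₜ (m' ⊗ₜ m'')) (n ⊗ₜ (n' ⊗ₜ n'')) =
        tm M N m n ⊗ₜ (tm M N m' n' ⊗ₜ tm M N m'' n'') := fun _ _ _ _ _ _ => rfl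
  induction t with
  | zero => simp only [map_zero, LinearMap.zero_apply]
  | add x y hx hy => simp only [map_add, LinearMap.add_apply, hx, hy]
  | tmul m t =>
    induction t with
    | zero => simp only [map_zero, LinearMap.zero_apply, TensorProduct.tmul_zero]
    | add x y hx hy => simp only [map_add, LinearMap.add_apply, TensorProduct.tmul_add, hx, hy]
    | tmul m' m'' =>
      induction u with
      | zero => simp only [map_zero]
      | add x y hx hy => simp only [map_add, hx, hy]
      | tmul n u =>
        induction u with
        | zero => simp only [map_zero, TensorProduct.tmul_zero]
        | add x y hx hy => simp only [map_add, TensorProduct.tmul_add, hx, hy]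
        | tmul n' n'' => simp only [TensorProduct.map_tmul, key, h, h', h'']

/-- The second and third legs of (id ⊗ Δ)Δ(m) come from one comultiplication, so r moves between
them. -/
theorem mk₃_map_smulR_right (m : M.carrier) (r : R') :
    mk₃ M.act (TensorProduct.map LinearMap.id (TensorProduct.map (M.smulR (Y.ι r)) LinearMap.id)
      (TensorProduct.map LinearMap.id M.coalg.rep (M.coalg.rep m))) =
    mk₃ M.act (TensorProduct.map LinearMap.id (TensorProduct.map LinearMap.id (M.smulR (Y.ι r)))
      (TensorProduct.map LinearMap.id M.coalg.rep (M.coalg.rep m))) := by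
  rw [TensorProduct.map_map, TensorProduct.map_map]
  exact mk₃_map_congr_right M.act
    (f := TensorProduct.map (M.smulR (Y.ι r)) LinearMap.id ∘ₗ M.coalg.rep)
    (g := TensorProduct.map LinearMap.id (M.smulR (Y.ι r)) ∘ₗ M.coalg.rep)
    (fun c => M.mk_map_smulR (M.coalg.isRep_rep c) r) _

/-- The first two legs of (id ⊗ Δ)Δ(m) do not come from one comultiplication. Coassociativity
replaces the tensor by (Δ ⊗ id)Δ(m), where they do. -/
theorem mk₃_map_smulR_left (m : M.carrier) (r : R') :
    mk₃ M.act (TensorProduct.map (M.smulR (Y.ι r))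
      (TensorProduct.map LinearMap.id LinearMap.id)
      (TensorProduct.map LinearMap.id M.coalg.rep (M.coalg.rep m))) =
    mk₃ M.act (TensorProduct.map LinearMap.id
      (TensorProduct.map (M.smulR (Y.ι r)) LinearMap.id)
      (TensorProduct.map LinearMap.id M.coalg.rep (M.coalg.rep m))) := by
  have key : ∀ (f g : Module.End F M.carrier) (_ : ∀ r c, f (M.act r c) = M.act r (f c))
      (_ : ∀ r c, g (M.act r c) = M.act r (g c)),
      mk₃ M.act (TensorProduct.map f (TensorProduct.map g LinearMap.id)
        (TensorProduct.map LinearMap.id M.coalg.rep (M.coalg.rep m))) =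
      mk₃ M.act (TensorProduct.assoc F _ _ _ (TensorProduct.map
        (TensorProduct.map f g ∘ₗ M.coalg.rep) LinearMap.id (M.coalg.rep m))) := by
    intro f g hf hg
    -- The operator f ⊗ g ⊗ id is R-linear in each leg, hence it preserves the coassociativity
    -- identity.
    have h1 := mk₃_congr M.act (mk₃ M.act ∘ₗ TensorProduct.map f (TensorProduct.map g LinearMap.id))
      (fun r a b c => by
        have h := Bal.tmul_bal M.act (balAct M.act) r (f a) (Bal.tmul M.act M.act (g b) c)
        rw [balAct_tmul] at h
        simp only [LinearMap.comp_apply, TensorProduct.map_tmul, hf, hg]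
        exact h)
      (fun r a b c => by
        have h := Bal.tmul_bal M.act M.act r (g b) c
        simp only [LinearMap.comp_apply, TensorProduct.map_tmul, hg, mk₃_tmul, Bal.mk_tmul,
          LinearMap.id_apply, h])
      (M.coalg.coassoc_rep m)
    refine h1.symm.trans ?_
    rw [LinearMap.comp_apply]
    congr 1
    generalize M.coalg.rep m = t
    induction t with
    | zero => simp only [map_zero]
    | add x y hx hy => simp only [map_add, hx, hy]
    | tmul a b =>
      rw [TensorProduct.map_tmul, TensorProduct.map_tmul, LinearMap.comp_apply]
      generalize M.coalg.rep a = s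
      induction s with
      | zero => simp only [map_zero, TensorProduct.zero_tmul]
      | add x y hx hy => simp only [map_add, TensorProduct.add_tmul, hx, hy]
      | tmul c d => rfl
  have hR : ∀ s c, M.smulR (Y.ι r) (M.act s c) = M.act s (M.smulR (Y.ι r) c) :=
    fun s c => M.smulR_act s _ c
  rw [key (M.smulR (Y.ι r)) LinearMap.id hR (fun _ _ => rfl),
    key LinearMap.id (M.smulR (Y.ι r)) (fun _ _ => rfl) hR]
  exact mk₃_map_congr_left M.act (fun c => M.mk_map_smulR (M.coalg.isRep_rep c) r) _

/-- The triple version of `shuffle_congr_right`: each balancing relation in N is carried across B to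
M, where the iterated comultiplication of m lets an element of R' move between adjacent legs. -/
theorem shuffle₃_congr_right (m : M.carrier)
    {u u' : N.carrier ⊗[F] (N.carrier ⊗[F] N.carrier)} (h : mk₃ N.act u = mk₃ N.act u') :
    mk₃ (tensorAct M N) (shuffle₃ M N
      (TensorProduct.map LinearMap.id M.coalg.rep (M.coalg.rep m)) u) =
    mk₃ (tensorAct M N) (shuffle₃ M N
      (TensorProduct.map LinearMap.id M.coalg.rep (M.coalg.rep m)) u') := by
  refine mk₃_congr N.act (mk₃ (tensorAct M N) ∘ₗ shuffle₃ M N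
    (TensorProduct.map LinearMap.id M.coalg.rep (M.coalg.rep m))) ?_ ?_ h
  · intro r a b c
    have h1 := shuffle₃_congr_left M N (mk₃_map_smulR_left M m r) (a ⊗ₜ (b ⊗ₜ c))
    rw [shuffle₃_map_smulR M N (M.smulR (Y.ι r)) LinearMap.id LinearMap.id (N.smulL (Y.ι r))
        LinearMap.id LinearMap.id (fun _ _ => tm_bal _ _ _ _ _) (fun _ _ => rfl) (fun _ _ => rfl)] at h1
    have h2 := shuffle₃_map_smulR M N LinearMap.id (M.smulR (Y.ι r)) LinearMap.id LinearMap.id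
      (N.smulL (Y.ι r)) LinearMap.id (fun _ _ => rfl) (fun _ _ => tm_bal _ _ _ _ _) (fun _ _ => rfl)
      (TensorProduct.map LinearMap.id M.coalg.rep (M.coalg.rep m)) (a ⊗ₜ (b ⊗ₜ c))
    exact h1.trans (congrArg (mk₃ (tensorAct M N)) h2)
  · intro r a b c
    have h1 := shuffle₃_congr_left M N (mk₃_map_smulR_right M m r) (a ⊗ₜ (b ⊗ₜ c))
    have h2 := shuffle₃_map_smulR M N LinearMap.id (M.smulR (Y.ι r)) LinearMap.id LinearMap.id
      (N.smulL (Y.ι r)) LinearMap.id (fun _ _ => rfl) (fun _ _ => tm_bal _ _ _ _ _) (fun _ _ => rfl)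
      (TensorProduct.map LinearMap.id M.coalg.rep (M.coalg.rep m)) (a ⊗ₜ (b ⊗ₜ c))
    have h3 := shuffle₃_map_smulR M N LinearMap.id LinearMap.id (M.smulR (Y.ι r)) LinearMap.id
      LinearMap.id (N.smulL (Y.ι r)) (fun _ _ => rfl) (fun _ _ => rfl) (fun _ _ => tm_bal _ _ _ _ _)
      (TensorProduct.map LinearMap.id M.coalg.rep (M.coalg.rep m)) (a ⊗ₜ (b ⊗ₜ c))
    exact (congrArg (mk₃ (tensorAct M N)) h2).symm.trans
      (h1.trans (congrArg (mk₃ (tensorAct M N)) h3))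

theorem tensorComul_act (r : R) (z : Tensor M N) :
    tensorComul M N (tensorAct M N r z) = balAct (tensorAct M N) r (tensorComul M N z) := by
  induction z using Tensor.induction_on with
  | zero => simp only [map_zero]
  | add x y hx hy => simp only [map_add, hx, hy]
  | tmul m n =>
    rw [tensorAct_tm, tensorComul_tm M N (M.isRep_act (M.coalg.isRep_rep m) r) (N.coalg.isRep_rep n),
      tensorComul_tm M N (M.coalg.isRep_rep m) (N.coalg.isRep_rep n), balAct_mk]
    congr 1
    generalize M.coalg.rep m = t
    generalize N.coalg.rep n = u
    induction t with
    | zero => simp only [map_zero, LinearMap.zero_apply]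
    | add x y hx hy => simp only [map_add, LinearMap.add_apply, hx, hy]
    | tmul a b =>
      induction u with
      | zero => simp only [map_zero]
      | add x y hx hy => simp only [map_add, hx, hy]
      | tmul a' b' =>
        rw [TensorProduct.map_tmul, shuffle_tmul, shuffle_tmul, TensorProduct.map_tmul,
          tensorAct_tm, LinearMap.id_apply, LinearMap.id_apply]

theorem tensor_coassoc (z : Tensor M N) :
    assocMap (tensorAct M N) (Bal.map (ρ' := balAct (tensorAct M N)) (l' := tensorAct M N)
      (tensorComul M N) LinearMap.id (tensorComul_act M N) (fun _ _ => rfl)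
        (tensorComul M N z)) =
    Bal.map (ρ' := tensorAct M N) (l' := balAct (tensorAct M N))
      LinearMap.id (tensorComul M N) (fun _ _ => rfl) (tensorComul_act M N) (tensorComul M N z) := by
  induction z using Tensor.induction_on with
  | zero => simp only [map_zero]
  | add x y hx hy => simp only [map_add, hx, hy]
  | tmul m n =>
    -- Both sides are shuffles of iterated comultiplications of m and n. The factor from M is
    -- replaced first, since `shuffle₃_congr_right` requires it in the form (id ⊗ Δ)Δ(m).
    rw [tensorComul_tm M N (M.coalg.isRep_rep m) (N.coalg.isRep_rep n),
      assocMap_tensorComul M N _ _ (tensorComul_act M N),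
      map_tensorComul_mk M N _ _ (tensorComul_act M N),
      shuffle₃_congr_left M N (M.coalg.coassoc_rep m)]
    exact shuffle₃_congr_right M N m (N.coalg.coassoc_rep n)

end

end PreprincipalBimodule

end Bimodule
end Algd

/-! ### Local units, counitality and the coalgebra structure of the tensor product -/

namespace Algd

section Bimodule

variable {F : Type*} [Field F]
  {R : Type*} [NonUnitalCommRing R] [Module F R]
  {A : Type*} [NonUnitalRing A] [Module F A] [IsScalarTower F A A] [SMulCommClass F A A]
  {R' : Type*} [NonUnitalCommRing R'] [Module F R']
  {B : Type*} [NonUnitalRing B] [Module F B] [IsScalarTower F B B] [SMulCommClass F B B]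
  {R'' : Type*} [NonUnitalCommRing R''] [Module F R'']
  {C : Type*} [NonUnitalRing C] [Module F C] [IsScalarTower F C C] [SMulCommClass F C C]

variable {X : Bialgebroid F R A} {Y : Bialgebroid F R' B} {Z : Bialgebroid F R'' C}

namespace PreprincipalBimodule

section

variable (M : PreprincipalBimodule.{u} X Y) (N : PreprincipalBimodule.{u} Y Z)

/-- An element involves only finitely many left factors, and a unit that fixes all of them fixes the
element. -/
theorem tensor_unitaryL (s : Finset (Tensor M N)) : ∃ r : R, ∀ z ∈ s, tensorAct M N r z = z := by
  classical
  have key : ∀ z : Tensor M N, ∃ w : Finset M.carrier,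
      ∀ r : R, (∀ m ∈ w, M.act r m = m) → tensorAct M N r z = z := by
    intro z
    induction z using Tensor.induction_on with
    | zero => exact ⟨∅, fun r _ => map_zero _⟩
    | add x y hx hy =>
      obtain ⟨w, hw⟩ := hx
      obtain ⟨w', hw'⟩ := hy
      refine ⟨w ∪ w', fun r hr => ?_⟩
      rw [map_add, hw r fun m hm => hr m (Finset.mem_union_left _ hm),
        hw' r fun m hm => hr m (Finset.mem_union_right _ hm)]
    | tmul m n =>
      refine ⟨{m}, fun r hr => ?_⟩
      rw [tensorAct_tm, hr m (Finset.mem_singleton_self _)]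
  choose w hw using key
  obtain ⟨r, hr⟩ := M.coalg.unitary (s.biUnion w)
  exact ⟨r, fun z hz => hw z r fun m hm => hr m (Finset.mem_biUnion.2 ⟨z, hz, hm⟩)⟩

theorem tensor_unitaryR (s : Finset (Tensor M N)) :
    ∃ r : R'', ∀ z ∈ s, tensorR M N (Z.ι r) z = z := by
  classical
  have key : ∀ z : Tensor M N, ∃ w : Finset N.carrier,
      ∀ r : R'', (∀ n ∈ w, N.smulR (Z.ι r) n = n) → tensorR M N (Z.ι r) z = z := by
    intro z
    induction z using Tensor.induction_on with
    | zero => exact ⟨∅, fun r _ => map_zero _⟩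
    | add x y hx hy =>
      obtain ⟨w, hw⟩ := hx
      obtain ⟨w', hw'⟩ := hy
      refine ⟨w ∪ w', fun r hr => ?_⟩
      rw [map_add, hw r fun m hm => hr m (Finset.mem_union_left _ hm),
        hw' r fun m hm => hr m (Finset.mem_union_right _ hm)]
    | tmul m n =>
      refine ⟨{n}, fun r hr => ?_⟩
      rw [tensorR_tm, hr n (Finset.mem_singleton_self _)]
  choose w hw using key
  obtain ⟨r, hr⟩ := N.unitaryR (s.biUnion w)
  exact ⟨r, fun z hz => hw z r fun m hm => hr m (Finset.mem_biUnion.2 ⟨z, hz, hm⟩)⟩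

theorem tensorCounit_act (r : R) (z : Tensor M N) :
    tensorCounit M N (tensorAct M N r z) = r * tensorCounit M N z := by
  induction z using Tensor.induction_on with
  | zero => simp only [map_zero, mul_zero]
  | add x y hx hy => simp only [map_add, mul_add, hx, hy]
  | tmul m n =>
    rw [tensorAct_tm, tensorCounit_tm, tensorCounit_tm, smulR_act]
    exact M.coalg.counit_act _ _

/-- The map `m ⊗ m' ↦ ε(m) m'` on representatives. -/
abbrev counitL : M.carrier ⊗[F] M.carrier →ₗ[F] M.carrier :=
  TensorProduct.lift ((M.act : R →ₗ[F] Module.End F M.carrier) ∘ₗ M.coalg.counit)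

/-- The map `m ⊗ m' ↦ ε(m') m` on representatives. -/
abbrev counitR : M.carrier ⊗[F] M.carrier →ₗ[F] M.carrier :=
  TensorProduct.lift ((M.act : R →ₗ[F] Module.End F M.carrier) ∘ₗ M.coalg.counit).flip

theorem counitL_tmul (m m' : M.carrier) :
    counitL M (m ⊗ₜ m') = M.act (M.coalg.counit m) m' := rfl

theorem counitR_tmul (m m' : M.carrier) :
    counitR M (m ⊗ₜ m') = M.act (M.coalg.counit m') m := rfl

/-- Moved to the second leg, r factors out of ε ⊗ id, and counitality leaves mr. -/
theorem counitL_map_smulR {m : M.carrier} {t : M.carrier ⊗[F] M.carrier}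
    (h : M.coalg.IsRep m t) (r : R') :
    counitL M (TensorProduct.map (M.smulR (Y.ι r)) LinearMap.id t) = M.smulR (Y.ι r) m := by
  have h1 := congrArg (counitFst M.act M.coalg.counit M.coalg.counit_act) (M.mk_map_smulR h r)
  refine h1.trans ?_
  change counitL M _ = _
  rw [← h.counit_fst]
  generalize t = t
  induction t with
  | zero => simp only [map_zero]
  | add x y hx hy => simp only [map_add, hx, hy]
  | tmul a b => exact (M.smulR_act _ _ _).symm

theorem counitR_map_smulR {m : M.carrier} {t : M.carrier ⊗[F] M.carrier}
    (h : M.coalg.IsRep m t) (r : R') :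
    counitR M (TensorProduct.map LinearMap.id (M.smulR (Y.ι r)) t) = M.smulR (Y.ι r) m := by
  have h1 := congrArg (counitSnd M.act M.coalg.counit M.coalg.counit_act) (M.mk_map_smulR h r)
  refine h1.symm.trans ?_
  change counitR M _ = _
  rw [← h.counit_snd]
  generalize t = t
  induction t with
  | zero => simp only [map_zero]
  | add x y hx hy => simp only [map_add, hx, hy]
  | tmul a b => exact (M.smulR_act _ _ _).symm

/-- For a term n' ⊗ n'' of Δ(n), Σ ε(m'ε(n'))m'' ⊗ n'' = mε(n') ⊗ n'' = m ⊗ ε(n')n'' by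
`counitL_map_smulR`; counitality of N finishes. -/
theorem tensor_counit_comul (z : Tensor M N) :
    counitFst (tensorAct M N) (tensorCounit M N) (tensorCounit_act M N) (tensorComul M N z) = z := by
  induction z using Tensor.induction_on with
  | zero => simp only [map_zero]
  | add x y hx hy => simp only [map_add, hx, hy]
  | tmul m n =>
    have key : ∀ u : N.carrier ⊗[F] N.carrier,
        counitFst (tensorAct M N) (tensorCounit M N) (tensorCounit_act M N)
          (Bal.mk (tensorAct M N) (tensorAct M N) (shuffle M N (M.coalg.rep m) u)) =
        tm M N m (counitL N u) := by
      intro u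
      induction u with
      | zero => simp only [map_zero]
      | add x y hx hy => simp only [map_add, hx, hy]
      | tmul n n' =>
        rw [counitL_tmul]
        refine Eq.trans ?_ (tm_bal M N (Y.ι (N.coalg.counit n)) m n')
        rw [← M.counitL_map_smulR (M.coalg.isRep_rep m) (N.coalg.counit n)]
        generalize M.coalg.rep m = t
        induction t with
        | zero => simp only [map_zero, LinearMap.zero_apply]
        | add x y hx hy => simp only [map_add, LinearMap.add_apply, hx, hy]
        | tmul a b =>
          rw [shuffle_tmul, Bal.mk_tmul, counitFst_tmul, tensorCounit_tm, tensorAct_tm,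
            TensorProduct.map_tmul, counitL_tmul, LinearMap.id_apply]
    rw [tensorComul_tm M N (M.coalg.isRep_rep m) (N.coalg.isRep_rep n), key,
      (N.coalg.isRep_rep n).counit_fst]

theorem tensor_comul_counit (z : Tensor M N) :
    counitSnd (tensorAct M N) (tensorCounit M N) (tensorCounit_act M N) (tensorComul M N z) = z := by
  induction z using Tensor.induction_on with
  | zero => simp only [map_zero]
  | add x y hx hy => simp only [map_add, hx, hy]
  | tmul m n =>
    have key : ∀ u : N.carrier ⊗[F] N.carrier,
        counitSnd (tensorAct M N) (tensorCounit M N) (tensorCounit_act M N)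
          (Bal.mk (tensorAct M N) (tensorAct M N) (shuffle M N (M.coalg.rep m) u)) =
        tm M N m (counitR N u) := by
      intro u
      induction u with
      | zero => simp only [map_zero]
      | add x y hx hy => simp only [map_add, hx, hy]
      | tmul n n' =>
        rw [counitR_tmul]
        refine Eq.trans ?_ (tm_bal M N (Y.ι (N.coalg.counit n')) m n)
        rw [← M.counitR_map_smulR (M.coalg.isRep_rep m) (N.coalg.counit n')]
        generalize M.coalg.rep m = t
        induction t with
        | zero => simp only [map_zero, LinearMap.zero_apply]
        | add x y hx hy => simp only [map_add, LinearMap.add_apply, hx, hy]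
        | tmul a b =>
          rw [shuffle_tmul, Bal.mk_tmul, counitSnd_tmul, tensorCounit_tm, tensorAct_tm,
            TensorProduct.map_tmul, counitR_tmul, LinearMap.id_apply]
    rw [tensorComul_tm M N (M.coalg.isRep_rep m) (N.coalg.isRep_rep n), key,
      (N.coalg.isRep_rep n).counit_snd]

/-- The coalgebra structure of `M ⊗_B N`. -/
noncomputable def tensorCoalg : LeftCoalgebra (tensorAct M N) where
  unitary := tensor_unitaryL M N
  comul := tensorComul M N
  counit := tensorCounit M N
  comul_act := tensorComul_act M N
  counit_act := tensorCounit_act M N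
  counit_comul := tensor_counit_comul M N
  comul_counit := tensor_comul_counit M N
  coassoc := tensor_coassoc M N

theorem isRep_tensor {m : M.carrier} {n : N.carrier} {t : M.carrier ⊗[F] M.carrier}
    {u : N.carrier ⊗[F] N.carrier} (ht : M.coalg.IsRep m t) (hu : N.coalg.IsRep n u) :
    (tensorCoalg M N).IsRep (tm M N m n) (shuffle M N t u) :=
  (tensorComul_tm M N ht hu).symm

theorem shuffle_map_tensorR (c c' : C) (t : M.carrier ⊗[F] M.carrier)
    (u : N.carrier ⊗[F] N.carrier) :
    TensorProduct.map (tensorR M N c) (tensorR M N c') (shuffle M N t u) =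
      shuffle M N t (TensorProduct.map (N.smulR c) (N.smulR c') u) := by
  induction t with
  | zero => simp only [map_zero, LinearMap.zero_apply]
  | add x y hx hy => simp only [map_add, LinearMap.add_apply, hx, hy]
  | tmul m m' =>
    induction u with
    | zero => simp only [map_zero]
    | add x y hx hy => simp only [map_add, hx, hy]
    | tmul n n' => simp only [TensorProduct.map_tmul, shuffle_tmul, tensorR_tm]

theorem shuffle_map_tensorR_left (c : C) (t : M.carrier ⊗[F] M.carrier)
    (u : N.carrier ⊗[F] N.carrier) :
    TensorProduct.map (tensorR M N c) LinearMap.id (shuffle M N t u) =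
      shuffle M N t (TensorProduct.map (N.smulR c) LinearMap.id u) := by
  induction t with
  | zero => simp only [map_zero, LinearMap.zero_apply]
  | add x y hx hy => simp only [map_add, LinearMap.add_apply, hx, hy]
  | tmul m m' =>
    induction u with
    | zero => simp only [map_zero]
    | add x y hx hy => simp only [map_add, hx, hy]
    | tmul n n' => simp only [TensorProduct.map_tmul, shuffle_tmul, tensorR_tm, LinearMap.id_apply]

theorem shuffle_map_tensorR_right (c : C) (t : M.carrier ⊗[F] M.carrier)
    (u : N.carrier ⊗[F] N.carrier) :
    TensorProduct.map LinearMap.id (tensorR M N c) (shuffle M N t u) =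
      shuffle M N t (TensorProduct.map LinearMap.id (N.smulR c) u) := by
  induction t with
  | zero => simp only [map_zero, LinearMap.zero_apply]
  | add x y hx hy => simp only [map_add, LinearMap.add_apply, hx, hy]
  | tmul m m' =>
    induction u with
    | zero => simp only [map_zero]
    | add x y hx hy => simp only [map_add, hx, hy]
    | tmul n n' => simp only [TensorProduct.map_tmul, shuffle_tmul, tensorR_tm, LinearMap.id_apply]

theorem shuffle_map_tensorL (a a' : A) (t : M.carrier ⊗[F] M.carrier)
    (u : N.carrier ⊗[F] N.carrier) :
    TensorProduct.map (tensorL M N a) (tensorL M N a') (shuffle M N t u) =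
      shuffle M N (TensorProduct.map (M.smulL a) (M.smulL a') t) u := by
  induction t with
  | zero => simp only [map_zero, LinearMap.zero_apply]
  | add x y hx hy => simp only [map_add, LinearMap.add_apply, hx, hy]
  | tmul m m' =>
    induction u with
    | zero => simp only [map_zero]
    | add x y hx hy => simp only [map_add, hx, hy]
    | tmul n n' => simp only [TensorProduct.map_tmul, shuffle_tmul, tensorL_tm]

theorem tensorR_act (r : R) (c : C) (z : Tensor M N) :
    tensorR M N c (tensorAct M N r z) = tensorAct M N r (tensorR M N c z) := by
  induction z using Tensor.induction_on with
  | zero => simp only [map_zero]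
  | add x y hx hy => simp only [map_add, hx, hy]
  | tmul m n => simp only [tensorAct_tm, tensorR_tm]

theorem tensor_comul_right (r : R'') (z : Tensor M N) :
    endMap (tensorAct M N) (tensorR M N (Z.ι r)) LinearMap.id (fun s z => tensorR_act M N s _ z)
      (fun _ _ => rfl) (tensorComul M N z) =
    endMap (tensorAct M N) LinearMap.id (tensorR M N (Z.ι r)) (fun _ _ => rfl)
      (fun s z => tensorR_act M N s _ z) (tensorComul M N z) := by
  induction z using Tensor.induction_on with
  | zero => simp only [map_zero]
  | add x y hx hy => simp only [map_add, hx, hy]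
  | tmul m n =>
    rw [tensorComul_tm M N (M.coalg.isRep_rep m) (N.coalg.isRep_rep n), endMap_mk, endMap_mk,
      shuffle_map_tensorR_left, shuffle_map_tensorR_right]
    exact shuffle_congr_right M N (M.coalg.isRep_rep m) (N.mk_map_smulR (N.coalg.isRep_rep n) r)

end

end PreprincipalBimodule

end Bimodule
end Algd

/-! ### Multiplicativity of the comultiplication and the bimodule M ⊗_B N -/

namespace Algd

section Bimodule

variable {F : Type*} [Field F]
  {R : Type*} [NonUnitalCommRing R] [Module F R]
  {A : Type*} [NonUnitalRing A] [Module F A] [IsScalarTower F A A] [SMulCommClass F A A]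
  {R' : Type*} [NonUnitalCommRing R'] [Module F R']
  {B : Type*} [NonUnitalRing B] [Module F B] [IsScalarTower F B B] [SMulCommClass F B B]
  {R'' : Type*} [NonUnitalCommRing R''] [Module F R'']
  {C : Type*} [NonUnitalRing C] [Module F C] [IsScalarTower F C C] [SMulCommClass F C C]

variable {X : Bialgebroid F R A} {Y : Bialgebroid F R' B} {Z : Bialgebroid F R'' C}

section Action

variable {V : Type*} [AddCommGroup V] [Module F V] (L : A →ₙₐ[F] Module.End F V)

/-- The componentwise action of `A ⊗ A` on `V ⊗ V`. -/
abbrev mapL : A ⊗[F] A →ₗ[F] V ⊗[F] V →ₗ[F] V ⊗[F] V :=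
  TensorProduct.map₂ (L : A →ₗ[F] Module.End F V) (L : A →ₗ[F] Module.End F V)

theorem mapL_congr_left {t t' : A ⊗[F] A} (h : Bal.mk X.act X.act t = Bal.mk X.act X.act t')
    (u : V ⊗[F] V) :
    Bal.mk (L.comp X.ι) (L.comp X.ι) (mapL L t u) =
      Bal.mk (L.comp X.ι) (L.comp X.ι) (mapL L t' u) := by
  refine Bal.congr_of_balanced (Bal.mk (L.comp X.ι) (L.comp X.ι) ∘ₗ (mapL L).flip u)
    (fun r a a' => ?_) h
  simp only [LinearMap.comp_apply, LinearMap.flip_apply]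
  induction u with
  | zero => simp only [map_zero]
  | add x y hx hy => simp only [map_add, hx, hy]
  | tmul v v' =>
    have key : ∀ a b, mapL L (a ⊗ₜ b) (v ⊗ₜ v') = L a v ⊗ₜ L b v' := fun _ _ => rfl
    have hL : ∀ a w, L (X.act r a) w = (L.comp X.ι) r (L a w) := fun a w =>
      (congrArg (fun f : Module.End F V => f w) (map_mul L (X.ι r) a))
    rw [key, key, hL, hL, Bal.mk_tmul, Bal.mk_tmul]
    exact Bal.tmul_bal (L.comp X.ι) (L.comp X.ι) r (L a v) (L a' v')

/-- An element of R acting on a leg of `u` becomes a right multiplication on that leg of `t`, and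
the two right multiplications agree on Δ(a). -/
theorem mapL_congr_right {a : A} {t : A ⊗[F] A} (ht : X.coalg.IsRep a t) {u u' : V ⊗[F] V}
    (h : Bal.mk (L.comp X.ι) (L.comp X.ι) u = Bal.mk (L.comp X.ι) (L.comp X.ι) u') :
    Bal.mk (L.comp X.ι) (L.comp X.ι) (mapL L t u) =
      Bal.mk (L.comp X.ι) (L.comp X.ι) (mapL L t u') := by
  refine Bal.congr_of_balanced (Bal.mk (L.comp X.ι) (L.comp X.ι) ∘ₗ mapL L t)
    (fun r v v' => ?_) h
  have h1 : Bal.mk X.act X.act (TensorProduct.map (LinearMap.mulRight F (X.ι r)) LinearMap.id t) =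
      Bal.mk X.act X.act (TensorProduct.map LinearMap.id (LinearMap.mulRight F (X.ι r)) t) := by
    have h1 := X.comul_right r a
    rw [← ht.eq] at h1
    exact (endMap_mk X.act _ _ _ _ t).symm.trans (h1.trans (endMap_mk X.act _ _ _ _ t))
  have hL : ∀ a w, L (a * X.ι r) w = L a ((L.comp X.ι) r w) := fun a w =>
      (congrArg (fun f : Module.End F V => f w) (map_mul L a (X.ι r)))
  have h2 : ∀ t : A ⊗[F] A, mapL L t ((L.comp X.ι) r v ⊗ₜ v') =
      mapL L (TensorProduct.map (LinearMap.mulRight F (X.ι r)) LinearMap.id t) (v ⊗ₜ v') := by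
    intro t
    induction t with
    | zero => simp only [map_zero, LinearMap.zero_apply]
    | add x y hx hy => simp only [map_add, LinearMap.add_apply, hx, hy]
    | tmul b b' => exact congrArg (· ⊗ₜ[F] L b' v') (hL b v).symm
  have h3 : ∀ t : A ⊗[F] A, mapL L t (v ⊗ₜ (L.comp X.ι) r v') =
      mapL L (TensorProduct.map LinearMap.id (LinearMap.mulRight F (X.ι r)) t) (v ⊗ₜ v') := by
    intro t
    induction t with
    | zero => simp only [map_zero, LinearMap.zero_apply]
    | add x y hx hy => simp only [map_add, LinearMap.add_apply, hx, hy]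
    | tmul b b' => exact congrArg (L b v ⊗ₜ[F] ·) (hL b' v').symm
  rw [LinearMap.comp_apply, LinearMap.comp_apply, h2, h3]
  exact mapL_congr_left L h1 _

/-- With linearly chosen representatives both sides are linear in v, so a spanning set suffices.
There one convenient representative is enough, because the congruence lemmas compare it with any
other. -/
theorem Bialgebroid.isRep_mapL (K : LeftCoalgebra (L.comp X.ι)) {W : Set V}
    (hW : Submodule.span F W = ⊤)
    (h : ∀ w ∈ W, ∀ a t, X.coalg.IsRep a t → ∃ u, K.IsRep w u ∧ K.IsRep (L a w) (mapL L t u))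
    (a : A) (v : V) (t : A ⊗[F] A) (u : V ⊗[F] V) (ht : X.coalg.IsRep a t) (hu : K.IsRep v u) :
    K.IsRep (L a v) (mapL L t u) := by
  have h1 : Bal.mk (L.comp X.ι) (L.comp X.ι) ∘ₗ mapL L t ∘ₗ K.rep = K.comul ∘ₗ L a := by
    refine LinearMap.ext_on_range (v := ((↑) : W → V)) (by simpa using hW) ?_
    rintro ⟨w, hw⟩
    obtain ⟨u, hu, hu'⟩ := h w hw a t ht
    refine Eq.trans ?_ hu'
    exact mapL_congr_right L ht ((K.isRep_rep w).eq.trans hu.eq.symm)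
  refine Eq.trans ?_ (LinearMap.congr_fun h1 v)
  exact mapL_congr_right L ht (hu.eq.trans (K.isRep_rep v).eq.symm)

variable (Q : B →ₗ[F] Module.End F V)

omit [IsScalarTower F B B] [SMulCommClass F B B] in
theorem mapR_congr_right (s : B ⊗[F] B) {act : R →ₙₐ[F] Module.End F V}
    (hQ : ∀ r b v, Q b (act r v) = act r (Q b v)) {u u' : V ⊗[F] V}
    (h : Bal.mk act act u = Bal.mk act act u') :
    Bal.mk act act (TensorProduct.map₂ Q Q s u) = Bal.mk act act (TensorProduct.map₂ Q Q s u') := by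
  refine Bal.congr_of_balanced (Bal.mk act act ∘ₗ TensorProduct.map₂ Q Q s) (fun r v v' => ?_) h
  induction s with
  | zero => simp only [map_zero, LinearMap.zero_apply, LinearMap.comp_zero]
  | add x y hx hy =>
    simp only [LinearMap.comp_apply] at hx hy ⊢
    simp only [map_add, LinearMap.add_apply, hx, hy]
  | tmul b b' =>
    have key : ∀ v v', TensorProduct.map₂ Q Q (b ⊗ₜ b') (v ⊗ₜ v') = Q b v ⊗ₜ Q b' v' :=
      fun _ _ => rfl
    rw [LinearMap.comp_apply, LinearMap.comp_apply, key, key, hQ, hQ, Bal.mk_tmul, Bal.mk_tmul]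
    exact Bal.tmul_bal act act r (Q b v) (Q b' v')

omit [IsScalarTower F B B] [SMulCommClass F B B] in
theorem isRep_mapR {act : R →ₙₐ[F] Module.End F V} (hQ : ∀ r b v, Q b (act r v) = act r (Q b v))
    (K : LeftCoalgebra act) {W : Set V} (hW : Submodule.span F W = ⊤) (b : B) (s : B ⊗[F] B)
    (h : ∀ w ∈ W, ∃ u, K.IsRep w u ∧ K.IsRep (Q b w) (TensorProduct.map₂ Q Q s u))
    (v : V) (u : V ⊗[F] V) (hu : K.IsRep v u) :
    K.IsRep (Q b v) (TensorProduct.map₂ Q Q s u) := by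
  have h1 : Bal.mk act act ∘ₗ TensorProduct.map₂ Q Q s ∘ₗ K.rep = K.comul ∘ₗ Q b := by
    refine LinearMap.ext_on_range (v := ((↑) : W → V)) (by simpa using hW) ?_
    rintro ⟨w, hw⟩
    obtain ⟨u, hu, hu'⟩ := h w hw
    refine Eq.trans ?_ hu'
    exact mapR_congr_right Q s hQ ((K.isRep_rep w).eq.trans hu.eq.symm)
  refine Eq.trans ?_ (LinearMap.congr_fun h1 v)
  exact mapR_congr_right Q s hQ (hu.eq.trans (K.isRep_rep v).eq.symm)

end Action

namespace PreprincipalBimodule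

section

variable (M : PreprincipalBimodule.{u} X Y) (N : PreprincipalBimodule.{u} Y Z)

theorem span_tm : Submodule.span F {z : Tensor M N | ∃ m n, z = tm M N m n} = ⊤ := by
  refine eq_top_iff.2 fun z _ => ?_
  induction z using Tensor.induction_on with
  | zero => exact zero_mem _
  | add x y hx hy => exact add_mem (hx trivial) (hy trivial)
  | tmul m n => exact Submodule.subset_span ⟨m, n, rfl⟩

theorem mapL_shuffle (s : A ⊗[F] A) (t : M.carrier ⊗[F] M.carrier)
    (u : N.carrier ⊗[F] N.carrier) :
    mapL (tensorL M N) s (shuffle M N t u) = shuffle M N (mapL M.smulL s t) u := by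
  induction s with
  | zero => simp only [map_zero, LinearMap.zero_apply]
  | add x y hx hy => simp only [map_add, LinearMap.add_apply, hx, hy]
  | tmul b b' => exact shuffle_map_tensorL M N b b' t u

theorem mapR_shuffle (s : C ⊗[F] C) (t : M.carrier ⊗[F] M.carrier)
    (u : N.carrier ⊗[F] N.carrier) :
    TensorProduct.map₂ (tensorR M N) (tensorR M N) s (shuffle M N t u) =
      shuffle M N t (TensorProduct.map₂ N.smulR N.smulR s u) := by
  induction s with
  | zero => simp only [map_zero, LinearMap.zero_apply]
  | add x y hx hy => simp only [map_add, LinearMap.add_apply, hx, hy]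
  | tmul b b' => exact shuffle_map_tensorR M N b b' t u

/-- The tensor product `M ⊗_B N` of preprincipal bimodules. -/
noncomputable def tensor : PreprincipalBimodule.{u} X Z where
  carrier := Tensor M N
  smulL := tensorL M N
  smulR := tensorR M N
  smulR_mul c c' z := by
    induction z using Tensor.induction_on with
    | zero => simp only [map_zero]
    | add x y hx hy => simp only [map_add, hx, hy]
    | tmul m n => simp only [tensorR_tm, N.smulR_mul]
  smul_comm a c z := by
    induction z using Tensor.induction_on with
    | zero => simp only [map_zero]
    | add x y hx hy => simp only [map_add, hx, hy]
    | tmul m n => simp only [tensorR_tm, tensorL_tm]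
  unitaryR := tensor_unitaryR M N
  coalg := tensorCoalg M N
  comul_right := tensor_comul_right M N
  counit_smulR c z := by
    change tensorCounit M N _ = tensorCounit M N _
    induction z using Tensor.induction_on with
    | zero => simp only [map_zero]
    | add x y hx hy => simp only [map_add, hx, hy]
    | tmul m n => rw [tensorR_tm, tensorR_tm, tensorCounit_tm, tensorCounit_tm, N.counit_smulR]
  counit_smulL a z := by
    change tensorCounit M N _ = X.coalg.counit (a * X.ι (tensorCounit M N z))
    induction z using Tensor.induction_on with
    | zero => simp only [map_zero, mul_zero]
    | add x y hx hy => simp only [map_add, mul_add, hx, hy]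
    | tmul m n =>
      rw [tensorL_tm, tensorCounit_tm, tensorCounit_tm, ← M.smul_comm, M.counit_smulL]
  comul_smulL a z t u ht hu := by
    refine Bialgebroid.isRep_mapL (tensorL M N) (tensorCoalg M N) (span_tm M N) ?_ a z t u ht hu
    rintro _ ⟨m, n, rfl⟩ a t ht
    refine ⟨_, isRep_tensor M N (M.coalg.isRep_rep m) (N.coalg.isRep_rep n), ?_⟩
    rw [tensorL_tm, mapL_shuffle]
    exact isRep_tensor M N (M.comul_smulL _ _ _ _ ht (M.coalg.isRep_rep m)) (N.coalg.isRep_rep n)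
  comul_smulR c z t u ht hu := by
    refine isRep_mapR (tensorR M N) (fun r c z => tensorR_act M N r c z) (tensorCoalg M N)
      (span_tm M N) c t ?_ z u hu
    rintro _ ⟨m, n, rfl⟩
    refine ⟨_, isRep_tensor M N (M.coalg.isRep_rep m) (N.coalg.isRep_rep n), ?_⟩
    rw [tensorR_tm, mapR_shuffle]
    exact isRep_tensor M N (M.coalg.isRep_rep m) (N.comul_smulR _ _ _ _ ht (N.coalg.isRep_rep n))

/-- The structure on `M ⊗_B N` is the natural one. -/
noncomputable def tensorIso : TensorIso M N (tensor M N) where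
  toEquiv := LinearEquiv.refl F (Tensor M N)
  map_smulL a m n := tensorL_tm M N a m n
  map_smulR c m n := tensorR_tm M N c m n
  map_counit m n := tensorCounit_tm M N m n
  map_comul _ _ _ _ ht hu := isRep_tensor M N ht hu

end

end PreprincipalBimodule

end Bimodule
end Algd

/-! ### Tools for the canonical map of a tensor product -/

namespace Algd

section Bimodule

variable {F : Type*} [Field F]
  {R : Type*} [NonUnitalCommRing R] [Module F R]
  {A : Type*} [NonUnitalRing A] [Module F A] [IsScalarTower F A A] [SMulCommClass F A A]
  {R' : Type*} [NonUnitalCommRing R'] [Module F R']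
  {B : Type*} [NonUnitalRing B] [Module F B] [IsScalarTower F B B] [SMulCommClass F B B]
  {R'' : Type*} [NonUnitalCommRing R''] [Module F R'']
  {C : Type*} [NonUnitalRing C] [Module F C] [IsScalarTower F C C] [SMulCommClass F C C]

variable {X : Bialgebroid F R A} {Y : Bialgebroid F R' B} {Z : Bialgebroid F R'' C}

namespace PreprincipalBimodule

section

variable (M : PreprincipalBimodule.{u} X Y) (N : PreprincipalBimodule.{u} Y Z)

/-- Serves to construct the inverse of the canonical map of M ⊗_B N, which is given by a formula in
the order (M ⊗ M) × (N ⊗ N). It descends one factor M ⊗_B N at a time, the second one first. -/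
theorem exists_tensor_desc {Q : Type*} [AddCommGroup Q] [Module F Q]
    (f : M.carrier ⊗[F] M.carrier →ₗ[F] N.carrier ⊗[F] N.carrier →ₗ[F] Q)
    (h₁ : ∀ b m m' n n', f (M.smulR b m ⊗ₜ m') (n ⊗ₜ n') = f (m ⊗ₜ m') (N.smulL b n ⊗ₜ n'))
    (h₂ : ∀ b m m' n n', f (m ⊗ₜ M.smulR b m') (n ⊗ₜ n') = f (m ⊗ₜ m') (n ⊗ₜ N.smulL b n'))
    (h₃ : ∀ r m m' u, f (M.act r m ⊗ₜ m') u = f (m ⊗ₜ M.act r m') u) :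
    ∃ g : Bal (tensorAct M N) (tensorAct M N) →ₗ[F] Q, ∀ t u,
      g (Bal.mk (tensorAct M N) (tensorAct M N) (shuffle M N t u)) = f t u := by
  let i : M.carrier → N.carrier → Tensor M N →ₗ[F] Q := fun m n =>
    Tensor.lift (LinearMap.mk₂ F (fun m' n' => f (m ⊗ₜ m') (n ⊗ₜ n'))
      (fun a b c => by simp only [TensorProduct.tmul_add, map_add, LinearMap.add_apply])
      (fun a b c => by simp only [TensorProduct.tmul_smul, map_smul, LinearMap.smul_apply])
      (fun a b c => by simp only [TensorProduct.tmul_add, map_add])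
      (fun a b c => by simp only [TensorProduct.tmul_smul, map_smul]))
      (fun b m' n' => h₂ b m m' n n')
  have hi : ∀ m n m' n', i m n (tm M N m' n') = f (m ⊗ₜ m') (n ⊗ₜ n') := fun m n m' n' =>
    Tensor.lift_tm _ _ _ _
  let o : Tensor M N →ₗ[F] Tensor M N →ₗ[F] Q :=
    Tensor.lift (LinearMap.mk₂ F i
      (fun a b c => Tensor.hom_ext fun m' n' => by
        simp only [hi, TensorProduct.add_tmul, map_add, LinearMap.add_apply])
      (fun a b c => Tensor.hom_ext fun m' n' => by
        simp only [hi, ← TensorProduct.smul_tmul', map_smul, LinearMap.smul_apply])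
      (fun a b c => Tensor.hom_ext fun m' n' => by
        simp only [hi, TensorProduct.add_tmul, map_add, LinearMap.add_apply])
      (fun a b c => Tensor.hom_ext fun m' n' => by
        simp only [hi, ← TensorProduct.smul_tmul', map_smul, LinearMap.smul_apply]))
      (fun b m n => Tensor.hom_ext fun m' n' => by
        simp only [LinearMap.mk₂_apply, hi, h₁])
  have ho : ∀ m n m' n', o (tm M N m n) (tm M N m' n') = f (m ⊗ₜ m') (n ⊗ₜ n') := by
    intro m n m' n'
    simp only [o, Tensor.lift_tm, LinearMap.mk₂_apply, hi]
  refine ⟨Bal.lift _ _ o ?_, ?_⟩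
  · intro r x y
    induction x using Tensor.induction_on with
    | zero => simp only [map_zero, LinearMap.zero_apply]
    | add x y hx hy => simp only [map_add, LinearMap.add_apply, hx, hy]
    | tmul m n =>
      induction y using Tensor.induction_on with
      | zero => simp only [map_zero]
      | add x y hx hy => simp only [map_add, hx, hy]
      | tmul m' n' => simp only [tensorAct_tm, ho, h₃]
  · intro t u
    induction t with
    | zero => simp only [map_zero, LinearMap.zero_apply]
    | add x y hx hy => simp only [map_add, LinearMap.add_apply, hx, hy]
    | tmul m m' =>
      induction u with
      | zero => simp only [map_zero]
      | add x y hx hy => simp only [map_add, hx, hy]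
      | tmul n n' => rw [shuffle_tmul, Bal.mk_tmul, Bal.lift_tmul, ho]

/-- The space `M ⊗_{R'} B`. -/
abbrev CanDom : Type _ := Bal (fun r => M.smulR (Y.ι r)) Y.act

/-- The space `(M ⊗_B N) ⊗_{R''} C`. -/
abbrev TensorCanDom : Type _ := Bal (fun r => tensorR M N (Z.ι r)) Z.act

/-- The map `n ⊗ c ↦ (m ⊗ n) ⊗ c`. -/
def assocCanMap (m : M.carrier) : CanDom N →ₗ[F] TensorCanDom M N :=
  Bal.map (ρ' := fun r => tensorR M N (Z.ι r)) (l' := Z.act)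
      (tm M N m) LinearMap.id (fun _ n => (tensorR_tm M N _ m n).symm) (fun _ _ => rfl)

theorem assocCanMap_tmul (m : M.carrier) (n : N.carrier) (c : C) :
    assocCanMap M N m (Bal.tmul _ _ n c) =
      Bal.tmul (fun r => tensorR M N (Z.ι r)) Z.act (tm M N m n) c := by
  rw [assocCanMap, Bal.map_tmul, LinearMap.id_apply]

/-- The map `m ⊗ (n ⊗ c) ↦ (m ⊗ n) ⊗ c`. -/
def assocCan : M.carrier →ₗ[F] CanDom N →ₗ[F] TensorCanDom M N where
  toFun := assocCanMap M N
  map_add' m m' := Bal.hom_ext fun n c => by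
    simp only [LinearMap.add_apply, assocCanMap_tmul, map_add]
  map_smul' k m := Bal.hom_ext fun n c => by
    simp only [LinearMap.smul_apply, assocCanMap_tmul, map_smul, RingHom.id_apply]

theorem assocCan_tmul (m : M.carrier) (n : N.carrier) (c : C) :
    assocCan M N m (Bal.tmul _ _ n c) =
      Bal.tmul (fun r => tensorR M N (Z.ι r)) Z.act (tm M N m n) c :=
  assocCanMap_tmul M N m n c

/-- The left action of `A` on `M ⊗_{R'} B`. -/
def canL (a : A) : Module.End F (CanDom M) :=
  Bal.map (M.smulL a) LinearMap.id (fun r m => M.smul_comm a (Y.ι r) m) (fun _ _ => rfl)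

theorem canL_tmul (a : A) (m : M.carrier) (b : B) :
    canL M a (Bal.tmul _ _ m b) = Bal.tmul _ _ (M.smulL a m) b := by
  rw [canL, Bal.map_tmul, LinearMap.id_apply]

theorem assocCan_smulR (b : B) (m : M.carrier) (z : CanDom N) :
    assocCan M N (M.smulR b m) z = assocCan M N m (canL N b z) := by
  induction z using Bal.induction_on with
  | zero => simp only [map_zero]
  | add x y hx hy => simp only [map_add, hx, hy]
  | tmul n c => rw [canL_tmul, assocCan_tmul, assocCan_tmul, tm_bal]

theorem map_id_smulR_mapL (c : B) (s : A ⊗[F] A) (u : M.carrier ⊗[F] M.carrier) :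
    TensorProduct.map LinearMap.id (M.smulR c) (mapL M.smulL s u) =
      mapL M.smulL s (TensorProduct.map LinearMap.id (M.smulR c) u) := by
  induction s with
  | zero => simp only [map_zero, LinearMap.zero_apply]
  | add x y hx hy => simp only [map_add, LinearMap.add_apply, hx, hy]
  | tmul a a' =>
    induction u with
    | zero => simp only [map_zero]
    | add x y hx hy => simp only [map_add, hx, hy]
    | tmul m m' => exact congrArg (M.smulL a m ⊗ₜ[F] ·) (M.smul_comm a' c m').symm

/-- On m ⊗ b this is Δ(am)(1 ⊗ b) = Δ(a)Δ(m)(1 ⊗ b): the canonical map is A-linear when A acts on M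
⊗_R M through Δ. -/
theorem can_canL {a : A} {s : A ⊗[F] A} (hs : X.coalg.IsRep a s) (z : CanDom M)
    (w : M.carrier ⊗[F] M.carrier) (hw : Bal.mk M.act M.act w = M.can z) :
    M.can (canL M a z) = Bal.mk M.act M.act (mapL M.smulL s w) := by
  -- A linear choice σ of representatives makes the claim additive in z; the given representative is
  -- compared with it at the end.
  obtain ⟨σ, hσ⟩ := Module.projective_lifting_property (Bal.mk M.act M.act) M.can
    (Bal.mk_surjective _ _)
  have hσ : ∀ z, Bal.mk M.act M.act (σ z) = M.can z := fun z => LinearMap.congr_fun hσ z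
  have h1 : M.can (canL M a z) = Bal.mk M.act M.act (mapL M.smulL s (σ z)) := by
    induction z using Bal.induction_on generalizing w with
    | zero => simp only [map_zero]
    | add x y hx hy => simp only [map_add, hx _ (hσ x), hy _ (hσ y)]
    | tmul m b =>
      rw [canL_tmul, M.can_tmul (M.comul_smulL _ _ _ _ hs (M.coalg.isRep_rep m)), map_id_smulR_mapL]
      refine mapL_congr_right M.smulL hs ?_
      exact (M.can_tmul (M.coalg.isRep_rep m) b).symm.trans (hσ _).symm
  rw [h1]
  exact mapL_congr_right M.smulL hs ((hσ z).trans hw.symm)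

/-- Balancing over R' in B is left multiplication by r on either leg, so m(rb) = (mr)b turns it into
the two right actions of r on Δ(m), which agree. -/
theorem mapR_congr_left {m : M.carrier} {t : M.carrier ⊗[F] M.carrier} (ht : M.coalg.IsRep m t)
    {s s' : B ⊗[F] B} (h : Bal.mk Y.act Y.act s = Bal.mk Y.act Y.act s') :
    Bal.mk M.act M.act (TensorProduct.map₂ M.smulR M.smulR s t) =
      Bal.mk M.act M.act (TensorProduct.map₂ M.smulR M.smulR s' t) := by
  refine Bal.congr_of_balanced
    (Bal.mk M.act M.act ∘ₗ (TensorProduct.map₂ M.smulR M.smulR).flip t) (fun r b b' => ?_) h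
  have hR : ∀ b, M.smulR (Y.act r b) = M.smulR b * M.smulR (Y.ι r) := fun b => by
    ext m
    exact M.smulR_mul (Y.ι r) b m
  have h1 := M.mk_map_smulR_comp ht r (M.smulR b) (M.smulR b')
    (fun s c => M.smulR_act s b c) (fun s c => M.smulR_act s b' c)
  rw [← hR, ← hR] at h1
  exact h1

theorem smulR_flip_mulRight (m : M.carrier) (r : R') (b : B) :
    M.smulR.flip m (LinearMap.mulRight F (Y.ι r) b) = M.smulR (Y.ι r) (M.smulR.flip m b) :=
  M.smulR_mul b (Y.ι r) m

/-- The map `x ⊗ y ↦ m x ⊗ y`. -/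
def canR (m : M.carrier) : Y.TensorRL →ₗ[F] CanDom M :=
  Bal.map (M.smulR.flip m) LinearMap.id (smulR_flip_mulRight M m) (fun _ _ => rfl)

theorem canR_tmul (m : M.carrier) (x y : B) :
    canR M m (Bal.tmul (fun r => LinearMap.mulRight F (Y.ι r)) Y.act x y) =
      Bal.tmul (fun r => M.smulR (Y.ι r)) Y.act (M.smulR x m) y := by
  rw [canR, Bal.map_tmul, LinearMap.id_apply, LinearMap.flip_apply]

theorem map_id_smulR_mapR (c : B) (s : B ⊗[F] B) (t : M.carrier ⊗[F] M.carrier) :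
    TensorProduct.map LinearMap.id (M.smulR c) (TensorProduct.map₂ M.smulR M.smulR s t) =
      TensorProduct.map₂ M.smulR M.smulR
        (TensorProduct.map LinearMap.id (LinearMap.mulRight F c) s) t := by
  induction s with
  | zero => simp only [map_zero, LinearMap.zero_apply]
  | add x y hx hy => simp only [map_add, LinearMap.add_apply, hx, hy]
  | tmul b b' =>
    induction t with
    | zero => simp only [map_zero]
    | add x y hx hy => simp only [map_add, hx, hy]
    | tmul m m' => exact congrArg (M.smulR b m ⊗ₜ[F] ·) (M.smulR_mul b' c m').symm

theorem mapL_map_id (c : B) (s : B ⊗[F] B) (u : N.carrier ⊗[F] N.carrier) :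
    mapL N.smulL s (TensorProduct.map LinearMap.id (N.smulL c) u) =
      mapL N.smulL (TensorProduct.map LinearMap.id (LinearMap.mulRight F c) s) u := by
  induction s with
  | zero => simp only [map_zero, LinearMap.zero_apply]
  | add x y hx hy => simp only [map_add, LinearMap.add_apply, hx, hy]
  | tmul b b' =>
    induction u with
    | zero => simp only [map_zero]
    | add x y hx hy => simp only [map_add, hx, hy]
    | tmul m m' => exact congrArg (N.smulL b m ⊗ₜ[F] ·) (N.smulL_mul b' c m').symm

end

end PreprincipalBimodule

end Bimodule
end Algd

/-! ### The tensor product of principal bimodules is principal -/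

namespace Algd

section Bimodule

variable {F : Type*} [Field F]
  {R : Type*} [NonUnitalCommRing R] [Module F R]
  {A : Type*} [NonUnitalRing A] [Module F A] [IsScalarTower F A A] [SMulCommClass F A A]
  {R' : Type*} [NonUnitalCommRing R'] [Module F R']
  {B : Type*} [NonUnitalRing B] [Module F B] [IsScalarTower F B B] [SMulCommClass F B B]
  {R'' : Type*} [NonUnitalCommRing R''] [Module F R'']
  {C : Type*} [NonUnitalRing C] [Module F C] [IsScalarTower F C C] [SMulCommClass F C C]

variable {X : Bialgebroid F R A} {Y : Bialgebroid F R' B} {Z : Bialgebroid F R'' C}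

/-- The canonical map `a ⊗ b ↦ Δ(a)(1 ⊗ b)` of a bialgebroid. -/
def Bialgebroid.canRL (X : Bialgebroid F R A) : X.TensorRL →ₗ[F] Bal X.act X.act :=
  X.toBimodule.can

theorem Bialgebroid.canRL_tmul (X : Bialgebroid F R A) (a b : A) :
    X.canRL (Bal.tmul _ _ a b) =
      Bal.mk X.act X.act (TensorProduct.map LinearMap.id (LinearMap.mulRight F b)
        (X.coalg.rep a)) :=
  X.toBimodule.can_tmul (m := a) (X.coalg.isRep_rep a) b

namespace PreprincipalBimodule

section

variable (M : PreprincipalBimodule.{u} X Y) (N : PreprincipalBimodule.{u} Y Z)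

theorem can_canL_ι (r : R) (z : CanDom M) :
    M.can (canL M (X.ι r) z) = balAct M.act r (M.can z) := by
  induction z using Bal.induction_on with
  | zero => simp only [map_zero]
  | add x y hx hy => simp only [map_add, hx, hy]
  | tmul m b =>
    rw [canL_tmul, M.can_tmul (m := M.smulL (X.ι r) m) (M.isRep_act (M.coalg.isRep_rep m) r),
      M.can_tmul (M.coalg.isRep_rep m), balAct_mk, TensorProduct.map_map, TensorProduct.map_map]
    rfl

theorem mk_map_act (r : R) (w : M.carrier ⊗[F] M.carrier) :
    Bal.mk M.act M.act (TensorProduct.map LinearMap.id (M.act r) w) =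
      balAct M.act r (Bal.mk M.act M.act w) := by
  rw [balAct_mk]
  induction w with
  | zero => simp only [map_zero]
  | add x y hx hy => simp only [map_add, hx, hy]
  | tmul a b => exact (Bal.tmul_bal M.act M.act r a b).symm

/-- For a right unit r of m, Δ(m)(1 ⊗ r) = Δ(mr) = Δ(m). This makes β⁻¹(Δ(m)) explicit. -/
theorem mk_rep_eq_can {m : M.carrier} {t : M.carrier ⊗[F] M.carrier} (ht : M.coalg.IsRep m t)
    (r : R') (hr : M.smulR (Y.ι r) m = m) :
    M.can (Bal.tmul (fun r => M.smulR (Y.ι r)) Y.act m (Y.ι r)) = Bal.mk M.act M.act t := by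
  have h := M.isRep_smulR_ι ht r
  rw [hr] at h
  rw [M.can_tmul ht, ← M.mk_map_smulR ht, h.eq, ht.eq]

/-- The inverse of the left B-linear map β_N is left B-linear. -/
theorem symm_mk_mapL (e : CanDom N ≃ₗ[F] Bal N.act N.act) (he : ∀ z, e z = N.can z)
    {b : B} {s : B ⊗[F] B} (hs : Y.coalg.IsRep b s) (w : N.carrier ⊗[F] N.carrier) :
    e.symm (Bal.mk N.act N.act (mapL N.smulL s w)) = canL N b (e.symm (Bal.mk N.act N.act w)) := by
  rw [LinearEquiv.symm_apply_eq, he]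
  exact (can_canL N hs _ w (by rw [← he, LinearEquiv.apply_symm_apply])).symm

theorem symm_mk_map_act (e : CanDom N ≃ₗ[F] Bal N.act N.act) (he : ∀ z, e z = N.can z)
    (r : R') (w : N.carrier ⊗[F] N.carrier) :
    e.symm (Bal.mk N.act N.act (TensorProduct.map LinearMap.id (N.act r) w)) =
      canL N (Y.ι r) (e.symm (Bal.mk N.act N.act w)) := by
  rw [LinearEquiv.symm_apply_eq, he, can_canL_ι, ← he, LinearEquiv.apply_symm_apply, mk_map_act]

/-- The map `(m, b, n ⊗ n') ↦ m ⊗ β⁻¹(n ⊗ b n')`, where `β` is the canonical map of `N`. -/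
def pairing (e : CanDom N ≃ₗ[F] Bal N.act N.act) (m : M.carrier) (b : B) :
    N.carrier ⊗[F] N.carrier →ₗ[F] TensorCanDom M N :=
  assocCan M N m ∘ₗ e.symm.toLinearMap ∘ₗ Bal.mk N.act N.act ∘ₗ
    TensorProduct.map LinearMap.id (N.smulL b)

theorem pairing_apply (e : CanDom N ≃ₗ[F] Bal N.act N.act) (m : M.carrier) (b : B)
    (u : N.carrier ⊗[F] N.carrier) : pairing M N e m b u =
      assocCan M N m (e.symm (Bal.mk N.act N.act (TensorProduct.map LinearMap.id (N.smulL b) u))) :=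
  rfl

/-- The map `m ⊗ b ↦ (n ⊗ n' ↦ m ⊗ β⁻¹(n ⊗ b n'))`. -/
def pairingLift (e : CanDom N ≃ₗ[F] Bal N.act N.act) (he : ∀ z, e z = N.can z) :
    CanDom M →ₗ[F] N.carrier ⊗[F] N.carrier →ₗ[F] TensorCanDom M N :=
  Bal.lift _ _ (LinearMap.mk₂ F (pairing M N e)
    (fun m m' b => LinearMap.ext fun u => by
      simp only [pairing_apply, map_add, LinearMap.add_apply])
    (fun k m b => LinearMap.ext fun u => by
      simp only [pairing_apply, map_smul, LinearMap.smul_apply])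
    (fun m b b' => LinearMap.ext fun u => by
      simp only [pairing_apply, map_add, LinearMap.add_apply, TensorProduct.map_add_right])
    (fun k m b => LinearMap.ext fun u => by
      simp only [pairing_apply, map_smul, LinearMap.smul_apply, TensorProduct.map_smul_right]))
    (fun r m b => LinearMap.ext fun u => by
      simp only [LinearMap.mk₂_apply, pairing_apply]
      -- Here mr ⊗ β⁻¹(n ⊗ bn') = m ⊗ rβ⁻¹(n ⊗ bn') = m ⊗ β⁻¹(n ⊗ rbn'), with r acting on the second
      -- leg by balancing over R'.
      rw [assocCan_smulR, ← symm_mk_map_act N e he, TensorProduct.map_map]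
      congr 5
      ext n
      exact (N.smulL_mul (Y.ι r) b n).symm)

theorem pairingLift_tmul (e : CanDom N ≃ₗ[F] Bal N.act N.act) (he : ∀ z, e z = N.can z)
    (m : M.carrier) (b : B) (u : N.carrier ⊗[F] N.carrier) :
    pairingLift M N e he (Bal.tmul _ _ m b) u = pairing M N e m b u := by
  rw [pairingLift, Bal.lift_tmul, LinearMap.mk₂_apply]

/-- The canonical map of `M ⊗_B N`. -/
noncomputable def tensorCan :
    TensorCanDom M N →ₗ[F] Bal (tensorAct M N) (tensorAct M N) := (tensor M N).can

theorem tensorCan_tmul (m : M.carrier) (n : N.carrier) (c : C) :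
    tensorCan M N (Bal.tmul _ _ (tm M N m n) c) =
      Bal.mk (tensorAct M N) (tensorAct M N) (shuffle M N (M.coalg.rep m)
        (TensorProduct.map LinearMap.id (N.smulR c) (N.coalg.rep n))) := by
  rw [← shuffle_map_tensorR_right]
  exact (tensor M N).can_tmul (m := tm M N m n)
    (isRep_tensor M N (M.coalg.isRep_rep m) (N.coalg.isRep_rep n)) c

theorem tensorCan_assocCan (m : M.carrier) (z : CanDom N) (w : N.carrier ⊗[F] N.carrier)
    (hw : Bal.mk N.act N.act w = N.can z) :
    tensorCan M N (assocCan M N m z) =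
      Bal.mk (tensorAct M N) (tensorAct M N) (shuffle M N (M.coalg.rep m) w) := by
  obtain ⟨σ, hσ⟩ := Module.projective_lifting_property (Bal.mk N.act N.act) N.can
    (Bal.mk_surjective _ _)
  have hσ : ∀ z, Bal.mk N.act N.act (σ z) = N.can z := fun z => LinearMap.congr_fun hσ z
  have h1 : tensorCan M N (assocCan M N m z) =
      Bal.mk (tensorAct M N) (tensorAct M N) (shuffle M N (M.coalg.rep m) (σ z)) := by
    induction z using Bal.induction_on generalizing w with
    | zero => simp only [map_zero]
    | add x y hx hy => simp only [map_add, hx _ (hσ x), hy _ (hσ y)]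
    | tmul n c =>
      rw [assocCan_tmul, tensorCan_tmul]
      refine shuffle_congr_right M N (M.coalg.isRep_rep m) ?_
      rw [hσ, N.can_tmul (N.coalg.isRep_rep n)]
  rw [h1]
  exact shuffle_congr_right M N (M.coalg.isRep_rep m) ((hσ z).trans hw.symm)

/-- For v = m ⊗ b and u = n ⊗ n' the canonical map yields the shuffle of Δ(m) with n ⊗ bn'; passing
b to the second leg of Δ(m) turns this into the shuffle of β_M(v) with u. Taking v = β_M⁻¹(m ⊗ m')
gives preimages of all elementary tensors. -/
theorem tensorCan_pairingLift (e : CanDom N ≃ₗ[F] Bal N.act N.act) (he : ∀ z, e z = N.can z)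
    (v : CanDom M) (s : M.carrier ⊗[F] M.carrier) (hs : Bal.mk M.act M.act s = M.can v)
    (u : N.carrier ⊗[F] N.carrier) :
    tensorCan M N (pairingLift M N e he v u) =
      Bal.mk (tensorAct M N) (tensorAct M N) (shuffle M N s u) := by
  obtain ⟨σ, hσ⟩ := Module.projective_lifting_property (Bal.mk M.act M.act) M.can
    (Bal.mk_surjective _ _)
  have hσ : ∀ z, Bal.mk M.act M.act (σ z) = M.can z := fun z => LinearMap.congr_fun hσ z
  have h1 : tensorCan M N (pairingLift M N e he v u) =
      Bal.mk (tensorAct M N) (tensorAct M N) (shuffle M N (σ v) u) := by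
    induction v using Bal.induction_on generalizing s with
    | zero => simp only [map_zero, LinearMap.zero_apply]
    | add x y hx hy => simp only [map_add, LinearMap.add_apply, hx _ (hσ x), hy _ (hσ y)]
    | tmul m b =>
      rw [pairingLift_tmul, pairing_apply, tensorCan_assocCan M N m _ _
        (by rw [← he, LinearEquiv.apply_symm_apply]), ← shuffle_map_smulR_right]
      refine shuffle_congr_left M N ?_ u
      rw [hσ, M.can_tmul (M.coalg.isRep_rep m)]
  rw [h1]
  exact shuffle_congr_left M N ((hσ v).trans hs.symm) u

theorem tensorCan_surjective (hM : Function.Surjective M.can) (hN : Function.Bijective N.can) :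
    Function.Surjective (tensorCan M N) := by
  intro z
  induction z using Bal.induction_on with
  | zero => exact ⟨0, map_zero _⟩
  | add x y hx hy =>
    obtain ⟨x, rfl⟩ := hx
    obtain ⟨y, rfl⟩ := hy
    exact ⟨x + y, map_add _ _ _⟩
  | tmul p q =>
    induction p using Tensor.induction_on with
    | zero => exact ⟨0, by simp only [map_zero, LinearMap.zero_apply]⟩
    | add x y hx hy =>
      obtain ⟨x, hx⟩ := hx
      obtain ⟨y, hy⟩ := hy
      exact ⟨x + y, by simp only [map_add, LinearMap.add_apply, hx, hy]⟩
    | tmul m n =>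
      induction q using Tensor.induction_on with
      | zero => exact ⟨0, by simp only [map_zero]⟩
      | add x y hx hy =>
        obtain ⟨x, hx⟩ := hx
        obtain ⟨y, hy⟩ := hy
        exact ⟨x + y, by simp only [map_add, hx, hy]⟩
      | tmul m' n' =>
        obtain ⟨v, hv⟩ := hM (Bal.mk M.act M.act (m ⊗ₜ m'))
        exact ⟨pairingLift M N (LinearEquiv.ofBijective N.can hN) (fun _ => rfl) v (n ⊗ₜ n'),
          tensorCan_pairingLift M N _ _ v _ hv.symm _⟩

theorem pairingLift_canMulRight (e : CanDom N ≃ₗ[F] Bal N.act N.act) (he : ∀ z, e z = N.can z)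
    (b : B) (v : CanDom M) (u : N.carrier ⊗[F] N.carrier) :
    pairingLift M N e he (M.canMulRight b v) u =
      pairingLift M N e he v (TensorProduct.map LinearMap.id (N.smulL b) u) := by
  induction v using Bal.induction_on with
  | zero => simp only [map_zero, LinearMap.zero_apply]
  | add x y hx hy => simp only [map_add, LinearMap.add_apply, hx, hy]
  | tmul m c =>
    rw [M.canMulRight_tmul, pairingLift_tmul, pairingLift_tmul, pairing_apply, pairing_apply,
      TensorProduct.map_map]
    congr 5
    ext n
    exact N.smulL_mul c b n

/-- For p = Σ x ⊗ y the identity reads Σ Δ(mx)(1 ⊗ y) = Δ(m)·Σ Δ(x)(1 ⊗ y), and the last sum is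
β_B(p). -/
theorem can_canR (m : M.carrier) (p : Y.TensorRL) (q : B ⊗[F] B)
    (hq : Bal.mk Y.act Y.act q = Y.canRL p) :
    M.can (canR M m p) =
      Bal.mk M.act M.act (TensorProduct.map₂ M.smulR M.smulR q (M.coalg.rep m)) := by
  obtain ⟨σ, hσ⟩ := Module.projective_lifting_property (Bal.mk Y.act Y.act) Y.canRL
    (Bal.mk_surjective _ _)
  have hσ : ∀ z, Bal.mk Y.act Y.act (σ z) = Y.canRL z := fun z => LinearMap.congr_fun hσ z
  have h1 : M.can (canR M m p) =
      Bal.mk M.act M.act (TensorProduct.map₂ M.smulR M.smulR (σ p) (M.coalg.rep m)) := by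
    induction p using Bal.induction_on generalizing q with
    | zero => simp only [map_zero, LinearMap.zero_apply]
    | add x y hx hy => simp only [map_add, LinearMap.add_apply, hx _ (hσ x), hy _ (hσ y)]
    | tmul x y =>
      rw [canR_tmul, M.can_tmul (M.comul_smulR _ _ _ _ (Y.coalg.isRep_rep x) (M.coalg.isRep_rep m)),
        map_id_smulR_mapR]
      refine mapR_congr_left M (M.coalg.isRep_rep m) ?_
      exact ((hσ _).trans (Y.canRL_tmul x y)).symm
  rw [h1]
  exact mapR_congr_left M (M.coalg.isRep_rep m) ((hσ p).trans hq.symm)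

/-- For p = Σ x ⊗ y and u = n ⊗ n', Σ mx ⊗ β_N⁻¹(n ⊗ yn') = m ⊗ Σ xβ_N⁻¹(n ⊗ yn') = m ⊗
β_N⁻¹(β_B(p)(n ⊗ n')), by left B-linearity of β_N⁻¹. -/
theorem pairingLift_canR (e : CanDom N ≃ₗ[F] Bal N.act N.act) (he : ∀ z, e z = N.can z)
    (m : M.carrier) (p : Y.TensorRL) (q : B ⊗[F] B)
    (hq : Bal.mk Y.act Y.act q = Y.canRL p) (u : N.carrier ⊗[F] N.carrier) :
    pairingLift M N e he (canR M m p) u =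
      assocCan M N m (e.symm (Bal.mk N.act N.act (mapL N.smulL q u))) := by
  obtain ⟨σ, hσ⟩ := Module.projective_lifting_property (Bal.mk Y.act Y.act) Y.canRL
    (Bal.mk_surjective _ _)
  have hσ : ∀ z, Bal.mk Y.act Y.act (σ z) = Y.canRL z := fun z => LinearMap.congr_fun hσ z
  have h1 : pairingLift M N e he (canR M m p) u =
      assocCan M N m (e.symm (Bal.mk N.act N.act (mapL N.smulL (σ p) u))) := by
    induction p using Bal.induction_on generalizing q with
    | zero => simp only [map_zero, LinearMap.zero_apply]
    | add x y hx hy => simp only [map_add, LinearMap.add_apply, hx _ (hσ x), hy _ (hσ y)]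
    | tmul x y =>
      rw [canR_tmul, pairingLift_tmul, pairing_apply, assocCan_smulR,
        ← symm_mk_mapL N e he (Y.coalg.isRep_rep x), mapL_map_id]
      congr 2
      refine mapL_congr_left N.smulL ?_ u
      exact ((hσ _).trans (Y.canRL_tmul x y)).symm
  rw [h1]
  congr 2
  exact mapL_congr_left N.smulL ((hσ p).trans hq.symm) u

/-- The balancing condition that uses principality of B. For v = m ⊗ c write b ⊗ c = β_B(Σ x ⊗ y);
then Δ(m)(b ⊗ c) = β_M(Σ mx ⊗ y) by `can_canR`, and `pairingLift_canR` transfers b ⊗ c to N. -/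
theorem pairingLift_smulR (hM : Function.Bijective M.can)
    (hY : Function.Surjective Y.canRL)
    (e : CanDom N ≃ₗ[F] Bal N.act N.act) (he : ∀ z, e z = N.can z) (b : B) (v v' : CanDom M)
    (h : M.can v' = endMap M.act (M.smulR b) LinearMap.id (fun s c => M.smulR_act s b c)
      (fun _ _ => rfl) (M.can v)) (u : N.carrier ⊗[F] N.carrier) :
    pairingLift M N e he v' u =
      pairingLift M N e he v (TensorProduct.map (N.smulL b) LinearMap.id u) := by
  induction v using Bal.induction_on generalizing v' with
  | zero =>
    have : v' = 0 := hM.1 (by rw [h]; simp only [map_zero])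
    rw [this]
    simp only [map_zero, LinearMap.zero_apply]
  | add x y hx hy =>
    -- Since β_M is bijective, v' is determined by v and depends on it additively.
    obtain ⟨x', hx'⟩ := hM.2 (endMap M.act (M.smulR b) LinearMap.id
      (fun s c => M.smulR_act s b c) (fun _ _ => rfl) (M.can x))
    obtain ⟨y', hy'⟩ := hM.2 (endMap M.act (M.smulR b) LinearMap.id
      (fun s c => M.smulR_act s b c) (fun _ _ => rfl) (M.can y))
    have : v' = x' + y' := hM.1 (by rw [h, map_add, map_add, map_add, hx', hy'])
    rw [this]
    simp only [map_add, LinearMap.add_apply, hx x' hx', hy y' hy']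
  | tmul m c =>
    obtain ⟨p, hp⟩ := hY (Bal.mk Y.act Y.act (b ⊗ₜ c))
    have : v' = canR M m p := hM.1 (by
      rw [h, can_canR M m p _ hp.symm, M.can_tmul (M.coalg.isRep_rep m), endMap_mk,
        TensorProduct.map_map]
      rfl)
    rw [this, pairingLift_canR M N e he m p _ hp.symm, pairingLift_tmul, pairing_apply,
      TensorProduct.map_map]
    rfl

theorem tensorCan_injective (hM : Function.Bijective M.can) (hN : Function.Bijective N.can)
    (hY : Function.Surjective Y.canRL) : Function.Injective (tensorCan M N) := by
  let e := LinearEquiv.ofBijective N.can hN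
  have he : ∀ z, e z = N.can z := fun _ => rfl
  let e' := LinearEquiv.ofBijective M.can hM
  have he' : ∀ z, M.can (e'.symm z) = z := fun z => e'.apply_symm_apply z
  -- The left inverse: (m ⊗ m', n ⊗ n') ↦ Σ mᵢ ⊗ β_N⁻¹(n ⊗ bᵢn') with Σ mᵢ ⊗ bᵢ = β_M⁻¹(m ⊗ m'). The
  -- three arguments are its balancing over B in the first leg, over B in the second leg, and over
  -- R.
  obtain ⟨g, hg⟩ := exists_tensor_desc M N
    (pairingLift M N e he ∘ₗ e'.symm.toLinearMap ∘ₗ Bal.mk M.act M.act)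
    (fun b m m' n n' => by
      refine (pairingLift_smulR M N hM hY e he b (e'.symm (Bal.mk M.act M.act (m ⊗ₜ m'))) _ ?_ _)
      rw [he', endMap_mk]
      exact he' _)
    (fun b m m' n n' => by
      refine Eq.trans ?_ (pairingLift_canMulRight M N e he b
        (e'.symm (Bal.mk M.act M.act (m ⊗ₜ m'))) (n ⊗ₜ n'))
      refine congrArg (fun v => pairingLift M N e he v (n ⊗ₜ n')) (hM.1 ?_)
      rw [M.can_mulRight, he', endMap_mk]
      exact he' _)
    (fun r m m' u => by
      simp only [LinearMap.comp_apply]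
      rw [Bal.mk_tmul, Bal.mk_tmul, Bal.tmul_bal])
  have h1 : ∀ z, g (tensorCan M N z) = z := by
    intro z
    induction z using Bal.induction_on with
    | zero => simp only [map_zero]
    | add x y hx hy => simp only [map_add, hx, hy]
    | tmul p c =>
      induction p using Tensor.induction_on with
      | zero => simp only [map_zero, LinearMap.zero_apply]
      | add x y hx hy => simp only [map_add, LinearMap.add_apply, hx, hy]
      | tmul m n =>
        obtain ⟨r, hr⟩ := M.unitaryR {m}
        have hr := hr m (Finset.mem_singleton_self _)
        -- Since β_M⁻¹(Δ(m)) = m ⊗ r with mr = m, the sum defining the left inverse has a single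
        -- term.
        have h2 : e'.symm (Bal.mk M.act M.act (M.coalg.rep m)) =
            Bal.tmul (fun r => M.smulR (Y.ι r)) Y.act m (Y.ι r) := by
          rw [LinearEquiv.symm_apply_eq]
          exact (mk_rep_eq_can M (M.coalg.isRep_rep m) r hr).symm
        have h3 : e.symm (Bal.mk N.act N.act
            (TensorProduct.map LinearMap.id (N.smulR c) (N.coalg.rep n))) = Bal.tmul _ _ n c := by
          rw [LinearEquiv.symm_apply_eq]
          exact (N.can_tmul (N.coalg.isRep_rep n) c).symm
        rw [tensorCan_tmul, hg]
        simp only [LinearMap.comp_apply, LinearEquiv.coe_coe]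
        rw [h2, pairingLift_tmul, pairing_apply]
        refine (congrArg (assocCan M N m) (symm_mk_map_act N e he r _)).trans ?_
        rw [h3, ← assocCan_smulR, hr, assocCan_tmul]
  exact Function.LeftInverse.injective h1

theorem tensor_isPrincipal (hM : M.IsPrincipal) (hN : N.IsPrincipal)
    (hY : Y.IsPrincipal) : (tensor M N).IsPrincipal := by
  rw [isPrincipal_iff] at hM hN ⊢
  refine ⟨fun r => ?_, tensorCan_injective M N hM.2 hN.2 (Y.isPrincipal_iff.1 hY).2,
    tensorCan_surjective M N hM.2.2 hN.2⟩
  obtain ⟨m, rfl⟩ := hM.1 r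
  -- If ε(n) is a right unit of m, then ε(m ⊗ n) = ε(mε(n)) = ε(m).
  obtain ⟨r, hr⟩ := M.unitaryR {m}
  obtain ⟨n, rfl⟩ := hN.1 r
  refine ⟨tm M N m n, ?_⟩
  refine (tensorCounit_tm M N m n).trans ?_
  rw [hr m (Finset.mem_singleton_self _)]

end

end PreprincipalBimodule

end Bimodule
end Algd

/-! ### Isomorphisms of bimodules and functoriality of the tensor product -/

namespace Algd

section Bimodule

variable {F : Type*} [Field F]
  {R : Type*} [NonUnitalCommRing R] [Module F R]
  {A : Type*} [NonUnitalRing A] [Module F A] [IsScalarTower F A A] [SMulCommClass F A A]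
  {R' : Type*} [NonUnitalCommRing R'] [Module F R']
  {B : Type*} [NonUnitalRing B] [Module F B] [IsScalarTower F B B] [SMulCommClass F B B]
  {R'' : Type*} [NonUnitalCommRing R''] [Module F R'']
  {C : Type*} [NonUnitalRing C] [Module F C] [IsScalarTower F C C] [SMulCommClass F C C]

variable {X : Bialgebroid F R A} {Y : Bialgebroid F R' B} {Z : Bialgebroid F R'' C}

namespace PreprincipalBimodule

theorem ext_of_span {V W : Type*} [AddCommGroup V] [Module F V] [AddCommGroup W] [Module F W]
    {S : Set V} (hS : Submodule.span F S = ⊤) {f g : V →ₗ[F] W} (h : ∀ v ∈ S, f v = g v) : f = g :=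
  LinearMap.ext_on hS h

/-- A linear isomorphism that respects the structure on a spanning set is an isomorphism of
bimodules. -/
def Iso.ofSpan {M N : PreprincipalBimodule.{u} X Y} (φ : M.carrier ≃ₗ[F] N.carrier)
    {S : Set M.carrier} (hS : Submodule.span F S = ⊤)
    (hL : ∀ m ∈ S, ∀ a, φ (M.smulL a m) = N.smulL a (φ m))
    (hR : ∀ m ∈ S, ∀ b, φ (M.smulR b m) = N.smulR b (φ m))
    (hε : ∀ m ∈ S, N.coalg.counit (φ m) = M.coalg.counit m)
    (hΔ : ∀ m ∈ S, ∃ t, M.coalg.IsRep m t ∧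
      N.coalg.IsRep (φ m) (TensorProduct.map φ.toLinearMap φ.toLinearMap t)) : Iso M N :=
  have hL' : ∀ a m, φ (M.smulL a m) = N.smulL a (φ m) := fun a =>
    LinearMap.congr_fun (f := φ.toLinearMap ∘ₗ M.smulL a)
      (g := N.smulL a ∘ₗ φ.toLinearMap) (ext_of_span hS fun m hm => hL m hm a)
  have hΔ' : ∀ m ∈ S, N.coalg.comul (φ m) =
      Bal.map (ρ' := N.act) (l' := N.act) φ.toLinearMap φ.toLinearMap
        (fun s m => hL' (X.ι s) m) (fun s m => hL' (X.ι s) m) (M.coalg.comul m) := by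
    intro m hm
    obtain ⟨t, ht, ht'⟩ := hΔ m hm
    have h := Bal.map_mk (ρ := M.act) (l := M.act) (ρ' := N.act) (l' := N.act) φ.toLinearMap
      φ.toLinearMap (fun s m => hL' (X.ι s) m) (fun s m => hL' (X.ι s) m) t
    rw [ht.eq] at h
    exact ht'.symm.trans h.symm
  { toEquiv := φ
    map_smulL := hL'
    map_smulR := fun b => LinearMap.congr_fun (f := φ.toLinearMap ∘ₗ M.smulR b)
      (g := N.smulR b ∘ₗ φ.toLinearMap) (ext_of_span hS fun m hm => hR m hm b)
    map_counit := LinearMap.congr_fun (f := N.coalg.counit ∘ₗ φ.toLinearMap)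
      (g := M.coalg.counit) (ext_of_span hS hε)
    map_comul := LinearMap.congr_fun (f := N.coalg.comul ∘ₗ φ.toLinearMap)
      (g := Bal.map (ρ' := N.act) (l' := N.act) φ.toLinearMap φ.toLinearMap
        (fun s m => hL' (X.ι s) m) (fun s m => hL' (X.ι s) m) ∘ₗ M.coalg.comul)
      (ext_of_span hS hΔ') }

theorem Iso.isRep {M N : PreprincipalBimodule.{u} X Y} (i : Iso M N) {m : M.carrier}
    {t : M.carrier ⊗[F] M.carrier} (ht : M.coalg.IsRep m t) :
    N.coalg.IsRep (i.toEquiv m)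
      (TensorProduct.map i.toEquiv.toLinearMap i.toEquiv.toLinearMap t) := by
  have h := i.map_comul m
  rw [← ht.eq] at h
  exact (h.trans (Bal.map_mk i.toEquiv.toLinearMap i.toEquiv.toLinearMap _ _ t)).symm

/-- The identity isomorphism. -/
def Iso.refl (M : PreprincipalBimodule.{u} X Y) : Iso M M :=
  Iso.ofSpan (LinearEquiv.refl F M.carrier) (Submodule.span_univ) (fun _ _ _ => rfl)
    (fun _ _ _ => rfl) (fun _ _ => rfl) (fun m _ => ⟨_, M.coalg.isRep_rep m, by
      rw [LinearEquiv.refl_toLinearMap, TensorProduct.map_id]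
      exact M.coalg.isRep_rep m⟩)

/-- The composition of isomorphisms. -/
def Iso.trans {M N P : PreprincipalBimodule.{u} X Y} (i : Iso M N) (j : Iso N P) : Iso M P :=
  Iso.ofSpan (i.toEquiv.trans j.toEquiv) (Submodule.span_univ)
    (fun m _ a => by
      simp only [LinearEquiv.trans_apply, i.map_smulL, j.map_smulL])
    (fun m _ b => by simp only [LinearEquiv.trans_apply, i.map_smulR, j.map_smulR])
    (fun m _ => by simp only [LinearEquiv.trans_apply, i.map_counit, j.map_counit])
    (fun m _ => ⟨_, M.coalg.isRep_rep m, by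
      have h := j.isRep (i.isRep (M.coalg.isRep_rep m))
      rw [TensorProduct.map_map] at h
      exact h⟩)

/-- The inverse of an isomorphism. -/
def Iso.symm {M N : PreprincipalBimodule.{u} X Y} (i : Iso M N) : Iso N M :=
  Iso.ofSpan i.toEquiv.symm (Submodule.span_univ)
    (fun m _ a => by
      rw [LinearEquiv.symm_apply_eq, i.map_smulL, LinearEquiv.apply_symm_apply])
    (fun m _ b => by
      rw [LinearEquiv.symm_apply_eq, i.map_smulR, LinearEquiv.apply_symm_apply])
    (fun m _ => by rw [← i.map_counit, LinearEquiv.apply_symm_apply])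
    (fun m _ => by
      obtain ⟨m, rfl⟩ := i.toEquiv.surjective m
      refine ⟨_, i.isRep (M.coalg.isRep_rep m), ?_⟩
      rw [TensorProduct.map_map, LinearEquiv.symm_apply_apply]
      have h : i.toEquiv.symm.toLinearMap ∘ₗ i.toEquiv.toLinearMap = LinearMap.id :=
        LinearMap.ext fun m => i.toEquiv.symm_apply_apply m
      rw [h, TensorProduct.map_id]
      exact M.coalg.isRep_rep m)

theorem iso_equivalence :
    Equivalence fun M N : PreprincipalBimodule.{u} X Y => Nonempty (Iso M N) :=
  ⟨fun M => ⟨Iso.refl M⟩, fun ⟨i⟩ => ⟨i.symm⟩, fun ⟨i⟩ ⟨j⟩ => ⟨i.trans j⟩⟩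

theorem map_shuffle {P : Type*} [AddCommGroup P] [Module F P] (M : PreprincipalBimodule.{u} X Y)
    (N : PreprincipalBimodule.{u} Y Z) (f : Tensor M N →ₗ[F] P) (t : M.carrier ⊗[F] M.carrier)
    (u : N.carrier ⊗[F] N.carrier) :
    TensorProduct.map f f (shuffle M N t u) =
      TensorProduct.map₂ ((tm M N).compr₂ f) ((tm M N).compr₂ f) t u := by
  induction t with
  | zero => simp only [map_zero, LinearMap.zero_apply]
  | add x y hx hy => simp only [map_add, LinearMap.add_apply, hx, hy]
  | tmul m m' =>
    induction u with
    | zero => simp only [map_zero]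
    | add x y hx hy => simp only [map_add, hx, hy]
    | tmul n n' => rfl

/-- A tensor product of `M` and `N` is isomorphic to the standard one. -/
noncomputable def TensorIso.iso {M : PreprincipalBimodule.{u} X Y} {N : PreprincipalBimodule.{u} Y Z}
    {P : PreprincipalBimodule.{u} X Z} (i : TensorIso M N P) : Iso (tensor M N) P :=
  Iso.ofSpan (M := tensor M N) (N := P) i.toEquiv (span_tm M N)
    (by
      rintro _ ⟨m, n, rfl⟩ a
      exact (congrArg i.toEquiv (tensorL_tm M N a m n)).trans (i.map_smulL a m n).symm)
    (by
      rintro _ ⟨m, n, rfl⟩ c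
      exact (congrArg i.toEquiv (tensorR_tm M N c m n)).trans (i.map_smulR c m n).symm)
    (by
      rintro _ ⟨m, n, rfl⟩
      exact (i.map_counit m n).trans (tensorCounit_tm M N m n).symm)
    (by
      rintro _ ⟨m, n, rfl⟩
      refine ⟨_, isRep_tensor M N (M.coalg.isRep_rep m) (N.coalg.isRep_rep n), ?_⟩
      have h := i.map_comul m n _ _ (M.coalg.isRep_rep m) (N.coalg.isRep_rep n)
      have h' := map_shuffle M N i.toEquiv.toLinearMap (M.coalg.rep m) (N.coalg.rep n)
      exact (congrArg (P.coalg.IsRep _) h').mpr h)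

/-- The map `f ⊗ g : M ⊗_B N → M' ⊗_B N'`. -/
def tensorMap {M M' : PreprincipalBimodule.{u} X Y} {N N' : PreprincipalBimodule.{u} Y Z}
    (i : Iso M M') (j : Iso N N') : Tensor M N →ₗ[F] Tensor M' N' :=
  Tensor.lift ((tm M' N').compl₁₂ i.toEquiv.toLinearMap j.toEquiv.toLinearMap) (fun b m n => by
    simp only [LinearMap.compl₁₂_apply, LinearEquiv.coe_coe, i.map_smulR, j.map_smulL, tm_bal])

theorem tensorMap_tm {M M' : PreprincipalBimodule.{u} X Y} {N N' : PreprincipalBimodule.{u} Y Z}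
    (i : Iso M M') (j : Iso N N') (m : M.carrier) (n : N.carrier) :
    tensorMap i j (tm M N m n) = tm M' N' (i.toEquiv m) (j.toEquiv n) :=
  Tensor.lift_tm _ _ _ _

/-- The isomorphism `f ⊗ g : M ⊗_B N → M' ⊗_B N'`. -/
def tensorEquiv {M M' : PreprincipalBimodule.{u} X Y} {N N' : PreprincipalBimodule.{u} Y Z}
    (i : Iso M M') (j : Iso N N') : Tensor M N ≃ₗ[F] Tensor M' N' :=
  have h1 : ∀ m, i.symm.toEquiv (i.toEquiv m) = m := i.toEquiv.symm_apply_apply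
  have h2 : ∀ n, j.symm.toEquiv (j.toEquiv n) = n := j.toEquiv.symm_apply_apply
  have h3 : ∀ m, i.toEquiv (i.symm.toEquiv m) = m := i.toEquiv.apply_symm_apply
  have h4 : ∀ n, j.toEquiv (j.symm.toEquiv n) = n := j.toEquiv.apply_symm_apply
  LinearEquiv.ofLinearMap (tensorMap i j) (tensorMap i.symm j.symm)
    (Tensor.hom_ext fun m n => by
      simp only [LinearMap.comp_apply, tensorMap_tm, h3, h4, LinearMap.id_apply])
    (Tensor.hom_ext fun m n => by
      simp only [LinearMap.comp_apply, tensorMap_tm, h1, h2, LinearMap.id_apply])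

/-- The tensor product respects isomorphisms. -/
noncomputable def tensorCongr {M M' : PreprincipalBimodule.{u} X Y}
    {N N' : PreprincipalBimodule.{u} Y Z} (i : Iso M M') (j : Iso N N') :
    Iso (tensor M N) (tensor M' N') := by
  refine Iso.ofSpan (M := tensor M N) (N := tensor M' N') (tensorEquiv i j)
    (span_tm M N) ?_ ?_ ?_ ?_
  · rintro _ ⟨m, n, rfl⟩ a
    change tensorMap i j (tensorL M N a (tm M N m n)) =
      tensorL M' N' a (tensorMap i j (tm M N m n))
    rw [tensorL_tm, tensorMap_tm, tensorMap_tm, tensorL_tm, i.map_smulL]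
  · rintro _ ⟨m, n, rfl⟩ c
    change tensorMap i j (tensorR M N c (tm M N m n)) =
      tensorR M' N' c (tensorMap i j (tm M N m n))
    rw [tensorR_tm, tensorMap_tm, tensorMap_tm, tensorR_tm, j.map_smulR]
  · rintro _ ⟨m, n, rfl⟩
    change tensorCounit M' N' (tensorMap i j (tm M N m n)) = tensorCounit M N (tm M N m n)
    rw [tensorMap_tm, tensorCounit_tm, tensorCounit_tm, j.map_counit, ← i.map_smulR, i.map_counit]
  · rintro _ ⟨m, n, rfl⟩
    refine ⟨_, isRep_tensor M N (M.coalg.isRep_rep m) (N.coalg.isRep_rep n), ?_⟩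
    have h := isRep_tensor M' N' (i.isRep (M.coalg.isRep_rep m)) (j.isRep (N.coalg.isRep_rep n))
    have h' : ∀ t u, TensorProduct.map (tensorMap i j) (tensorMap i j) (shuffle M N t u) =
        shuffle M' N' (TensorProduct.map i.toEquiv.toLinearMap i.toEquiv.toLinearMap t)
          (TensorProduct.map j.toEquiv.toLinearMap j.toEquiv.toLinearMap u) := by
      intro t u
      induction t with
      | zero => simp only [map_zero, LinearMap.zero_apply]
      | add x y hx hy => simp only [map_add, LinearMap.add_apply, hx, hy]
      | tmul m m' =>
        induction u with
        | zero => simp only [map_zero]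
        | add x y hx hy => simp only [map_add, hx, hy]
        | tmul n n' =>
          simp only [TensorProduct.map_tmul, shuffle_tmul, tensorMap_tm, LinearEquiv.coe_coe]
    rw [← h', ← tensorMap_tm] at h
    exact h

end PreprincipalBimodule

end Bimodule
end Algd

/-! ### Associativity of the tensor product and its units -/

namespace Algd

section Bimodule

variable {F : Type*} [Field F]
  {R : Type*} [NonUnitalCommRing R] [Module F R]
  {A : Type*} [NonUnitalRing A] [Module F A] [IsScalarTower F A A] [SMulCommClass F A A]
  {R' : Type*} [NonUnitalCommRing R'] [Module F R']
  {B : Type*} [NonUnitalRing B] [Module F B] [IsScalarTower F B B] [SMulCommClass F B B]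
  {R'' : Type*} [NonUnitalCommRing R''] [Module F R'']
  {C : Type*} [NonUnitalRing C] [Module F C] [IsScalarTower F C C] [SMulCommClass F C C]

variable {R₃ : Type*} [NonUnitalCommRing R₃] [Module F R₃]
  {D : Type*} [NonUnitalRing D] [Module F D] [IsScalarTower F D D] [SMulCommClass F D D]
  {W : Bialgebroid F R₃ D}

variable {X : Bialgebroid F R A} {Y : Bialgebroid F R' B} {Z : Bialgebroid F R'' C}

theorem map₂_flip_apply {U V W : Type*} [AddCommGroup U] [Module F U] [AddCommGroup V] [Module F V]
    [AddCommGroup W] [Module F W] (f g : U →ₗ[F] V →ₗ[F] W) (t : U ⊗[F] U) (u : V ⊗[F] V) :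
    TensorProduct.map₂ f g t u = TensorProduct.map₂ f.flip g.flip u t := by
  induction t with
  | zero => simp only [map_zero, LinearMap.zero_apply]
  | add x y hx hy => simp only [map_add, LinearMap.add_apply, hx, hy]
  | tmul m m' =>
    induction u with
    | zero => simp only [map_zero, LinearMap.zero_apply]
    | add x y hx hy => simp only [map_add, LinearMap.add_apply, hx, hy]
    | tmul n n' => rfl

/-- If e is a left unit for the finitely many elements of A that occur in z, then z is e ⊗ (image of
z). This replaces the inverse v ↦ 1 ⊗ v of the unital case. -/
theorem Bal.lift_action_injective {V : Type*} [AddCommGroup V] [Module F V]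
    (L : A →ₗ[F] Module.End F V) (hL : ∀ b a v, L ((LinearMap.mul F A).flip b a) v = L a (L b v))
    (hA : ∀ s : Finset A, ∃ e : A, ∀ a ∈ s, e * a = a) :
    Function.Injective (Bal.lift (LinearMap.mul F A).flip L L hL) := by
  classical
  refine (injective_iff_map_eq_zero _).2 fun z hz => ?_
  have key : ∃ s : Finset A, ∀ e : A, (∀ a ∈ s, e * a = a) →
      z = Bal.tmul (LinearMap.mul F A).flip L e (Bal.lift (LinearMap.mul F A).flip L L hL z) := by
    clear hz
    induction z using Bal.induction_on with
    | zero => exact ⟨∅, fun e _ => by simp only [map_zero]⟩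
    | add x y hx hy =>
      obtain ⟨s, hs⟩ := hx
      obtain ⟨t, ht⟩ := hy
      refine ⟨s ∪ t, fun e he => ?_⟩
      rw [map_add, map_add, ← hs e fun a ha => he a (Finset.mem_union_left _ ha),
        ← ht e fun a ha => he a (Finset.mem_union_right _ ha)]
    | tmul a v =>
      refine ⟨{a}, fun e he => ?_⟩
      rw [Bal.lift_tmul, ← Bal.tmul_bal, LinearMap.flip_apply, LinearMap.mul_apply',
        he a (Finset.mem_singleton_self a)]
  obtain ⟨s, hs⟩ := key
  obtain ⟨e, he⟩ := hA s
  rw [hs e he, hz, map_zero]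

theorem Bal.lift_action_flip_injective {V : Type*} [AddCommGroup V] [Module F V]
    (Q : A →ₗ[F] Module.End F V) (hQ : ∀ b v a, Q.flip (Q b v) a = Q.flip v (LinearMap.mul F A b a))
    (hA : ∀ s : Finset A, ∃ e : A, ∀ a ∈ s, a * e = a) :
    Function.Injective (Bal.lift Q (LinearMap.mul F A) Q.flip hQ) := by
  classical
  refine (injective_iff_map_eq_zero _).2 fun z hz => ?_
  have key : ∃ s : Finset A, ∀ e : A, (∀ a ∈ s, a * e = a) →
      z = Bal.tmul Q (LinearMap.mul F A) (Bal.lift Q (LinearMap.mul F A) Q.flip hQ z) e := by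
    clear hz
    induction z using Bal.induction_on with
    | zero => exact ⟨∅, fun e _ => by simp only [map_zero, LinearMap.zero_apply]⟩
    | add x y hx hy =>
      obtain ⟨s, hs⟩ := hx
      obtain ⟨t, ht⟩ := hy
      refine ⟨s ∪ t, fun e he => ?_⟩
      rw [map_add, map_add, LinearMap.add_apply,
        ← hs e fun a ha => he a (Finset.mem_union_left _ ha),
        ← ht e fun a ha => he a (Finset.mem_union_right _ ha)]
    | tmul v a =>
      refine ⟨{a}, fun e he => ?_⟩
      rw [Bal.lift_tmul, LinearMap.flip_apply, Bal.tmul_bal, LinearMap.mul_apply',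
        he a (Finset.mem_singleton_self a)]
  obtain ⟨s, hs⟩ := key
  obtain ⟨e, he⟩ := hA s
  rw [hs e he, hz, map_zero, LinearMap.zero_apply]

namespace PreprincipalBimodule


namespace TensorIso

section

variable {M : PreprincipalBimodule.{u} X Y} {N : PreprincipalBimodule.{u} Y Z}
  {T : PreprincipalBimodule.{u} X Z} (τ : TensorIso M N T)

/-- The elementary tensors `m ⊗ n` in a tensor product `T` of `M` and `N`. -/
def tmul : M.carrier →ₗ[F] N.carrier →ₗ[F] T.carrier :=
  (Bal.tmul M.smulR N.smulL).compr₂ τ.toEquiv.toLinearMap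

theorem tmul_bal (b : B) (m : M.carrier) (n : N.carrier) :
    τ.tmul (M.smulR b m) n = τ.tmul m (N.smulL b n) :=
  congrArg τ.toEquiv (Bal.tmul_bal M.smulR N.smulL b m n)

theorem smulL_tmul (a : A) (m : M.carrier) (n : N.carrier) :
    T.smulL a (τ.tmul m n) = τ.tmul (M.smulL a m) n :=
  τ.map_smulL a m n

theorem smulR_tmul (c : C) (m : M.carrier) (n : N.carrier) :
    T.smulR c (τ.tmul m n) = τ.tmul m (N.smulR c n) :=
  τ.map_smulR c m n

theorem counit_tmul (m : M.carrier) (n : N.carrier) :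
    T.coalg.counit (τ.tmul m n) = M.coalg.counit (M.smulR (Y.ι (N.coalg.counit n)) m) :=
  τ.map_counit m n

theorem isRep_tmul {m : M.carrier} {n : N.carrier} {t : M.carrier ⊗[F] M.carrier}
    {u : N.carrier ⊗[F] N.carrier} (ht : M.coalg.IsRep m t) (hu : N.coalg.IsRep n u) :
    T.coalg.IsRep (τ.tmul m n) (TensorProduct.map₂ τ.tmul τ.tmul t u) :=
  τ.map_comul m n t u ht hu

theorem induction {p : T.carrier → Prop} (z : T.carrier) (zero : p 0)
    (mk : ∀ m n, p (τ.tmul m n)) (add : ∀ x y, p x → p y → p (x + y)) : p z := by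
  obtain ⟨z, rfl⟩ := τ.toEquiv.surjective z
  induction z using Bal.induction_on with
  | zero => exact (map_zero τ.toEquiv).symm ▸ zero
  | tmul m n => exact mk m n
  | add x y hx hy => exact (map_add τ.toEquiv x y).symm ▸ add _ _ hx hy

variable {V : Type*} [AddCommGroup V] [Module F V]

/-- The map out of `T` induced by a balanced bilinear map. -/
def lift (f : M.carrier →ₗ[F] N.carrier →ₗ[F] V)
    (h : ∀ b m n, f (M.smulR b m) n = f m (N.smulL b n)) : T.carrier →ₗ[F] V :=
  Bal.lift M.smulR N.smulL f h ∘ₗ τ.toEquiv.symm.toLinearMap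

theorem lift_tmul (f : M.carrier →ₗ[F] N.carrier →ₗ[F] V)
    (h : ∀ b m n, f (M.smulR b m) n = f m (N.smulL b n)) (m : M.carrier) (n : N.carrier) :
    τ.lift f h (τ.tmul m n) = f m n :=
  (congrArg (Bal.lift M.smulR N.smulL f h) (τ.toEquiv.symm_apply_apply _)).trans
    (Bal.lift_tmul M.smulR N.smulL f h m n)

end

section Assoc

variable {M : PreprincipalBimodule.{u} X Y} {N : PreprincipalBimodule.{u} Y Z}
  {P : PreprincipalBimodule.{u} Z W} {T : PreprincipalBimodule.{u} X Z}
  {V : PreprincipalBimodule.{u} Y W} {E : PreprincipalBimodule.{u} X W}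
  {E' : PreprincipalBimodule.{u} X W}
  (τ : TensorIso M N T) (σ : TensorIso N P V) (τ' : TensorIso T P E) (σ' : TensorIso M V E')

/-- The map `m ⊗ n ↦ (p ↦ m ⊗ (n ⊗ p))`. -/
def assocHomInner : T.carrier →ₗ[F] P.carrier →ₗ[F] E'.carrier :=
  τ.lift (LinearMap.mk₂ F (fun m n => σ'.tmul m ∘ₗ σ.tmul n)
      (fun m m' n => by rw [map_add, LinearMap.add_comp])
      (fun k m n => by rw [map_smul, LinearMap.smul_comp])
      (fun m n n' => by rw [map_add, LinearMap.comp_add])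
      (fun k m n => by rw [map_smul, LinearMap.comp_smul]))
    (fun b m n => LinearMap.ext fun p => by
      simp only [LinearMap.mk₂_apply, LinearMap.comp_apply, σ'.tmul_bal, σ.smulL_tmul])

theorem assocHomInner_tmul (m : M.carrier) (n : N.carrier) (p : P.carrier) :
    assocHomInner τ σ σ' (τ.tmul m n) p = σ'.tmul m (σ.tmul n p) :=
  LinearMap.congr_fun (τ.lift_tmul _ _ m n) p

/-- The map `(m ⊗ n) ⊗ p ↦ m ⊗ (n ⊗ p)`. -/
def assocHom : E.carrier →ₗ[F] E'.carrier :=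
  τ'.lift (assocHomInner τ σ σ') (fun c z p => by
    -- Arbitrary models of the four tensor products are allowed, so balancing is checked on their
    -- generators instead of on quotients.
    refine τ.induction (p := fun z => assocHomInner τ σ σ' (T.smulR c z) p =
      assocHomInner τ σ σ' z (P.smulL c p)) z ?_ ?_ ?_
    · simp only [map_zero, LinearMap.zero_apply]
    · intro m n
      rw [τ.smulR_tmul, assocHomInner_tmul, assocHomInner_tmul, σ.tmul_bal]
    · intro x y hx hy
      simp only [map_add, LinearMap.add_apply, hx, hy])

theorem assocHom_tmul (m : M.carrier) (n : N.carrier) (p : P.carrier) :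
    assocHom τ σ τ' σ' (τ'.tmul (τ.tmul m n) p) = σ'.tmul m (σ.tmul n p) :=
  (τ'.lift_tmul _ _ _ p).trans (assocHomInner_tmul τ σ σ' m n p)

/-- The map `n ⊗ p ↦ (m ↦ (m ⊗ n) ⊗ p)`. -/
def assocInvInner : V.carrier →ₗ[F] M.carrier →ₗ[F] E.carrier :=
  σ.lift (LinearMap.mk₂ F (fun n p => τ'.tmul.flip p ∘ₗ τ.tmul.flip n)
      (fun m m' n => by rw [map_add, LinearMap.comp_add])
      (fun k m n => by rw [map_smul, LinearMap.comp_smul])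
      (fun m n n' => by rw [map_add, LinearMap.add_comp])
      (fun k m n => by rw [map_smul, LinearMap.smul_comp]))
    (fun c n p => LinearMap.ext fun m => by
      simp only [LinearMap.mk₂_apply, LinearMap.comp_apply, LinearMap.flip_apply, ← τ'.tmul_bal,
        τ.smulR_tmul])

theorem assocInvInner_tmul (m : M.carrier) (n : N.carrier) (p : P.carrier) :
    assocInvInner τ σ τ' (σ.tmul n p) m = τ'.tmul (τ.tmul m n) p :=
  LinearMap.congr_fun (σ.lift_tmul _ _ n p) m

/-- The map `m ⊗ (n ⊗ p) ↦ (m ⊗ n) ⊗ p`. -/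
def assocInv : E'.carrier →ₗ[F] E.carrier :=
  σ'.lift (assocInvInner τ σ τ').flip (fun b m z => by
    simp only [LinearMap.flip_apply]
    refine σ.induction (p := fun z => assocInvInner τ σ τ' z (M.smulR b m) =
      assocInvInner τ σ τ' (V.smulL b z) m) z ?_ ?_ ?_
    · simp only [map_zero, LinearMap.zero_apply]
    · intro n p
      rw [σ.smulL_tmul, assocInvInner_tmul, assocInvInner_tmul, τ.tmul_bal]
    · intro x y hx hy
      simp only [map_add, LinearMap.add_apply, hx, hy])

theorem assocInv_tmul (m : M.carrier) (n : N.carrier) (p : P.carrier) :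
    assocInv τ σ τ' σ' (σ'.tmul m (σ.tmul n p)) = τ'.tmul (τ.tmul m n) p :=
  (σ'.lift_tmul _ _ m _).trans (assocInvInner_tmul τ σ τ' m n p)

theorem span_tmul₃ : Submodule.span F {z | ∃ m n p, z = τ'.tmul (τ.tmul m n) p} = ⊤ := by
  refine eq_top_iff.2 fun z _ => ?_
  refine τ'.induction (p := fun z => z ∈ Submodule.span F _) z (zero_mem _) (fun w p => ?_)
    fun x y hx hy => add_mem hx hy
  refine τ.induction (p := fun w => τ'.tmul w p ∈ Submodule.span F _) w ?_ (fun m n => ?_) ?_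
  · rw [map_zero, LinearMap.zero_apply]
    exact zero_mem _
  · exact Submodule.subset_span ⟨m, n, p, rfl⟩
  · intro x y hx hy
    rw [map_add, LinearMap.add_apply]
    exact add_mem hx hy

theorem span_tmul₃' : Submodule.span F {z | ∃ m n p, z = σ'.tmul m (σ.tmul n p)} = ⊤ := by
  refine eq_top_iff.2 fun z _ => ?_
  refine σ'.induction (p := fun z => z ∈ Submodule.span F _) z (zero_mem _) (fun m w => ?_)
    fun x y hx hy => add_mem hx hy
  refine σ.induction (p := fun w => σ'.tmul m w ∈ Submodule.span F _) w ?_ (fun n p => ?_) ?_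
  · rw [map_zero]
    exact zero_mem _
  · exact Submodule.subset_span ⟨m, n, p, rfl⟩
  · intro x y hx hy
    rw [map_add]
    exact add_mem hx hy

/-- The equivalence `(M ⊗ N) ⊗ P ≃ M ⊗ (N ⊗ P)`. -/
def assocEquiv : E.carrier ≃ₗ[F] E'.carrier :=
  LinearEquiv.ofLinearMap (assocHom τ σ τ' σ') (assocInv τ σ τ' σ')
    (ext_of_span (span_tmul₃' σ σ') (by
      rintro _ ⟨m, n, p, rfl⟩
      rw [LinearMap.comp_apply, assocInv_tmul, assocHom_tmul, LinearMap.id_apply]))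
    (ext_of_span (span_tmul₃ τ τ') (by
      rintro _ ⟨m, n, p, rfl⟩
      rw [LinearMap.comp_apply, assocHom_tmul, assocInv_tmul, LinearMap.id_apply]))

theorem map_assocHom_map₂ (t : M.carrier ⊗[F] M.carrier) (u : N.carrier ⊗[F] N.carrier)
    (v : P.carrier ⊗[F] P.carrier) :
    TensorProduct.map (assocHom τ σ τ' σ') (assocHom τ σ τ' σ')
      (TensorProduct.map₂ τ'.tmul τ'.tmul (TensorProduct.map₂ τ.tmul τ.tmul t u) v) =
      TensorProduct.map₂ σ'.tmul σ'.tmul t (TensorProduct.map₂ σ.tmul σ.tmul u v) := by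
  induction t with
  | zero => simp only [map_zero, LinearMap.zero_apply]
  | add x y hx hy => simp only [map_add, LinearMap.add_apply, hx, hy]
  | tmul m m' =>
    induction u with
    | zero => simp only [map_zero, LinearMap.zero_apply]
    | add x y hx hy => simp only [map_add, LinearMap.add_apply, hx, hy]
    | tmul n n' =>
      induction v with
      | zero => simp only [map_zero]
      | add x y hx hy => simp only [map_add, hx, hy]
      | tmul p p' => simp only [TensorProduct.map₂_apply_tmul, TensorProduct.map_tmul, assocHom_tmul]

/-- The tensor product of bimodules is associative. -/
def assoc : Iso E E' :=
  Iso.ofSpan (assocEquiv τ σ τ' σ') (span_tmul₃ τ τ')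
    (by
      rintro _ ⟨m, n, p, rfl⟩ a
      change assocHom τ σ τ' σ' _ = E'.smulL a (assocHom τ σ τ' σ' _)
      rw [τ'.smulL_tmul, τ.smulL_tmul, assocHom_tmul, assocHom_tmul, σ'.smulL_tmul])
    (by
      rintro _ ⟨m, n, p, rfl⟩ c
      change assocHom τ σ τ' σ' _ = E'.smulR c (assocHom τ σ τ' σ' _)
      rw [τ'.smulR_tmul, assocHom_tmul, assocHom_tmul, σ'.smulR_tmul, σ.smulR_tmul])
    (by
      rintro _ ⟨m, n, p, rfl⟩
      change E'.coalg.counit (assocHom τ σ τ' σ' _) = _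
      rw [assocHom_tmul, σ'.counit_tmul, σ.counit_tmul, τ'.counit_tmul, τ.smulR_tmul, τ.counit_tmul])
    (by
      rintro _ ⟨m, n, p, rfl⟩
      refine ⟨_, τ'.isRep_tmul (τ.isRep_tmul (M.coalg.isRep_rep m) (N.coalg.isRep_rep n))
        (P.coalg.isRep_rep p), ?_⟩
      have h := σ'.isRep_tmul (M.coalg.isRep_rep m)
        (σ.isRep_tmul (N.coalg.isRep_rep n) (P.coalg.isRep_rep p))
      rw [← map_assocHom_map₂ τ σ τ' σ', ← assocHom_tmul τ σ τ' σ'] at h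
      exact h)

end Assoc

end TensorIso

/-- The map `a ⊗ m ↦ am` from `A ⊗_A M` to `M`. -/
def leftUnitHom {A : Type u} [NonUnitalRing A] [Module F A] [IsScalarTower F A A]
    [SMulCommClass F A A] {X : Bialgebroid F R A} (M : PreprincipalBimodule.{u} X Y) :
    Bal X.toBimodule.smulR M.smulL →ₗ[F] M.carrier :=
  Bal.lift X.toBimodule.smulR M.smulL (M.smulL : A →ₗ[F] Module.End F M.carrier)
    (fun b a m => M.smulL_mul a b m)

theorem leftUnitHom_bijective {A : Type u} [NonUnitalRing A] [Module F A] [IsScalarTower F A A]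
    [SMulCommClass F A A] {X : Bialgebroid F R A} (M : PreprincipalBimodule.{u} X Y) :
    Function.Bijective (leftUnitHom M) := by
  have h0 : ∀ (a : A) (m : M.carrier), leftUnitHom M (Bal.tmul X.toBimodule.smulR M.smulL a m) =
    M.smulL a m := fun a m => Bal.lift_tmul X.toBimodule.smulR M.smulL _ _ a m
  constructor
  · refine Bal.lift_action_injective (M.smulL : A →ₗ[F] Module.End F M.carrier) _ fun s => ?_
    obtain ⟨e, he⟩ := X.localIdentities s
    exact ⟨X.ι e, fun a ha => (he a ha).1⟩
  · intro m
    obtain ⟨r, hr⟩ := M.coalg.unitary {m}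
    exact ⟨_, (h0 (X.ι r) m).trans (hr m (by simp))⟩

/-- The isomorphism `A ⊗_A M ≃ M`. -/
noncomputable def leftUnit {A : Type u} [NonUnitalRing A] [Module F A] [IsScalarTower F A A]
    [SMulCommClass F A A] {X : Bialgebroid F R A} (M : PreprincipalBimodule.{u} X Y) :
    TensorIso X.toBimodule M M :=
  have h0 : ∀ (a : A) (m : M.carrier), leftUnitHom M (Bal.tmul X.toBimodule.smulR M.smulL a m) =
    M.smulL a m := fun a m => Bal.lift_tmul X.toBimodule.smulR M.smulL _ _ a m
  { toEquiv := LinearEquiv.ofBijective _ (leftUnitHom_bijective M)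
    map_smulL := fun a (a' : A) m => by
      refine (congrArg (M.smulL a) (h0 a' m)).trans (Eq.trans ?_ (h0 (a * a') m).symm)
      exact (M.smulL_mul a a' m).symm
    map_smulR := fun b a m =>
      (congrArg (M.smulR b) (h0 a m)).trans ((M.smul_comm a b m).symm.trans (h0 a _).symm)
    map_counit := fun a m => (congrArg M.coalg.counit (h0 a m)).trans (M.counit_smulL a m)
    map_comul := fun a m t u ht hu => by
      have h := M.comul_smulL a m t u ht hu
      have h1 : (Bal.tmul X.toBimodule.smulR M.smulL).compr₂ (leftUnitHom M) =
        (M.smulL : A →ₗ[F] Module.End F M.carrier) := LinearMap.ext fun a => LinearMap.ext (h0 a)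
      rw [← h1] at h
      exact (congrArg (fun c => M.coalg.IsRep c _) (h0 a m)).mpr h }

/-- The map `m ⊗ b ↦ mb` from `M ⊗_B B` to `M`. -/
def rightUnitHom {B : Type u} [NonUnitalRing B] [Module F B] [IsScalarTower F B B]
    [SMulCommClass F B B] {Y : Bialgebroid F R' B} (M : PreprincipalBimodule.{u} X Y) :
    Bal M.smulR Y.toBimodule.smulL →ₗ[F] M.carrier :=
  Bal.lift M.smulR Y.toBimodule.smulL M.smulR.flip (fun b m b' => (M.smulR_mul b b' m).symm)

theorem rightUnitHom_bijective {B : Type u} [NonUnitalRing B] [Module F B] [IsScalarTower F B B]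
    [SMulCommClass F B B] {Y : Bialgebroid F R' B} (M : PreprincipalBimodule.{u} X Y) :
    Function.Bijective (rightUnitHom M) := by
  have h0 : ∀ (m : M.carrier) (b : B), rightUnitHom M (Bal.tmul M.smulR Y.toBimodule.smulL m b) =
    M.smulR b m := fun m b => Bal.lift_tmul M.smulR Y.toBimodule.smulL _ _ m b
  constructor
  · refine Bal.lift_action_flip_injective M.smulR _ fun s => ?_
    obtain ⟨e, he⟩ := Y.localIdentities s
    exact ⟨Y.ι e, fun a ha => (he a ha).2⟩
  · intro m
    obtain ⟨r, hr⟩ := M.unitaryR {m}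
    exact ⟨_, (h0 m (Y.ι r)).trans (hr m (by simp))⟩

/-- The isomorphism `M ⊗_B B ≃ M`. -/
noncomputable def rightUnit {B : Type u} [NonUnitalRing B] [Module F B] [IsScalarTower F B B]
    [SMulCommClass F B B] {Y : Bialgebroid F R' B} (M : PreprincipalBimodule.{u} X Y) :
    TensorIso M Y.toBimodule M :=
  have h0 : ∀ (m : M.carrier) (b : B), rightUnitHom M (Bal.tmul M.smulR Y.toBimodule.smulL m b) =
    M.smulR b m := fun m b => Bal.lift_tmul M.smulR Y.toBimodule.smulL _ _ m b
  { toEquiv := LinearEquiv.ofBijective _ (rightUnitHom_bijective M)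
    map_smulL := fun a m b =>
      (congrArg (M.smulL a) (h0 m b)).trans ((M.smul_comm a b m).trans (h0 _ b).symm)
    map_smulR := fun b' m (b : B) =>
      (congrArg (M.smulR b') (h0 m b)).trans
        ((M.smulR_mul b b' m).symm.trans (h0 m (b * b')).symm)
    map_counit := fun m b => (congrArg M.coalg.counit (h0 m b)).trans (M.counit_smulR b m)
    map_comul := fun m b t u ht hu => by
      have h := M.comul_smulR b m u t hu ht
      have h1 : (Bal.tmul M.smulR Y.toBimodule.smulL).compr₂ (rightUnitHom M) =
        M.smulR.flip := LinearMap.ext fun a => LinearMap.ext (h0 a)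
      have h2 : TensorProduct.map₂ M.smulR M.smulR u t =
          TensorProduct.map₂ M.smulR.flip M.smulR.flip t u := map₂_flip_apply _ _ u t
      rw [h2, ← h1] at h
      exact (congrArg (fun c => M.coalg.IsRep c _) (h0 m b)).mpr h }

end PreprincipalBimodule

end Bimodule
end Algd

/-! ### Composition of isomorphism classes -/

namespace Algd

namespace PrHoALGD

variable {F : Type} [RCLike F]

/-- `Quot` identifies along the generated equivalence relation, and being isomorphic is already an
equivalence relation. -/
theorem Hom.mk_eq_mk {X Y : PrHoALGD.{u, v} F} {M N : PrincipalBimodule X Y} :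
    Hom.mk M = Hom.mk N ↔ Nonempty (M.bimod.Iso N.bimod) := by
  refine ⟨fun h => ?_, fun h => Quot.sound h⟩
  have e : Equivalence fun M N : PrincipalBimodule X Y => Nonempty (M.bimod.Iso N.bimod) :=
    PreprincipalBimodule.iso_equivalence.comap PrincipalBimodule.bimod
  exact e.eqvGen_iff.1 (Quot.eqvGen_exact h)

/-- The tensor product of principal bimodules. -/
noncomputable def PrincipalBimodule.tensor {X Y Z : PrHoALGD.{u, v} F} (M : PrincipalBimodule X Y)
    (N : PrincipalBimodule Y Z) : PrincipalBimodule X Z :=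
  ⟨PreprincipalBimodule.tensor M.bimod N.bimod,
    PreprincipalBimodule.tensor_isPrincipal M.bimod N.bimod M.isPrincipal N.isPrincipal
      Y.isPrincipal⟩

/-- The composition of the Morita category. -/
noncomputable def comp (X Y Z : PrHoALGD.{u, v} F) : Hom X Y → Hom Y Z → Hom X Z :=
  Quot.map₂ PrincipalBimodule.tensor
    (fun M _ _ ⟨j⟩ => ⟨PreprincipalBimodule.tensorCongr (.refl M.bimod) j⟩)
    (fun _ _ N ⟨i⟩ => ⟨PreprincipalBimodule.tensorCongr i (.refl N.bimod)⟩)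

theorem comp_eq_of_tensorIso {X Y Z : PrHoALGD.{u, v} F} {M : PrincipalBimodule X Y}
    {N : PrincipalBimodule Y Z} {P : PrincipalBimodule X Z}
    (i : PreprincipalBimodule.TensorIso M.bimod N.bimod P.bimod) :
    comp X Y Z (Hom.mk M) (Hom.mk N) = Hom.mk P :=
  Hom.mk_eq_mk.2 ⟨i.iso⟩

/-- Every model of a tensor product is isomorphic to the standard one, so `IsComposite` is the graph
of `comp`. The units come from A ⊗_A M ≅ M ≅ M ⊗_B B, which make M itself a model of both products.
-/
theorem isMoritaComposition_comp : IsMoritaComposition comp.{u, v} (F := F) where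
  comp_eq_iff {X Y Z} f g h := by
    constructor
    · rintro rfl
      obtain ⟨M, rfl⟩ := Quot.exists_rep f
      obtain ⟨N, rfl⟩ := Quot.exists_rep g
      exact ⟨M, N, M.tensor N, rfl, rfl, rfl, ⟨PreprincipalBimodule.tensorIso M.bimod N.bimod⟩⟩
    · rintro ⟨M, N, P, rfl, rfl, rfl, ⟨i⟩⟩
      exact comp_eq_of_tensorIso i
  id_comp {X Y} f := by
    obtain ⟨M, rfl⟩ := Quot.exists_rep f
    exact comp_eq_of_tensorIso (PreprincipalBimodule.leftUnit M.bimod)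
  comp_id {X Y} f := by
    obtain ⟨M, rfl⟩ := Quot.exists_rep f
    exact comp_eq_of_tensorIso (PreprincipalBimodule.rightUnit M.bimod)
  assoc {W X Y Z} f g h := by
    obtain ⟨M, rfl⟩ := Quot.exists_rep f
    obtain ⟨N, rfl⟩ := Quot.exists_rep g
    obtain ⟨P, rfl⟩ := Quot.exists_rep h
    exact Hom.mk_eq_mk.2 ⟨PreprincipalBimodule.TensorIso.assoc
      (PreprincipalBimodule.tensorIso M.bimod N.bimod)
      (PreprincipalBimodule.tensorIso N.bimod P.bimod)
      (PreprincipalBimodule.tensorIso (M.tensor N).bimod P.bimod)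
      (PreprincipalBimodule.tensorIso M.bimod (N.tensor P).bimod)⟩

end PrHoALGD

end Algd

/-! ### Germs, ideals and characters of algebras of smooth functions -/

namespace Algd

section Functions

variable {F : Type} [RCLike F] {d : ℕ} {M : Type*} [TopologicalSpace M]
  [ChartedSpace (EuclideanSpace ℝ (Fin d)) M]

/-- The value of a germ. -/
def Stalk.eval (x : M) : Stalk F d x →+* F :=
  Filter.Germ.valueRingHom.comp (Stalk F d x).subtype

theorem Stalk.eval_germ (x : M) (f : Cc F d M) : Stalk.eval x (germ x f) = (f : M → F) x := rfl

instance (x : M) : Nontrivial (Stalk F d x) :=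
  (Stalk.eval x).domain_nontrivial

/-- By continuity a representative has no zero near x, and its pointwise inverse is smooth there. -/
theorem Stalk.isUnit_of_eval_ne_zero {x : M} {s : Stalk F d x} (hs : Stalk.eval x s ≠ 0) :
    IsUnit s := by
  obtain ⟨_, f, hf, rfl⟩ := s
  have h0 : f x ≠ 0 := hs
  have h1 : ∀ᶠ y in nhds x, f y ≠ 0 := by
    have hc : ContinuousAt f x := hf.self_of_nhds.continuousAt
    exact hc.eventually_ne h0
  have h2 : ∀ᶠ y in nhds x, ContMDiffAt (𝓡 d) 𝓘(ℝ, F) ∞ (fun y => (f y)⁻¹) y := by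
    filter_upwards [hf, h1] with y hy hy'
    exact (contDiffAt_inv ℝ hy').contMDiffAt.comp y hy
  refine IsUnit.of_mul_eq_one ⟨_, (fun y => (f y)⁻¹), h2, rfl⟩ (Subtype.ext ?_)
  refine Filter.Germ.coe_eq.2 ?_
  filter_upwards [h1] with y hy
  exact mul_inv_cancel₀ hy

/-- One of s and 1 - s is a unit, according to the value of s at x, while s(1 - s) = 0. -/
theorem Stalk.eq_zero_or_eq_one_of_mul_self {x : M} {s : Stalk F d x} (hs : s * s = s) :
    s = 0 ∨ s = 1 := by
  by_cases h : Stalk.eval x s = 0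
  · have h1 : IsUnit (1 - s) := Stalk.isUnit_of_eval_ne_zero (by
      rw [map_sub, h, map_one, sub_zero]
      exact one_ne_zero)
    exact Or.inl (h1.mul_left_eq_zero.1 (by rw [mul_sub, mul_one, hs, sub_self]))
  · refine Or.inr ((Stalk.isUnit_of_eval_ne_zero h).mul_left_cancel ?_)
    rw [hs, mul_one]

/-- By compactness finitely many pᵢ in I have no common zero on the support of r. Then g = Σ
conj(pᵢ)pᵢ = Σ |pᵢ|² lies in I and is positive there, so r = (r/g)g with r/g smooth of compact
support. -/
theorem mem_of_forall_exists_ne_zero {I : AddSubgroup (Cc F d M)} (hI : ∀ f, ∀ g ∈ I, f * g ∈ I)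
    (r : Cc F d M) (h : ∀ x ∈ tsupport (r : M → F), ∃ f ∈ I, (f : M → F) x ≠ 0) : r ∈ I := by
  classical
  have hstar : ∀ f : Cc F d M, (fun x => (starRingEnd F) ((f : M → F) x)) ∈ Cc F d M := fun f =>
    ⟨(RCLike.conjCLE (K := F)).contDiff.contMDiff.comp f.2.1, f.2.2.comp_left (map_zero _)⟩
  choose! p hp hpx using h
  obtain ⟨s, hsr, hs⟩ := r.2.2.isCompact.elim_nhds_subcover
    (fun x => {y | (p x : M → F) y ≠ 0})
    (fun x hx => ((p x).2.1.continuous.continuousAt).eventually_ne (hpx x hx))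
  let g : Cc F d M := ∑ i ∈ s, (⟨_, hstar (p i)⟩ : Cc F d M) * p i
  have hgI : g ∈ I := sum_mem fun i hi => hI _ _ (hp i (hsr i hi))
  have hg : ∀ y, (g : M → F) y = ((∑ i ∈ s, ‖(p i : M → F) y‖ ^ 2 : ℝ) : F) := by
    intro y
    have h1 : (g : M → F) = ∑ i ∈ s, (fun z => (starRingEnd F) ((p i : M → F) z)) *
        (p i : M → F) := by
      rw [AddSubmonoidClass.coe_finsetSum]
      rfl
    rw [h1, Finset.sum_apply, RCLike.ofReal_sum]
    refine Finset.sum_congr rfl fun i _ => ?_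
    rw [Pi.mul_apply, RCLike.conj_mul, RCLike.ofReal_pow]
  have hg0 : ∀ y ∈ tsupport (r : M → F), (g : M → F) y ≠ 0 := by
    intro y hy h0
    rw [hg, RCLike.ofReal_eq_zero, Finset.sum_eq_zero_iff_of_nonneg fun i _ => sq_nonneg _] at h0
    obtain ⟨i, hi, hiy⟩ := Set.mem_iUnion₂.1 (hs hy)
    exact hiy (norm_eq_zero.1 (pow_eq_zero_iff two_ne_zero |>.1 (h0 i hi)))
  let q : Cc F d M := ⟨fun y => (r : M → F) y * ((g : M → F) y)⁻¹, by
    refine ⟨contMDiff_of_tsupport fun y hy => ?_, r.2.2.mul_right⟩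
    have hy' : y ∈ tsupport (r : M → F) :=
      closure_mono (fun z (hz : _ * _ ≠ (0 : F)) => left_ne_zero_of_mul hz) hy
    exact contMDiffAt_mul (r.2.1 y)
      ((contDiffAt_inv ℝ (hg0 y hy')).contMDiffAt.comp y (g.2.1 y))⟩
  have hq : r = q * g := Subtype.ext (funext fun y => by
    by_cases hy : (r : M → F) y = 0
    · exact hy.trans (by change (0 : F) = ((r : M → F) y * ((g : M → F) y)⁻¹) * (g : M → F) y; simp [hy])
    · exact (inv_mul_cancel_right₀ (hg0 y (subset_tsupport _ hy)) _).symm)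
  rw [hq]
  exact hI q g hgI

variable [T2Space M] [IsManifold (𝓡 d) ∞ M]

theorem exists_eval_eq_one (x : M) : ∃ f : Cc F d M, (f : M → F) x = 1 := by
  obtain ⟨f, hf⟩ := germ_surjective (F := F) (d := d) x 1
  exact ⟨f, by rw [← Stalk.eval_germ, hf, map_one]⟩

/-- If the kernel of χ had no common zero, it would be everything by `mem_of_forall_exists_ne_zero`.
So it vanishes at some x, and evaluation at x is a multiple of χ; multiplicativity forces the factor
1. -/
theorem exists_eq_eval (χ : Cc F d M →ₙₐ[F] F) (hχ : χ ≠ 0) :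
    ∃ x, ∀ f : Cc F d M, χ f = (f : M → F) x := by
  obtain ⟨h, hh⟩ : ∃ h, χ h = 1 := by
    by_contra! hne
    refine hχ (NonUnitalAlgHom.ext fun f => ?_)
    by_contra h0
    exact hne ((χ f)⁻¹ • f) (by rw [map_smul, smul_eq_mul, inv_mul_cancel₀ h0])
  obtain ⟨x, hx⟩ : ∃ x, ∀ f : Cc F d M, χ f = 0 → (f : M → F) x = 0 := by
    by_contra! hne
    have h0 : h ∈ (χ : Cc F d M →ₗ[F] F).toAddMonoidHom.ker := by
      refine mem_of_forall_exists_ne_zero (fun f g hg => ?_) h fun x _ => ?_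
      · exact (map_mul χ f g).trans (by rw [show χ g = 0 from hg, mul_zero])
      · obtain ⟨f, hf, hfx⟩ := hne x
        exact ⟨f, hf, hfx⟩
    exact one_ne_zero (hh.symm.trans h0)
  have h1 : ∀ f : Cc F d M, (f : M → F) x = χ f * (h : M → F) x := fun f => by
    have h2 := hx (f - χ f • h) (by rw [map_sub, map_smul, hh, smul_eq_mul, mul_one, sub_self])
    exact sub_eq_zero.1 h2
  obtain ⟨e, he⟩ := exists_eval_eq_one (F := F) (d := d) x
  have h3 : (h : M → F) x ≠ 0 := fun h0 => one_ne_zero (he.symm.trans (by rw [h1, h0, mul_zero]))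
  -- The factor is h(x); comparing both functionals on h² gives h(x)² = h(x).
  have h4 : (h : M → F) x = 1 := by
    have h5 := h1 (h * h)
    rw [map_mul, hh, one_mul, one_mul] at h5
    exact mul_left_cancel₀ h3 (h5.trans (mul_one _).symm)
  exact ⟨x, fun f => by rw [h1, h4, mul_one]⟩

/-- The functions f with fc ∈ Q form an ideal. Near each x it contains a function equal to 1 there,
namely one that annihilates the difference between c and an element of Q with the same class at x.
So the ideal has no common zero and contains a local unit of c. -/
theorem LeftCoalgebra.eq_top_of_forall_local {C : Type*} [AddCommGroup C] [Module F C]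
    {act : Cc F d M →ₙₐ[F] Module.End F C} (K : LeftCoalgebra act) (Q : Submodule F C)
    (hQ : ∀ f, ∀ q ∈ Q, act f q ∈ Q)
    (h : ∀ x c, ∃ q ∈ Q, LocalMod.mk act x c = LocalMod.mk act x q) : Q = ⊤ := by
  refine eq_top_iff.2 fun c _ => ?_
  obtain ⟨r, hr⟩ := K.unitary {c}
  rw [← hr c (Finset.mem_singleton_self c)]
  let I : AddSubgroup (Cc F d M) :=
    (Q.toAddSubgroup).comap ((act : Cc F d M →ₗ[F] Module.End F C).flip c).toAddMonoidHom
  refine show r ∈ I from mem_of_forall_exists_ne_zero (fun f g hg => ?_) r fun x _ => ?_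
  · have h1 : act (f * g) c = act f (act g c) := by rw [map_mul, Module.End.mul_apply]
    exact (congrArg (· ∈ Q) h1).mpr (hQ f _ hg)
  · obtain ⟨q, hq, hcq⟩ := h x c
    obtain ⟨f, hf, hfc⟩ := (LocalMod.mk_eq_zero_iff act x (c - q)).1 (by rw [map_sub, hcq, sub_self])
    refine ⟨f, ?_, ?_⟩
    · rw [map_sub, sub_eq_zero] at hfc
      exact (congrArg (· ∈ Q) hfc).mpr (hQ f q hq)
    · rw [← Stalk.eval_germ, hf, map_one]
      exact one_ne_zero

end Functions

end Algd

/-! ### Bases of grouplike elements and localization -/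

namespace Algd

section FreeGen

variable {S : Type*} [CommRing S] {E : Type*} [AddCommGroup E] [Module S E]

/-- The basis given by a set of free generators. -/
noncomputable def FreelyGenerates.basis {G : Set E} (h : FreelyGenerates S G) :
    Module.Basis G S E :=
  Module.Basis.mk h.1 (by rw [Subtype.range_coe]; exact h.2.ge)

theorem FreelyGenerates.basis_apply {G : Set E} (h : FreelyGenerates S G) (g : G) :
    h.basis g = g :=
  Module.Basis.mk_apply _ _ _

/-- If a module with a comultiplication and a counit has a basis of grouplike elements, then every
grouplike element belongs to the basis. -/
theorem mem_range_of_grouplike (hS : ∀ s : S, s * s = s → s = 0 ∨ s = 1) [Nontrivial S]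
    {ι : Type*} (b : Module.Basis ι S E) (Δ : E →ₗ[S] E ⊗[S] E) (ε : E →ₗ[S] S)
    (hΔ : ∀ i, Δ (b i) = b i ⊗ₜ b i) {z : E} (hz : Δ z = z ⊗ₜ z)
    (hz' : ε z = 1) : ∃ i, b i = z := by
  classical
  -- Δ is diagonal on the basis, so applying the i-th and j-th coordinates to the two legs of Δ(z)
  -- gives δᵢⱼzᵢ; for Δ(z) = z ⊗ z they give zᵢzⱼ.
  have h1 : ∀ i j, b.repr z i * b.repr z j = if i = j then b.repr z i else 0 := by
    intro i j
    have h2 : (LinearMap.mul' S S ∘ₗ TensorProduct.map (b.coord i) (b.coord j)) ∘ₗ Δ =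
        if i = j then b.coord i else 0 := by
      refine b.ext fun k => ?_
      rw [LinearMap.comp_apply, hΔ, LinearMap.comp_apply, TensorProduct.map_tmul,
        LinearMap.mul'_apply, b.coord_apply, b.coord_apply, b.repr_self]
      split_ifs with hij
      · subst hij
        rw [b.coord_apply, b.repr_self, Finsupp.single_apply]
        split_ifs <;> simp
      · rw [LinearMap.zero_apply, Finsupp.single_apply, Finsupp.single_apply]
        split_ifs with h1 h2
        · exact (hij (h1.symm.trans h2)).elim
        all_goals simp
    have h3 := LinearMap.congr_fun h2 z
    rw [LinearMap.comp_apply, hz, LinearMap.comp_apply, TensorProduct.map_tmul,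
      LinearMap.mul'_apply, b.coord_apply, b.coord_apply] at h3
    rw [h3]
    split_ifs <;> rfl
  obtain ⟨i, hi⟩ : ∃ i, b.repr z i ≠ 0 := by
    by_contra! h0
    have hz0 : z = 0 := b.ext_elem fun i => by rw [h0, map_zero, Finsupp.zero_apply]
    rw [hz0, map_zero] at hz'
    exact zero_ne_one hz'
  -- A nonzero idempotent coordinate is 1, and orthogonality then kills all the others.
  have hi1 : b.repr z i = 1 := (hS _ ((h1 i i).trans (if_pos rfl))).resolve_left hi
  refine ⟨i, b.ext_elem fun j => ?_⟩
  rw [b.repr_self, Finsupp.single_apply]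
  split_ifs with hij
  · rw [← hij, hi1]
  · have := h1 i j
    rw [hi1, one_mul, if_neg hij] at this
    exact this.symm

end FreeGen

section Local

variable {F : Type} [RCLike F] {d : ℕ} {M : Type*} [TopologicalSpace M]
  [ChartedSpace (EuclideanSpace ℝ (Fin d)) M] [T2Space M] [IsManifold (𝓡 d) ∞ M]
  {C : Type*} [AddCommGroup C] [Module F C] {C' : Type*} [AddCommGroup C'] [Module F C']
  {act : Cc F d M →ₙₐ[F] Module.End F C} {act' : Cc F d M →ₙₐ[F] Module.End F C'}

namespace LocalMod

/-- The map out of `C_x` induced by a map that is compatible with the action of functions. -/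
def lift {S : Type*} [CommRing S] {V : Type*} [AddCommGroup V] [Module S V] {x : M}
    (σ : Stalk F d x →+* S) (φ : C →+ V) (h : ∀ f c, φ (act f c) = σ (germ x f) • φ c) :
    LocalMod act x →ₛₗ[σ] V where
  toFun := QuotientAddGroup.lift (nullSub act x).toAddSubgroup φ (by
    rintro c ⟨f, hf, hfc⟩
    have h1 := h f c
    rw [hfc, hf, map_one, one_smul, map_zero] at h1
    exact h1.symm)
  map_add' := map_add _
  map_smul' s z := by
    obtain ⟨f, rfl⟩ := germ_surjective x s
    obtain ⟨c, rfl⟩ := mk_surjective act x z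
    rw [germ_smul_mk]
    exact h f c

theorem semilinear_ext {S : Type*} [CommRing S] {V : Type*} [AddCommGroup V] [Module S V] {x : M}
    {σ : Stalk F d x →+* S} {f g : LocalMod act x →ₛₗ[σ] V}
    (h : ∀ c, f (mk act x c) = g (mk act x c)) : f = g := by
  ext z
  obtain ⟨c, rfl⟩ := mk_surjective act x z
  exact h c

/-- The map `C_x → C'_x` induced by a linear map that is compatible with the action of functions. -/
noncomputable def map (x : M) (φ : C →ₗ[F] C') (h : ∀ f c, φ (act f c) = act' f (φ c)) :
    LocalMod act x →ₗ[Stalk F d x] LocalMod act' x :=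
  lift (S := Stalk F d x) (act := act) (RingHom.id _) ((mk act' x).toAddMonoidHom.comp φ.toAddMonoidHom) (fun f c => by
    change mk act' x (φ (act f c)) = germ x f • mk act' x (φ c)
    rw [h, germ_smul_mk])

theorem map_mk (x : M) (φ : C →ₗ[F] C') (h : ∀ f c, φ (act f c) = act' f (φ c)) (c : C) :
    map x φ h (mk act x c) = mk act' x (φ c) :=
  rfl

theorem map_id (x : M) (h : ∀ f c, (LinearMap.id : C →ₗ[F] C) (act f c) = act f (LinearMap.id c)) :
    map (act' := act) x LinearMap.id h = LinearMap.id :=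
  semilinear_ext fun _ => rfl

theorem projTensor_map (x : M) (φ ψ : C →ₗ[F] C') (h : ∀ f c, φ (act f c) = act' f (φ c))
    (h' : ∀ f c, ψ (act f c) = act' f (ψ c)) (z : Bal act act) :
    projTensor act' x (Bal.map (ρ' := act') (l' := act') φ ψ h h' z) =
      TensorProduct.map (map x φ h) (map x ψ h') (projTensor act x z) := by
  induction z using Bal.induction_on with
  | zero => simp only [map_zero]
  | add x y hx hy => simp only [map_add, hx, hy]
  | tmul c c' =>
    rw [Bal.map_tmul, projTensor_tmul, projTensor_tmul, TensorProduct.map_tmul, map_mk, map_mk]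

/-- A map out of `C ⊗_{C_c(M)} C` that is compatible with the action of functions factors through
`C_x ⊗ C_x`. -/
theorem congr_of_projTensor_eq {S : Type*} [CommRing S] {V : Type*} [AddCommGroup V] [Module S V]
    {x : M} (σ : Stalk F d x →+* S) (Ψ : Bal act act →+ V)
    (hΨ : ∀ f z, Ψ (balAct act f z) = σ (germ x f) • Ψ z) {z z' : Bal act act}
    (h : projTensor act x z = projTensor act x z') : Ψ z = Ψ z' := by
  -- Restriction of scalars along σ reduces the claim to linear maps over the germs at x. A σ other
  -- than the identity is needed when the target lives over another point.
  let _ : Module (Stalk F d x) V := Module.compHom V σ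
  have hs : ∀ (s : Stalk F d x) (v : V), s • v = σ s • v := fun _ _ => rfl
  let φ₁ : C → LocalMod act x →ₗ[Stalk F d x] V := fun c =>
    lift (S := Stalk F d x) (act := act) (RingHom.id _) (Ψ.comp (Bal.tmul act act c).toAddMonoidHom) (fun f c' => by
      change Ψ (Bal.tmul act act c (act f c')) = σ (germ x f) • Ψ (Bal.tmul act act c c')
      rw [← hΨ, balAct_tmul, Bal.tmul_bal])
  have h1 : ∀ c c', φ₁ c (mk act x c') = Ψ (Bal.tmul act act c c') := fun c c' => rfl
  let φ₂ : C →+ LocalMod act x →ₗ[Stalk F d x] V :=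
    { toFun := φ₁
      map_zero' := semilinear_ext fun c' => by
        rw [h1, map_zero, LinearMap.zero_apply, map_zero, LinearMap.zero_apply]
      map_add' := fun a b => semilinear_ext fun c' => by
        rw [h1, map_add, LinearMap.add_apply, map_add, LinearMap.add_apply, h1, h1] }
  let Φ : LocalMod act x →ₗ[Stalk F d x] LocalMod act x →ₗ[Stalk F d x] V :=
    lift (S := Stalk F d x) (act := act) (RingHom.id _) φ₂ (fun f c => semilinear_ext fun c' => by
      change Ψ (Bal.tmul act act (act f c) c') = σ (germ x f) • Ψ (Bal.tmul act act c c')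
      rw [← hΨ, balAct_tmul])
  have h2 : ∀ z, TensorProduct.lift Φ (projTensor act x z) = Ψ z := by
    intro z
    induction z using Bal.induction_on with
    | zero => simp only [map_zero]
    | add x y hx hy => simp only [map_add, hx, hy]
    | tmul c c' =>
      rw [projTensor_tmul, TensorProduct.lift.tmul]
      rfl
  rw [← h2, ← h2, h]

end LocalMod

namespace LeftCoalgebra

variable (K : LeftCoalgebra act)

/-- The comultiplication of `C_x`, as a linear map. -/
noncomputable def localComulₗ (x : M) :
    LocalMod act x →ₗ[Stalk F d x] LocalMod act x ⊗[Stalk F d x] LocalMod act x :=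
  LocalMod.lift (S := Stalk F d x) (act := act) (RingHom.id _)
    ((LocalMod.projTensor act x).toAddMonoidHom.comp K.comul.toAddMonoidHom) (fun f c => by
      change LocalMod.projTensor act x (K.comul (act f c)) =
        germ x f • LocalMod.projTensor act x (K.comul c)
      rw [K.comul_act, LocalMod.projTensor_balAct])

theorem localComulₗ_apply (x : M) (z : LocalMod act x) : K.localComulₗ x z = K.localComul x z := by
  obtain ⟨c, rfl⟩ := LocalMod.mk_surjective act x z
  rfl

/-- The counit of `C_x`, as a linear map. -/
noncomputable def localCounitₗ (x : M) : LocalMod act x →ₗ[Stalk F d x] Stalk F d x :=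
  LocalMod.lift (S := Stalk F d x) (act := act) (RingHom.id _)
    ⟨⟨fun c => germ x (K.counit c), by rw [map_zero, germ_zero]⟩, fun c c' => by
      change germ x (K.counit (c + c')) = _
      rw [map_add, germ_add]⟩ (fun f c => by
      change germ x (K.counit (act f c)) = germ x f * germ x (K.counit c)
      rw [K.counit_act, germ_mul])

theorem localCounitₗ_apply (x : M) (z : LocalMod act x) :
    K.localCounitₗ x z = K.localCounit x z := by
  obtain ⟨c, rfl⟩ := LocalMod.mk_surjective act x z
  rfl

theorem mem_grouplike_iff {x : M} {z : LocalMod act x} :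
    z ∈ K.grouplike x ↔ K.localComulₗ x z = z ⊗ₜ z ∧ K.localCounitₗ x z = 1 := by
  rw [localComulₗ_apply, localCounitₗ_apply]
  rfl

/-- A basis of `C_x` that consists of grouplike elements is the set of all grouplike elements. -/
theorem grouplike_eq_range {x : M} {ι : Type*} (b : Module.Basis ι (Stalk F d x) (LocalMod act x))
    (hb : ∀ i, b i ∈ K.grouplike x) : K.grouplike x = Set.range b := by
  ext z
  refine ⟨fun hz => ?_, ?_⟩
  · rw [mem_grouplike_iff] at hz
    have hS : ∀ s : Stalk F d x, s * s = s → s = 0 ∨ s = 1 := fun _ h =>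
      Stalk.eq_zero_or_eq_one_of_mul_self h
    exact mem_range_of_grouplike (S := Stalk F d x) hS b (K.localComulₗ x)
      (K.localCounitₗ x) (fun i => ((K.mem_grouplike_iff).1 (hb i)).1)
      hz.1 hz.2
  · rintro ⟨i, rfl⟩
    exact hb i

theorem freelyGenerates_grouplike {x : M} {ι : Type*}
    (b : Module.Basis ι (Stalk F d x) (LocalMod act x))
    (hb : ∀ i, b i ∈ K.grouplike x) : FreelyGenerates (Stalk F d x) (K.grouplike x) := by
  rw [K.grouplike_eq_range b hb]
  exact ⟨b.linearIndependent.linearIndepOn_id, b.span_eq⟩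

/-- Free generation of `C_x` by grouplike elements is invariant under isomorphisms. -/
theorem FreelyGenerates.of_equiv {K : LeftCoalgebra act} {K' : LeftCoalgebra act'} {x : M}
    (h : FreelyGenerates (Stalk F d x) (K.grouplike x)) (φ : C ≃ₗ[F] C')
    (hφ : ∀ f c, φ (act f c) = act' f (φ c)) (hε : ∀ c, K'.counit (φ c) = K.counit c)
    (hΔ : ∀ c, K'.comul (φ c) = Bal.map (ρ' := act') (l' := act') φ.toLinearMap φ.toLinearMap hφ hφ
      (K.comul c)) : FreelyGenerates (Stalk F d x) (K'.grouplike x) := by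
  have hφ' : ∀ f c, φ.symm (act' f c) = act f (φ.symm c) := fun f c => by
    rw [LinearEquiv.symm_apply_eq, hφ, LinearEquiv.apply_symm_apply]
  let e : LocalMod act x ≃ₗ[Stalk F d x] LocalMod act' x :=
    LinearEquiv.ofLinearMap (LocalMod.map x φ.toLinearMap hφ)
      (LocalMod.map x φ.symm.toLinearMap hφ')
      (LocalMod.semilinear_ext fun c => by
        rw [LinearMap.comp_apply, LocalMod.map_mk, LocalMod.map_mk]
        exact congrArg (LocalMod.mk act' x) (φ.apply_symm_apply c))
      (LocalMod.semilinear_ext fun c => by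
        rw [LinearMap.comp_apply, LocalMod.map_mk, LocalMod.map_mk]
        exact congrArg (LocalMod.mk act x) (φ.symm_apply_apply c))
  -- It suffices to transport one grouplike basis, since such a basis is the full set of grouplike
  -- elements.
  refine K'.freelyGenerates_grouplike (h.basis.map e) fun g => ?_
  rw [Module.Basis.map_apply, h.basis_apply]
  obtain ⟨g, hg, hg'⟩ := g
  obtain ⟨c, rfl⟩ := LocalMod.mk_surjective act x g
  refine ⟨?_, ?_⟩
  · change LocalMod.projTensor act' x (K'.comul (φ c)) = _
    rw [hΔ, LocalMod.projTensor_map]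
    exact (congrArg (TensorProduct.map (LocalMod.map x φ.toLinearMap hφ)
      (LocalMod.map x φ.toLinearMap hφ)) hg)
  · change germ x (K'.counit (φ c)) = 1
    rw [hε]
    exact hg'

end LeftCoalgebra

end Local

end Algd

/-! ### Locally grouplike Hopf algebroids are principal -/

namespace Algd

section Hopf

variable {F : Type*} [Field F] {R : Type*} [NonUnitalCommRing R] [Module F R]

variable {A : Type u} [NonUnitalRing A] [Module F A] [IsScalarTower F A A] [SMulCommClass F A A]

theorem Bialgebroid.isRep_mul_ι (X : Bialgebroid F R A) {a : A} {t : A ⊗[F] A}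
    (h : X.coalg.IsRep a t) (r : R) :
    X.coalg.IsRep (a * X.ι r) (TensorProduct.map (LinearMap.mulRight F (X.ι r)) LinearMap.id t) :=
  X.toBimodule.isRep_smulR_ι (m := a) h r

theorem Bialgebroid.comul_mul_ι (X : Bialgebroid F R A) (a : A) (r : R) :
    X.coalg.comul (a * X.ι r) = endMap X.act LinearMap.id (LinearMap.mulRight F (X.ι r))
        (fun _ _ => rfl) (fun s a => by simp [mul_assoc]) (X.coalg.comul a) := by
  rw [← X.comul_right, ← X.coalg.mk_rep a, endMap_mk]
  exact (X.isRep_mul_ι (X.coalg.isRep_rep a) r).eq.symm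

namespace HopfAlgebroid

variable (H : HopfAlgebroid F R A)

theorem antipode_mul_of_isRep {a b c : A} (h : H.coalg.IsRep a (b ⊗ₜ c)) :
    H.antipode b * c = H.ι (H.coalg.counit (H.antipode a)) := by
  have h1 := H.mul_antipode_comul a
  rw [← h.eq] at h1
  exact h1

/-- The map `u ⊗ v ↦ (b ↦ S(u) ⊗ vb)`. -/
def twist : Bal H.act H.act →ₗ[F] A →ₗ[F] H.TensorRL :=
  Bal.lift H.act H.act
    (LinearMap.mk₂ F (fun u v => Bal.tmul (fun r => LinearMap.mulRight F (H.ι r)) H.act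
        (H.antipode u) ∘ₗ LinearMap.mulLeft F v)
      (fun m m' n => by rw [map_add, map_add, LinearMap.add_comp])
      (fun k m n => by rw [map_smul, map_smul, LinearMap.smul_comp])
      (fun m n n' => by
        rw [← LinearMap.comp_add]
        congr 1
        exact LinearMap.ext fun x => add_mul n n' x)
      (fun k m n => by
        rw [← LinearMap.comp_smul]
        congr 1
        exact LinearMap.ext fun x => smul_mul_assoc k n x))
    (fun r u v => LinearMap.ext fun b => by
      simp only [LinearMap.mk₂_apply, LinearMap.comp_apply, LinearMap.mulLeft_apply]
      have h1 : H.antipode (H.act r u) = LinearMap.mulRight F (H.ι r) (H.antipode u) :=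
        (H.antipode_mul (H.ι r) u).trans (congrArg (H.antipode u * ·) (H.antipode_ι r))
      have h2 : H.act r v * b = H.act r (v * b) := mul_assoc (H.ι r) v b
      rw [h1, h2]
      exact Bal.tmul_bal (fun r => LinearMap.mulRight F (H.ι r)) H.act r (H.antipode u) (v * b))

theorem twist_tmul (u v b : A) : H.twist (Bal.tmul H.act H.act u v) b =
    Bal.tmul (fun r => LinearMap.mulRight F (H.ι r)) H.act (H.antipode u) (v * b) :=
  LinearMap.congr_fun (Bal.lift_tmul H.act H.act _ _ u v) b

/-- Since Δ(ar) = Δ(a)(1 ⊗ r), the factor r passes to b; this makes `canInv` balanced. -/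
theorem twist_comul_mul_ι (a b : A) (r : R) :
    H.twist (H.coalg.comul (a * H.ι r)) b = H.twist (H.coalg.comul a) (H.ι r * b) := by
  rw [H.comul_mul_ι]
  generalize H.coalg.comul a = z
  induction z using Bal.induction_on with
  | zero => simp only [map_zero, LinearMap.zero_apply]
  | add x y hx hy => simp only [map_add, LinearMap.add_apply, hx, hy]
  | tmul u v =>
    have h : endMap H.act LinearMap.id (LinearMap.mulRight F (H.ι r)) (fun _ _ => rfl)
        (fun s a => by simp [mul_assoc]) (Bal.tmul H.act H.act u v) =
        Bal.tmul H.act H.act u (v * H.ι r) := endMap_tmul _ _ _ _ _ _ _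
    rw [h, twist_tmul, twist_tmul, mul_assoc]

/-- The map `x ⊗ b ↦ ∑ S(u) ⊗ vb` for `Δ(S(x)) = ∑ u ⊗ v`. -/
def canInv : Bal H.act H.act →ₗ[F] H.TensorRL :=
  Bal.lift H.act H.act (H.twist ∘ₗ H.coalg.comul ∘ₗ H.antipode) (fun r x b => by
    have h1 : H.antipode (H.act r x) = H.antipode x * H.ι r :=
      (H.antipode_mul (H.ι r) x).trans (congrArg (H.antipode x * ·) (H.antipode_ι r))
    simp only [LinearMap.comp_apply]
    rw [h1]
    exact H.twist_comul_mul_ι _ b r)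

theorem canInv_tmul (x b : A) :
    H.canInv (Bal.tmul H.act H.act x b) = H.twist (H.coalg.comul (H.antipode x)) b :=
  Bal.lift_tmul H.act H.act _ _ x b

section WeaklyGrouplike

variable {H} {a a' : A} (ha : H.coalg.IsRep a (a ⊗ₜ a'))
  (hS : H.coalg.IsRep (H.antipode a) (H.antipode a' ⊗ₜ H.antipode a)) {h : R}
  (hh : h * H.coalg.counit a = h)

-- Counitality of Δ(a) = a ⊗ a' reads ε(a)a' = a, and h absorbs ε(a).
include ha hh in
theorem ι_mul_eq_of_weaklyGrouplike : H.ι h * a = H.ι h * a' := by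
  have h1 : H.ι (H.coalg.counit a) * a' = a := ha.counit_fst
  rw [← h1, ← mul_assoc, ← map_mul, hh]

-- Counitality of Δ(S(a)) = S(a') ⊗ S(a) in the second leg reads ε(S(a))S(a') = S(a); apply S.
include hS in
theorem mul_ι_eq_of_weaklyGrouplike : a' * H.ι (H.coalg.counit (H.antipode a)) = a := by
  have h1 : H.ι (H.coalg.counit (H.antipode a)) * H.antipode a' = H.antipode a := hS.counit_snd
  have h2 := congrArg H.antipode h1
  rw [H.antipode_mul, H.antipode_antipode, H.antipode_antipode, H.antipode_ι] at h2
  exact h2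

-- S(ha) = S(a)h has comultiplication S(a')h ⊗ S(a), and S(S(a')h) = ha' = ha.
include ha hS hh in
theorem canInv_tmul_of_weaklyGrouplike (b : A) :
    H.canInv (Bal.tmul H.act H.act (H.ι h * a) b) =
      Bal.tmul (fun r => LinearMap.mulRight F (H.ι r)) H.act (H.ι h * a) (H.antipode a * b) := by
  have h1 : H.antipode (H.ι h * a) = H.antipode a * H.ι h := by
    rw [H.antipode_mul, H.antipode_ι]
  rw [canInv_tmul, h1, ← (H.isRep_mul_ι hS h).eq,
    TensorProduct.map_tmul, Bal.mk_tmul, twist_tmul, LinearMap.mulRight_apply, H.antipode_mul,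
    H.antipode_antipode, H.antipode_ι, ι_mul_eq_of_weaklyGrouplike ha hh, LinearMap.id_apply]

include ha in
theorem canRL_tmul_of_weaklyGrouplike (b : A) :
    H.canRL (Bal.tmul (fun r => LinearMap.mulRight F (H.ι r)) H.act (H.ι h * a) b) =
      Bal.tmul H.act H.act (H.ι h * a) (a' * b) := by
  have h1 : H.coalg.IsRep (H.ι h * a) ((H.ι h * a) ⊗ₜ a') :=
    H.toBimodule.isRep_act (m := a) ha h
  exact (H.toBimodule.can_tmul (m := H.ι h * a) h1 b).trans (Bal.mk_tmul _ _ _ _)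

-- The composite is ha ⊗ S(a)a'b with S(a)a' = ε(S(a)). This function passes to the right of ha =
-- ha', where a'ε(S(a)) = a.
include ha hS hh in
theorem canInv_canRL_of_weaklyGrouplike (b : A) :
    H.canInv (H.canRL (Bal.tmul (fun r => LinearMap.mulRight F (H.ι r)) H.act (H.ι h * a) b)) =
      Bal.tmul (fun r => LinearMap.mulRight F (H.ι r)) H.act (H.ι h * a) b := by
  rw [canRL_tmul_of_weaklyGrouplike ha, canInv_tmul_of_weaklyGrouplike ha hS hh, ← mul_assoc,
    H.antipode_mul_of_isRep ha]
  refine (Bal.tmul_bal (fun r => LinearMap.mulRight F (H.ι r)) H.act _ _ b).symm.trans ?_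
  rw [LinearMap.mulRight_apply, ι_mul_eq_of_weaklyGrouplike ha hh, mul_assoc,
    mul_ι_eq_of_weaklyGrouplike hS, ι_mul_eq_of_weaklyGrouplike ha hh]

-- The composite is ha ⊗ a'S(a)b. The antipode axiom for S(a) gives a'S(a) = ε(a), and ε(a)ha = ha.
include ha hS hh in
theorem canRL_canInv_of_weaklyGrouplike (b : A) :
    H.canRL (H.canInv (Bal.tmul H.act H.act (H.ι h * a) b)) =
      Bal.tmul H.act H.act (H.ι h * a) b := by
  have h1 := H.antipode_mul_of_isRep hS
  rw [H.antipode_antipode, H.antipode_antipode] at h1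
  rw [canInv_tmul_of_weaklyGrouplike ha hS hh, canRL_tmul_of_weaklyGrouplike ha, ← mul_assoc, h1]
  refine (Bal.tmul_bal H.act H.act _ _ b).symm.trans ?_
  have h2 : H.act (H.coalg.counit a) (H.ι h * a) = H.ι h * a := by
    change H.ι (H.coalg.counit a) * (H.ι h * a) = _
    rw [← mul_assoc, ← map_mul, mul_comm, hh]
  rw [h2]

end WeaklyGrouplike

/-- A Hopf algebroid that is spanned by localized invariant weakly grouplike elements is
principal. -/
theorem isPrincipal_of_span
    (hspan : Submodule.span F {x | ∃ a a' h, H.coalg.IsRep a (a ⊗ₜ a') ∧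
      H.coalg.IsRep (H.antipode a) (H.antipode a' ⊗ₜ H.antipode a) ∧ h * H.coalg.counit a = h ∧
      x = H.ι h * a} = ⊤) : H.toBialgebroid.IsPrincipal := by
  rw [H.toBialgebroid.isPrincipal_iff]
  have h1 : ∀ z, H.canInv (H.canRL z) = z := by
    have h2 : ((Bal.tmul (fun r => LinearMap.mulRight F (H.ι r)) H.act).compr₂
        (H.canInv ∘ₗ H.canRL)) = Bal.tmul (fun r => LinearMap.mulRight F (H.ι r)) H.act := by
      refine LinearMap.ext_on hspan ?_
      rintro _ ⟨a, a', h, ha, hS, hh, rfl⟩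
      exact LinearMap.ext fun b => canInv_canRL_of_weaklyGrouplike ha hS hh b
    exact LinearMap.congr_fun (f := H.canInv ∘ₗ H.canRL) (g := LinearMap.id)
      (Bal.hom_ext fun m n => LinearMap.congr_fun₂ h2 m n)
  have h2 : ∀ z, H.canRL (H.canInv z) = z := by
    have h2 : ((Bal.tmul H.act H.act).compr₂ (H.canRL ∘ₗ H.canInv)) = Bal.tmul H.act H.act := by
      refine LinearMap.ext_on hspan ?_
      rintro _ ⟨a, a', h, ha, hS, hh, rfl⟩
      exact LinearMap.ext fun b => canRL_canInv_of_weaklyGrouplike ha hS hh b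
    exact LinearMap.congr_fun (f := H.canRL ∘ₗ H.canInv) (g := LinearMap.id)
      (Bal.hom_ext fun m n => LinearMap.congr_fun₂ h2 m n)
  exact ⟨Function.LeftInverse.injective h1, Function.RightInverse.surjective h2⟩

end HopfAlgebroid

end Hopf

namespace SmoothHopfAlgebroid

variable {F : Type} [RCLike F] (X : SmoothHopfAlgebroid.{u, v} F)

/-- The span of the localized invariant weakly grouplike elements. -/
def wglSpan : Submodule F X.carrier :=
  Submodule.span F {x | ∃ a a' h, X.bialg.coalg.IsRep a (a ⊗ₜ a') ∧
      X.bialg.coalg.IsRep (X.hopf.antipode a) (X.hopf.antipode a' ⊗ₜ X.hopf.antipode a) ∧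
      h * X.bialg.coalg.counit a = h ∧ x = X.bialg.ι h * a}

theorem act_mem_wglSpan (f : Cc F X.dim X.base) {q : X.carrier} (hq : q ∈ X.wglSpan) :
    X.bialg.act f q ∈ X.wglSpan := by
  induction hq using Submodule.span_induction with
  | zero => rw [map_zero]; exact zero_mem _
  | add x y _ _ hx hy => rw [map_add]; exact add_mem hx hy
  | smul k x _ hx => rw [map_smul]; exact Submodule.smul_mem _ k hx
  | mem x hx =>
    obtain ⟨a, a', h, ha, hS, hh, rfl⟩ := hx
    refine Submodule.subset_span ⟨a, a', f * h, ha, hS, by rw [mul_assoc, hh], ?_⟩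
    rw [map_mul X.bialg.ι f h]
    exact (mul_assoc (X.bialg.ι f) (X.bialg.ι h) a).symm

variable {X}

/-- At y every class is a combination of arrows. An arrow a_y is also the class of ha, where h is 1
near y and so small that hε(a) = h. Then `LeftCoalgebra.eq_top_of_forall_local` applies. -/
theorem IsLocallyGrouplike.wglSpan_eq_top (hX : X.IsLocallyGrouplike) : X.wglSpan = ⊤ := by
  refine X.bialg.coalg.eq_top_of_forall_local X.wglSpan (fun f q hq => X.act_mem_wglSpan f hq)
    fun y c => ?_
  have h1 : LocalMod.mk X.bialg.act y c ∈ Submodule.span (Stalk F X.dim y) (X.arrows y) := by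
    rw [(hX y).2]
    trivial
  have h2 : ∃ q ∈ X.wglSpan, LocalMod.mk X.bialg.act y q = LocalMod.mk X.bialg.act y c := by
    generalize LocalMod.mk X.bialg.act y c = z at h1
    induction h1 using Submodule.span_induction with
    | zero => exact ⟨0, zero_mem _, map_zero _⟩
    | add z w _ _ hz hw =>
      obtain ⟨q, hq, rfl⟩ := hz
      obtain ⟨q', hq', rfl⟩ := hw
      exact ⟨q + q', add_mem hq hq', map_add _ _ _⟩
    | smul s z _ hz =>
      obtain ⟨q, hq, rfl⟩ := hz
      obtain ⟨f, rfl⟩ := germ_surjective y s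
      exact ⟨_, X.act_mem_wglSpan f hq, (LocalMod.germ_smul_mk _ _ _ _).symm⟩
    | mem z hz =>
      obtain ⟨a, ⟨a', ha, hS⟩, hε, rfl⟩ := hz
      obtain ⟨h, h1, h2⟩ := exists_mul_left_eq y _ hε
      refine ⟨X.bialg.ι h * a, Submodule.subset_span ⟨a, a', h, ha, hS, h2, rfl⟩, ?_⟩
      refine (LocalMod.germ_smul_mk X.bialg.act y h a).symm.trans ?_
      rw [h1, one_smul]
  obtain ⟨q, hq, h⟩ := h2
  exact ⟨q, hq, h.symm⟩

/-- A locally grouplike Hopf algebroid is principal. -/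
theorem IsLocallyGrouplike.isPrincipal (hX : X.IsLocallyGrouplike) :
    X.hopf.toBialgebroid.IsPrincipal :=
  X.hopf.isPrincipal_of_span hX.wglSpan_eq_top

-- From ε(a)a' = a the elements a and a' have the same class at y, so Δ(a) = a ⊗ a' becomes ζ ⊗ ζ
-- there.
variable (X) in
theorem arrows_subset_grouplike (y : X.base) : X.arrows y ⊆ X.bialg.coalg.grouplike y := by
  rintro _ ⟨a, ⟨a', ha, -⟩, hε, rfl⟩
  have h1 : X.bialg.act (X.bialg.coalg.counit a) a' = a := ha.counit_fst
  have h2 : LocalMod.mk X.bialg.act y a' = LocalMod.mk X.bialg.act y a := by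
    rw [← h1, ← LocalMod.germ_smul_mk, hε, one_smul]
  refine ⟨?_, hε⟩
  rw [LeftCoalgebra.localComul_mk, ← ha.eq, Bal.mk_tmul, LocalMod.projTensor_tmul, h2]

/-- The bimodule `A` over a locally grouplike Hopf algebroid `A` is locally grouplike. -/
theorem IsLocallyGrouplike.freelyGenerates (hX : X.IsLocallyGrouplike) (y : X.base) :
    FreelyGenerates (Stalk F X.dim y) (X.bialg.coalg.grouplike y) :=
  X.bialg.coalg.freelyGenerates_grouplike (hX y).basis fun g => by
    rw [(hX y).basis_apply]
    exact X.arrows_subset_grouplike y g.2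

end SmoothHopfAlgebroid

end Algd

/-! ### The source of a grouplike element and transitivity of the action on its fibre -/

namespace Algd

/-- A homomorphism of non-unital algebras extends along a localization `π`. -/
theorem exists_algHom_comp_eq {F R S S' : Type*} [Field F] [NonUnitalCommRing R] [Module F R]
    [CommRing S] [Algebra F S] [CommRing S'] [Algebra F S'] (π : R →ₙₐ[F] S')
    (hπ : Function.Surjective π)
    (hπ' : ∀ g g', π g = π g' → ∃ e, π e = 1 ∧ e * g = e * g') (Θ : R →ₙₐ[F] S)
    (hΘ : ∀ e, π e = 1 → IsUnit (Θ e)) : ∃ θ : S' →ₐ[F] S, ∀ g, θ (π g) = Θ g := by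
  have hcongr : ∀ g g', π g = π g' → Θ g = Θ g' := fun g g' h => by
    obtain ⟨e, he, heg⟩ := hπ' g g' h
    refine (hΘ e he).mul_left_cancel ?_
    rw [← map_mul, ← map_mul, heg]
  let θ₁ : S' → S := fun s => Θ (Function.surjInv hπ s)
  have hθ₁ : ∀ g, θ₁ (π g) = Θ g := fun g => hcongr _ _ (Function.surjInv_eq _ _)
  have hone : θ₁ 1 = 1 := by
    obtain ⟨e, he⟩ := hπ 1
    rw [← he, hθ₁]
    refine (hΘ e he).mul_left_cancel ?_
    rw [← map_mul, mul_one]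
    exact hcongr _ _ (by rw [map_mul, he, one_mul])
  refine ⟨AlgHom.ofLinearMap
    { toFun := θ₁
      map_add' := fun s t => by
        obtain ⟨g, rfl⟩ := hπ s
        obtain ⟨g', rfl⟩ := hπ t
        rw [← map_add, hθ₁, hθ₁, hθ₁, map_add]
      map_smul' := fun k s => by
        obtain ⟨g, rfl⟩ := hπ s
        rw [← map_smul, hθ₁, hθ₁, map_smul, RingHom.id_apply] }
    hone (fun s t => by
        obtain ⟨g, rfl⟩ := hπ s
        obtain ⟨g', rfl⟩ := hπ t
        change θ₁ _ = θ₁ _ * θ₁ _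
        rw [← map_mul, hθ₁, hθ₁, hθ₁, map_mul]), hθ₁⟩

section Linear

variable {S V : Type*} [CommRing S] [AddCommGroup V] [Module S V]

/-- Contract the first leg of both sides with ε. -/
theorem apply_eq_smul_of_tmul_eq {ζ : V} (ε : V →ₗ[S] S) (hε : ε ζ = 1) (ρ : V →ₗ[S] V)
    (h : ρ ζ ⊗ₜ[S] ζ = ζ ⊗ₜ[S] ρ ζ) : ρ ζ = ε (ρ ζ) • ζ := by
  have h2 := congrArg (TensorProduct.lift (LinearMap.lsmul S V ∘ₗ ε)) h
  simp only [TensorProduct.lift.tmul, LinearMap.comp_apply, LinearMap.lsmul_apply, hε,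
    one_smul] at h2
  exact h2.symm

variable {ι : Type*} (β : Module.Basis ι S V) (i : ι) (ρ : V →ₗ[S] V)

theorem coord_apply_of_diagonal {c : S} (hi : ρ (β i) = c • β i)
    (hρ : ∀ k, ∃ s : S, ρ (β k) = s • β k) (z : V) : β.coord i (ρ z) = c * β.coord i z := by
  classical
  refine LinearMap.congr_fun (f := β.coord i ∘ₗ ρ) (g := c • β.coord i) (β.ext fun k => ?_) z
  rw [LinearMap.comp_apply]
  by_cases hk : k = i
  · subst hk
    rw [hi, map_smul, LinearMap.smul_apply]
  · have h1 : β.coord i (β k) = 0 := by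
      rw [β.coord_apply, β.repr_self, Finsupp.single_eq_of_ne' hk]
    obtain ⟨s, hs⟩ := hρ k
    rw [hs, LinearMap.smul_apply, map_smul, h1, smul_zero, smul_zero]

/-- Δ is diagonal in the basis, so contracting the first leg with the i-th coordinate leaves only
the i-th term. -/
theorem lift_coord_map_of_grouplike (Δ : V →ₗ[S] V ⊗[S] V) (hΔ : ∀ k, Δ (β k) = β k ⊗ₜ β k) (z : V) :
    TensorProduct.lift (LinearMap.lsmul S V ∘ₗ β.coord i) (TensorProduct.map LinearMap.id ρ (Δ z)) =
      β.coord i z • ρ (β i) := by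
  classical
  refine LinearMap.congr_fun (f := TensorProduct.lift (LinearMap.lsmul S V ∘ₗ β.coord i) ∘ₗ
      TensorProduct.map LinearMap.id ρ ∘ₗ Δ)
    (g := (β.coord i).smulRight (ρ (β i))) (β.ext fun k => ?_) z
  rw [LinearMap.comp_apply, LinearMap.comp_apply, hΔ, TensorProduct.map_tmul,
    TensorProduct.lift.tmul, LinearMap.comp_apply, LinearMap.lsmul_apply, LinearMap.id_apply,
    LinearMap.smulRight_apply]
  by_cases hk : k = i
  · rw [hk]
  · have h2 : β.coord i (β k) = 0 := by
      rw [β.coord_apply, β.repr_self, Finsupp.single_eq_of_ne' hk]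
    rw [h2, zero_smul, zero_smul]

end Linear

section Functions

variable {F : Type} [RCLike F] {d : ℕ} {E : Type*} [TopologicalSpace E]
  [ChartedSpace (EuclideanSpace ℝ (Fin d)) E]

/-- The germs of constant functions. -/
def Stalk.const (x : E) : F →+* Stalk F d x where
  toFun k := ⟨((fun _ => k : E → F) : Filter.Germ (nhds x) F), fun _ => k,
    Filter.Eventually.of_forall fun _ => contMDiffAt_const, rfl⟩
  map_one' := rfl
  map_mul' _ _ := rfl
  map_zero' := rfl
  map_add' _ _ := rfl

noncomputable instance (x : E) : Algebra F (Stalk F d x) := (Stalk.const x).toAlgebra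

theorem germ_smul (x : E) (k : F) (f : Cc F d E) : germ x (k • f) = k • germ x f := rfl

/-- Every nonzero homomorphism to an algebra of germs is induced by a homomorphism of algebras of
germs. -/
theorem exists_map_germ_eq {d' : ℕ} {E' : Type*} [TopologicalSpace E']
    [ChartedSpace (EuclideanSpace ℝ (Fin d')) E'] [T2Space E'] [IsManifold (𝓡 d') ∞ E'] {x : E}
    (Θ : Cc F d' E' →ₙₐ[F] Stalk F d x) (hΘ : ∃ r, Θ r = 1) :
    ∃ (y : E') (θ : Stalk F d' y →ₐ[F] Stalk F d x), ∀ g, θ (germ y g) = Θ g := by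
  obtain ⟨r, hr⟩ := hΘ
  -- The value at x of Θ is a scalar character, hence evaluation at a point y.
  let χ : Cc F d' E' →ₙₐ[F] F :=
    { toFun := fun g => Stalk.eval x (Θ g)
      map_smul' := fun k g => by
        rw [map_smul, Algebra.smul_def, map_mul]
        rfl
      map_zero' := by rw [map_zero, map_zero]
      map_add' := fun g g' => by rw [map_add, map_add]
      map_mul' := fun g g' => by rw [map_mul, map_mul] }
  have hχ : ∀ g, χ g = Stalk.eval x (Θ g) := fun _ => rfl
  obtain ⟨y, hy⟩ := exists_eq_eval χ (fun h => by
    have h1 := hχ r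
    rw [h, hr, map_one] at h1
    exact zero_ne_one h1)
  let π : Cc F d' E' →ₙₐ[F] Stalk F d' y :=
    { toFun := germ y
      map_smul' := germ_smul y
      map_zero' := germ_zero y
      map_add' := germ_add y
      map_mul' := germ_mul y }
  -- A function with germ 1 at y is sent to a germ with value 1 at x, a unit; so Θ factors through
  -- the germs at y.
  obtain ⟨θ, hθ⟩ := exists_algHom_comp_eq π (germ_surjective y) (exists_mul_eq y) Θ fun e he => by
    refine Stalk.isUnit_of_eval_ne_zero ?_
    have he' : germ y e = 1 := he
    rw [← hχ, hy, ← Stalk.eval_germ, he', map_one]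
    exact one_ne_zero
  exact ⟨y, θ, hθ⟩

variable [T2Space E] [IsManifold (𝓡 d) ∞ E]

instance {C : Type*} [AddCommGroup C] [Module F C] (act : Cc F d E →ₙₐ[F] Module.End F C) (x : E) :
    IsScalarTower F (Stalk F d x) (LocalMod act x) where
  smul_assoc k s z := by
    obtain ⟨f, rfl⟩ := germ_surjective x s
    obtain ⟨c, rfl⟩ := LocalMod.mk_surjective act x z
    rw [← germ_smul, LocalMod.germ_smul_mk, LocalMod.germ_smul_mk, map_smul, LinearMap.smul_apply,
      map_smul]

end Functions

section Bimodule

set_option linter.unusedSectionVars false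

variable {F : Type} [RCLike F] {d : ℕ} {E : Type*} [TopologicalSpace E]
  [ChartedSpace (EuclideanSpace ℝ (Fin d)) E] [T2Space E] [IsManifold (𝓡 d) ∞ E]
  {d' : ℕ} {E' : Type*} [TopologicalSpace E']
  [ChartedSpace (EuclideanSpace ℝ (Fin d')) E'] [T2Space E'] [IsManifold (𝓡 d') ∞ E']
  {A : Type*} [NonUnitalRing A] [Module F A] [IsScalarTower F A A] [SMulCommClass F A A]
  {B : Type*} [NonUnitalRing B] [Module F B] [IsScalarTower F B B] [SMulCommClass F B B]

variable {X : Bialgebroid F (Cc F d E) A} {Y : Bialgebroid F (Cc F d' E') B}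

namespace PreprincipalBimodule

variable (M : PreprincipalBimodule.{u} X Y) (x : E)

/-- The right multiplication by `b` on `M_x`. -/
noncomputable def localR (b : B) : LocalMod M.act x →ₗ[Stalk F d x] LocalMod M.act x :=
  LocalMod.map x (M.smulR b) (fun f m => M.smulR_act f b m)

theorem localR_mk (b : B) (m : M.carrier) :
    M.localR x b (LocalMod.mk M.act x m) = LocalMod.mk M.act x (M.smulR b m) := rfl

theorem localR_mul (b b' : B) (z : LocalMod M.act x) :
    M.localR x (b * b') z = M.localR x b' (M.localR x b z) := by
  obtain ⟨m, rfl⟩ := LocalMod.mk_surjective M.act x z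
  rw [localR_mk, localR_mk, localR_mk, M.smulR_mul]

theorem projTensor_endMap_id_smulR (b : B) (z : Bal M.act M.act) :
    LocalMod.projTensor M.act x (endMap M.act LinearMap.id (M.smulR b) (fun _ _ => rfl)
      (fun s c => M.smulR_act s b c) z) =
      TensorProduct.map LinearMap.id (M.localR x b) (LocalMod.projTensor M.act x z) := by
  have h := LocalMod.projTensor_map x LinearMap.id (M.smulR b) (fun _ _ => rfl)
    (fun s c => M.smulR_act s b c) z
  rw [LocalMod.map_id] at h
  exact h

theorem projTensor_endMap_smulR_id (b : B) (z : Bal M.act M.act) :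
    LocalMod.projTensor M.act x (endMap M.act (M.smulR b) LinearMap.id
      (fun s c => M.smulR_act s b c) (fun _ _ => rfl) z) =
      TensorProduct.map (M.localR x b) LinearMap.id (LocalMod.projTensor M.act x z) := by
  have h := LocalMod.projTensor_map x (M.smulR b) LinearMap.id (fun s c => M.smulR_act s b c)
    (fun _ _ => rfl) z
  rw [LocalMod.map_id] at h
  exact h

theorem projTensor_can_tmul (m : M.carrier) (b : B) :
    LocalMod.projTensor M.act x (M.can (Bal.tmul _ _ m b)) =
      TensorProduct.map LinearMap.id (M.localR x b)
        (M.coalg.localComulₗ x (LocalMod.mk M.act x m)) := by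
  rw [M.can_tmul (M.coalg.isRep_rep m)]
  have h := M.projTensor_endMap_id_smulR x b (Bal.mk M.act M.act (M.coalg.rep m))
  rw [endMap_mk, M.coalg.mk_rep] at h
  exact h

theorem map_localR_id_localComul (g : Cc F d' E') (z : LocalMod M.act x) :
    TensorProduct.map (M.localR x (Y.ι g)) LinearMap.id (M.coalg.localComulₗ x z) =
      TensorProduct.map LinearMap.id (M.localR x (Y.ι g)) (M.coalg.localComulₗ x z) := by
  obtain ⟨m, rfl⟩ := LocalMod.mk_surjective M.act x z
  exact (M.projTensor_endMap_smulR_id x (Y.ι g) (M.coalg.comul m)).symm.trans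
    ((congrArg (LocalMod.projTensor M.act x) (M.comul_right g m)).trans
      (M.projTensor_endMap_id_smulR x (Y.ι g) (M.coalg.comul m)))

variable {M x} {ζ : LocalMod M.act x}

/-- The two right actions of g agree on Δ(ζ) = ζ ⊗ ζ, so ζg ⊗ ζ = ζ ⊗ ζg. -/
theorem localR_of_grouplike (hζ : ζ ∈ M.coalg.grouplike x) (g : Cc F d' E') :
    M.localR x (Y.ι g) ζ = M.coalg.localCounitₗ x (M.localR x (Y.ι g) ζ) • ζ := by
  rw [M.coalg.mem_grouplike_iff] at hζ
  have h1 := M.map_localR_id_localComul x g ζ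
  rw [hζ.1] at h1
  exact apply_eq_smul_of_tmul_eq (M.coalg.localCounitₗ x) hζ.2 (M.localR x (Y.ι g)) h1

/-- A grouplike element of `M_x` determines a point `y` of the base of `Y`, its source, and a
homomorphism from the germs at `y` to the germs at `x`. -/
theorem exists_source (hζ : ζ ∈ M.coalg.grouplike x) :
    ∃ (y : E') (θ : Stalk F d' y →ₐ[F] Stalk F d x),
      ∀ g, M.localR x (Y.ι g) ζ = θ (germ y g) • ζ := by
  have hε := (M.coalg.mem_grouplike_iff.1 hζ).2
  let θ₀ : Cc F d' E' → Stalk F d x := fun g => M.coalg.localCounitₗ x (M.localR x (Y.ι g) ζ)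
  have h0 : ∀ g, M.localR x (Y.ι g) ζ = θ₀ g • ζ := localR_of_grouplike hζ
  have hinj : ∀ s t : Stalk F d x, s • ζ = t • ζ → s = t := fun s t hst => by
    have h1 := congrArg (M.coalg.localCounitₗ x) hst
    rwa [map_smul, map_smul, hε, smul_eq_mul, smul_eq_mul, mul_one, mul_one] at h1
  -- Multiplicativity is read off from the action on ζ, which is faithful because ε(ζ) = 1;
  -- linearity from the formula with a representative m₀.
  have hmul : ∀ g g', θ₀ (g * g') = θ₀ g * θ₀ g' := fun g g' => hinj _ _ (by
    rw [← h0, map_mul, localR_mul, h0, map_smul, h0, smul_smul])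
  obtain ⟨m₀, hm₀⟩ := LocalMod.mk_surjective M.act x ζ
  have hθ : ∀ g, θ₀ g = germ x (M.coalg.counit (M.smulR (Y.ι g) m₀)) := fun g => by
    change M.coalg.localCounitₗ x (M.localR x (Y.ι g) ζ) = _
    rw [← hm₀]
    rfl
  let L : Cc F d' E' →ₗ[F] Cc F d E :=
    { toFun := fun g => M.coalg.counit (M.smulR (Y.ι g) m₀)
      map_add' := fun g g' => by simp only [map_add, LinearMap.add_apply]
      map_smul' := fun k g => by simp only [map_smul, LinearMap.smul_apply, RingHom.id_apply] }
  have hadd : ∀ g g', θ₀ (g + g') = θ₀ g + θ₀ g' := fun g g' => by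
    rw [hθ, hθ, hθ]
    exact congrArg (germ x) (L.map_add g g')
  have hsmul : ∀ (k : F) g, θ₀ (k • g) = k • θ₀ g := fun k g => by
    rw [hθ, hθ]
    exact congrArg (germ x) (L.map_smul k g)
  obtain ⟨r, hr⟩ := M.unitaryR {m₀}
  have hr1 : θ₀ r = 1 := by
    rw [hθ, hr m₀ (Finset.mem_singleton_self _), ← hε, ← hm₀]
    rfl
  let Θ : Cc F d' E' →ₙₐ[F] Stalk F d x :=
    { toFun := θ₀
      map_smul' := hsmul
      map_zero' := by rw [hθ]; exact congrArg (germ x) L.map_zero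
      map_add' := hadd
      map_mul' := hmul }
  obtain ⟨y, θ, hΘ⟩ := exists_map_germ_eq Θ ⟨r, hr1⟩
  exact ⟨y, θ, fun g => (h0 g).trans (congrArg (· • ζ) (hΘ g).symm)⟩

theorem map_germ_eq_one {y : E'} {θ : Stalk F d' y →ₐ[F] Stalk F d x}
    (hζ : ζ ∈ M.coalg.grouplike x) (hθ : ∀ g, M.localR x (Y.ι g) ζ = θ (germ y g) • ζ)
    {g : Cc F d' E'} (hg : M.localR x (Y.ι g) ζ = ζ) : θ (germ y g) = 1 := by
  have h := congrArg (M.coalg.localCounitₗ x) (hθ g)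
  rw [hg, map_smul, (M.coalg.mem_grouplike_iff.1 hζ).2, smul_eq_mul, mul_one] at h
  exact h.symm

section Coord

variable {ι : Type*} (β : Module.Basis ι (Stalk F d x) (LocalMod M.act x))
  (hβ : ∀ k, β k ∈ M.coalg.grouplike x) (i : ι)

-- Each basis element is an eigenvector of every g, possibly with another source; on the i-th
-- coordinate only the eigenvalue of β i survives.
include hβ in
theorem coord_localR {y : E'} {θ : Stalk F d' y →ₐ[F] Stalk F d x}
    (hθ : ∀ g, M.localR x (Y.ι g) (β i) = θ (germ y g) • β i) (g : Cc F d' E')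
    (z : LocalMod M.act x) :
    β.coord i (M.localR x (Y.ι g) z) = θ (germ y g) * β.coord i z :=
  coord_apply_of_diagonal β i (M.localR x (Y.ι g)) (hθ g)
    (fun k => ⟨_, localR_of_grouplike (hβ k) g⟩) z

include hβ in
theorem lift_coord_map_localR (b : B) (z : LocalMod M.act x) :
    TensorProduct.lift (LinearMap.lsmul (Stalk F d x) (LocalMod M.act x) ∘ₗ β.coord i)
      (TensorProduct.map LinearMap.id (M.localR x b) (M.coalg.localComulₗ x z)) =
      β.coord i z • M.localR x b (β i) :=
  lift_coord_map_of_grouplike β i (M.localR x b) (M.coalg.localComulₗ x)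
    (fun k => (M.coalg.mem_grouplike_iff.1 (hβ k)).1) z

include hβ in
/-- The algebra `B` acts transitively on the grouplike elements of a principal bimodule. -/
theorem span_localR_eq_top (hM : Function.Surjective M.can) :
    Submodule.span (Stalk F d x) (Set.range fun b => M.localR x b (β i)) = ⊤ := by
  refine eq_top_iff.2 fun z _ => ?_
  obtain ⟨m, rfl⟩ := LocalMod.mk_surjective M.act x z
  obtain ⟨m₀, hm₀⟩ := LocalMod.mk_surjective M.act x (β i)
  -- Contraction of the first leg with the i-th coordinate sends Δ(m)(1 ⊗ b) to a multiple of (β i)b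
  -- and β i ⊗ m to m. Writing β i ⊗ m as a canonical image exhibits m in the span.
  let W := TensorProduct.lift (LinearMap.lsmul (Stalk F d x) (LocalMod M.act x) ∘ₗ
    β.coord i)
  have key : ∀ w, W (LocalMod.projTensor M.act x (M.can w)) ∈
      Submodule.span (Stalk F d x) (Set.range fun b => M.localR x b (β i)) := by
    intro w
    induction w using Bal.induction_on with
    | zero => rw [map_zero, map_zero, map_zero]; exact zero_mem _
    | add a b ha hb => rw [map_add, map_add, map_add]; exact add_mem ha hb
    | tmul m b =>
      rw [projTensor_can_tmul, lift_coord_map_localR β hβ i]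
      exact Submodule.smul_mem _ _ (Submodule.subset_span ⟨b, rfl⟩)
  obtain ⟨w, hw⟩ := hM (Bal.tmul M.act M.act m₀ m)
  have h1 := key w
  rw [hw, LocalMod.projTensor_tmul, TensorProduct.lift.tmul, LinearMap.comp_apply,
    LinearMap.lsmul_apply, hm₀, β.coord_apply, β.repr_self,
    Finsupp.single_eq_same, one_smul] at h1
  exact h1

end Coord

end PreprincipalBimodule

end Bimodule

end Algd

/-! ### Generators of the localized tensor product -/

namespace Algd

section Bimodule

set_option linter.unusedSectionVars false

variable {F : Type} [RCLike F] {d : ℕ} {E : Type*} [TopologicalSpace E]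
  [ChartedSpace (EuclideanSpace ℝ (Fin d)) E] [T2Space E] [IsManifold (𝓡 d) ∞ E]
  {d' : ℕ} {E' : Type*} [TopologicalSpace E']
  [ChartedSpace (EuclideanSpace ℝ (Fin d')) E'] [T2Space E'] [IsManifold (𝓡 d') ∞ E']
  {A : Type*} [NonUnitalRing A] [Module F A] [IsScalarTower F A A] [SMulCommClass F A A]
  {B : Type*} [NonUnitalRing B] [Module F B] [IsScalarTower F B B] [SMulCommClass F B B]
  {R'' : Type*} [NonUnitalCommRing R''] [Module F R'']
  {C : Type*} [NonUnitalRing C] [Module F C] [IsScalarTower F C C] [SMulCommClass F C C]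

variable {X : Bialgebroid F (Cc F d E) A} {Y : Bialgebroid F (Cc F d' E') B}
  {Z : Bialgebroid F R'' C}

namespace PreprincipalBimodule

variable {M : PreprincipalBimodule.{u} X Y} {N : PreprincipalBimodule.{u} Y Z}
  {T : PreprincipalBimodule.{u} X Z}

section Source

variable {x : E} {y : E'} {θ : Stalk F d' y →ₐ[F] Stalk F d x} {m₀ : M.carrier}

namespace TensorIso

variable (τ : TensorIso M N T) (x)

/-- The map `M_x → T_x`, `m ↦ m ⊗ n`. -/
noncomputable def localTmul (n : N.carrier) :
    LocalMod M.act x →ₗ[Stalk F d x] LocalMod T.act x :=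
  LocalMod.map x (τ.tmul.flip n) (fun f m => (τ.smulL_tmul (X.ι f) m n).symm)

theorem localTmul_mk (n : N.carrier) (m : M.carrier) :
    τ.localTmul x n (LocalMod.mk M.act x m) = LocalMod.mk T.act x (τ.tmul m n) := rfl

variable {x}

/-- The function g passes from n to m₀ and acts there through θ. Hence n ↦ m₀ ⊗ n is θ-semilinear.
-/
theorem mk_tmul_act
    (hθ : ∀ g, M.localR x (Y.ι g) (LocalMod.mk M.act x m₀) =
      θ (germ y g) • LocalMod.mk M.act x m₀) (g : Cc F d' E') (n : N.carrier) :
    LocalMod.mk T.act x (τ.tmul m₀ (N.act g n)) =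
      θ (germ y g) • LocalMod.mk T.act x (τ.tmul m₀ n) := by
  rw [N.act_apply, ← τ.tmul_bal, ← localTmul_mk, ← localR_mk, hθ, map_smul, localTmul_mk]

/-- The semilinear map `N_y → T_x`, `n ↦ m₀ ⊗ n`. -/
noncomputable def localTmulRight
    (hθ : ∀ g, M.localR x (Y.ι g) (LocalMod.mk M.act x m₀) =
      θ (germ y g) • LocalMod.mk M.act x m₀) :
    LocalMod N.act y →ₛₗ[(θ : Stalk F d' y →+* Stalk F d x)] LocalMod T.act x :=
  LocalMod.lift (θ : Stalk F d' y →+* Stalk F d x)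
    ((LocalMod.mk T.act x).toAddMonoidHom.comp (τ.tmul m₀).toAddMonoidHom)
    (fun g n => τ.mk_tmul_act hθ g n)

theorem localTmulRight_mk
    (hθ : ∀ g, M.localR x (Y.ι g) (LocalMod.mk M.act x m₀) =
      θ (germ y g) • LocalMod.mk M.act x m₀) (n : N.carrier) :
    τ.localTmulRight hθ (LocalMod.mk N.act y n) = LocalMod.mk T.act x (τ.tmul m₀ n) := rfl

/-- At x every m is a combination of elements m₀b, and m₀b ⊗ n = m₀ ⊗ bn. So the image of N_y
generates T_x, and by semilinearity a basis of N_y suffices. -/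
theorem span_localTmulRight_eq_top
    (hθ : ∀ g, M.localR x (Y.ι g) (LocalMod.mk M.act x m₀) =
      θ (germ y g) • LocalMod.mk M.act x m₀)
    (hspan : Submodule.span (Stalk F d x)
      (Set.range fun b => M.localR x b (LocalMod.mk M.act x m₀)) = ⊤)
    {ι : Type*} (β : Module.Basis ι (Stalk F d' y) (LocalMod N.act y)) :
    Submodule.span (Stalk F d x) (Set.range fun i => τ.localTmulRight hθ (β i)) = ⊤ := by
  have h1 : ∀ w, τ.localTmulRight hθ w ∈
      Submodule.span (Stalk F d x) (Set.range fun i => τ.localTmulRight hθ (β i)) := by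
    intro w
    induction β.mem_span w using Submodule.span_induction with
    | zero => rw [map_zero]; exact zero_mem _
    | add a b _ _ ha hb => rw [map_add]; exact add_mem ha hb
    | smul s a _ ha => rw [LinearMap.map_smulₛₗ]; exact Submodule.smul_mem _ _ ha
    | mem a ha =>
      obtain ⟨i, rfl⟩ := ha
      exact Submodule.subset_span ⟨i, rfl⟩
  have h2 : ∀ (n : N.carrier) (z : LocalMod M.act x), τ.localTmul x n z ∈
      Submodule.span (Stalk F d x) (Set.range fun i => τ.localTmulRight hθ (β i)) := by
    intro n z
    have hz : z ∈ Submodule.span (Stalk F d x)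
      (Set.range fun b => M.localR x b (LocalMod.mk M.act x m₀)) := hspan ▸ Submodule.mem_top
    induction hz using Submodule.span_induction with
    | zero => rw [map_zero]; exact zero_mem _
    | add a b _ _ ha hb => rw [map_add]; exact add_mem ha hb
    | smul s a _ ha => rw [map_smul]; exact Submodule.smul_mem _ _ ha
    | mem a ha =>
      obtain ⟨b, rfl⟩ := ha
      simp only [localR_mk, localTmul_mk, τ.tmul_bal]
      exact h1 (LocalMod.mk N.act y (N.smulL b n))
  refine eq_top_iff.2 fun z _ => ?_
  obtain ⟨t, rfl⟩ := LocalMod.mk_surjective T.act x z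
  refine τ.induction (p := fun t => LocalMod.mk T.act x t ∈ _) t ?_ ?_ ?_
  · rw [map_zero]; exact zero_mem _
  · exact fun m n => h2 n (LocalMod.mk M.act x m)
  · intro a b ha hb
    rw [map_add]; exact add_mem ha hb

end TensorIso

end Source

end PreprincipalBimodule

end Bimodule

end Algd

/-! ### Dual functionals and linear independence -/

namespace Algd

section Pairing

variable {F : Type*} [Field F]
  {R : Type*} [NonUnitalCommRing R] [Module F R]
  {A : Type*} [NonUnitalRing A] [Module F A] [IsScalarTower F A A] [SMulCommClass F A A]
  {R' : Type*} [NonUnitalCommRing R'] [Module F R']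
  {B : Type*} [NonUnitalRing B] [Module F B] [IsScalarTower F B B] [SMulCommClass F B B]
  {R'' : Type*} [NonUnitalCommRing R''] [Module F R'']
  {C : Type*} [NonUnitalRing C] [Module F C] [IsScalarTower F C C] [SMulCommClass F C C]

variable {X : Bialgebroid F R A} {Y : Bialgebroid F R' B} {Z : Bialgebroid F R'' C}

namespace PreprincipalBimodule

variable {M : PreprincipalBimodule.{u} X Y} {N : PreprincipalBimodule.{u} Y Z}
  {T : PreprincipalBimodule.{u} X Z}

variable {S : Type*} [CommRing S] [Algebra F S] {η : R' → S} {σ : R → S}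
  {α : M.carrier →ₗ[F] S} {κ : N.carrier →ₗ[F] S}
  (hα : ∀ g m, α (M.smulR (Y.ι g) m) = η g * α m) (hκ : ∀ g n, κ (N.act g n) = η g * κ n)

/-- The map `m ⊗ b ↦ α(m) κ(bn)` on `M ⊗_{R'} B`. -/
noncomputable def pairCan (n : N.carrier) : CanDom M →ₗ[F] S :=
  Bal.lift (fun r => M.smulR (Y.ι r)) Y.act
    ((LinearMap.mul F (S)).compl₁₂ α
      (κ ∘ₗ (N.smulL : B →ₗ[F] Module.End F N.carrier).flip n))
    (fun g m b => by
      have h1 : N.smulL (Y.act g b) n = N.act g (N.smulL b n) := N.smulL_mul (Y.ι g) b n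
      change α (M.smulR (Y.ι g) m) * κ (N.smulL b n) = α m * κ (N.smulL (Y.act g b) n)
      rw [h1, hα, hκ, mul_assoc, mul_left_comm])

theorem pairCan_tmul (n : N.carrier) (m : M.carrier) (b : B) :
    pairCan hα hκ n (Bal.tmul (fun r => M.smulR (Y.ι r)) Y.act m b) = α m * κ (N.smulL b n) :=
  Bal.lift_tmul (fun r => M.smulR (Y.ι r)) Y.act _ _ m b

theorem pairCan_canMulRight (b : B) (n : N.carrier) (w : CanDom M) :
    pairCan hα hκ n (M.canMulRight b w) = pairCan hα hκ (N.smulL b n) w := by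
  induction w using Bal.induction_on with
  | zero => simp only [map_zero]
  | add x y hx hy => simp only [map_add, hx, hy]
  | tmul m c => rw [canMulRight_tmul, pairCan_tmul, pairCan_tmul, N.smulL_mul]

theorem pairCan_canL (hα' : ∀ f m, α (M.act f m) = σ f * α m) (f : R) (n : N.carrier)
    (w : CanDom M) : pairCan hα hκ n (canL M (X.ι f) w) = σ f * pairCan hα hκ n w := by
  induction w using Bal.induction_on with
  | zero => simp only [map_zero, mul_zero]
  | add x y hx hy => simp only [map_add, mul_add, hx, hy]
  | tmul m c => rw [canL_tmul, pairCan_tmul, pairCan_tmul, ← M.act_apply, hα', mul_assoc]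

/-- The map `n ↦ (m ⊗ b ↦ α(m) κ(bn))`. -/
noncomputable def pairCanₗ : N.carrier →ₗ[F] CanDom M →ₗ[F] S where
  toFun := pairCan hα hκ
  map_add' n n' := Bal.hom_ext fun m b => by
    rw [LinearMap.add_apply, pairCan_tmul, pairCan_tmul, pairCan_tmul, map_add, map_add, mul_add]
  map_smul' k n := Bal.hom_ext fun m b => by
    rw [LinearMap.smul_apply, pairCan_tmul, pairCan_tmul, map_smul, map_smul, mul_smul_comm,
      RingHom.id_apply]

variable (hM : Function.Bijective M.can)

/-- The inverse of the canonical map. -/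
noncomputable def canSymm : Bal M.act M.act →ₗ[F] CanDom M :=
  (LinearEquiv.ofBijective M.can hM).symm.toLinearMap

theorem can_canSymm (z : Bal M.act M.act) : M.can (canSymm hM z) = z :=
  (LinearEquiv.ofBijective M.can hM).apply_symm_apply z

theorem canSymm_can (w : CanDom M) : canSymm hM (M.can w) = w :=
  (LinearEquiv.ofBijective M.can hM).symm_apply_apply w

theorem canSymm_tmul_smulR (m m' : M.carrier) (b : B) :
    canSymm hM (Bal.tmul M.act M.act m (M.smulR b m')) =
      M.canMulRight b (canSymm hM (Bal.tmul M.act M.act m m')) := by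
  refine hM.1 ((can_canSymm hM _).trans ?_)
  exact (endMap_tmul M.act _ _ _ _ m m').symm.trans
    ((congrArg (endMap M.act LinearMap.id (M.smulR b) (fun _ _ => rfl)
      (fun s c => M.smulR_act s b c)) (can_canSymm hM _)).symm.trans
      (M.can_mulRight b (canSymm hM (Bal.tmul M.act M.act m m'))).symm)

theorem canSymm_balAct (f : R) (z : Bal M.act M.act) :
    canSymm hM (balAct M.act f z) = canL M (X.ι f) (canSymm hM z) := by
  refine hM.1 ((can_canSymm hM _).trans ?_)
  exact (congrArg (balAct M.act f) (can_canSymm hM z)).symm.trans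
    (M.can_canL_ι f (canSymm hM z)).symm

namespace TensorIso

variable (τ : TensorIso M N T) (hα' : ∀ f m, α (M.act f m) = σ f * α m) (m₀ : M.carrier)

/-- The map `m ⊗ n ↦ ∑ α(mᵢ) κ(bᵢ n)` on `T`, where `m₀ ⊗ m = ∑ Δ(mᵢ)(1 ⊗ bᵢ)`. -/
noncomputable def pair : T.carrier →ₗ[F] S :=
  τ.lift ((pairCanₗ hα hκ).flip ∘ₗ canSymm hM ∘ₗ Bal.tmul M.act M.act m₀) (fun b m n =>
    (congrArg (pairCan hα hκ n) (canSymm_tmul_smulR hM m₀ m b)).trans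
      (pairCan_canMulRight hα hκ b n _))

theorem pair_tmul (m : M.carrier) (n : N.carrier) :
    τ.pair hα hκ hM m₀ (τ.tmul m n) =
      pairCan hα hκ n (canSymm hM (Bal.tmul M.act M.act m₀ m)) :=
  τ.lift_tmul _ _ m n

include hα' in
theorem pair_act (f : R) (t : T.carrier) :
    τ.pair hα hκ hM m₀ (T.act f t) = σ f * τ.pair hα hκ hM m₀ t := by
  refine τ.induction (p := fun t => τ.pair hα hκ hM m₀ (T.act f t) =
    σ f * τ.pair hα hκ hM m₀ t) t ?_ ?_ ?_
  · simp only [map_zero, mul_zero]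
  · intro m n
    have h1 : T.act f (τ.tmul m n) = τ.tmul (M.act f m) n := τ.smulL_tmul (X.ι f) m n
    have h2 : Bal.tmul M.act M.act m₀ (M.act f m) =
        balAct M.act f (Bal.tmul M.act M.act m₀ m) :=
      (Bal.tmul_bal M.act M.act f m₀ m).symm.trans (balAct_tmul M.act f m₀ m).symm
    have h3 := (congrArg (canSymm hM) h2).trans (canSymm_balAct hM f _)
    exact (congrArg (τ.pair hα hκ hM m₀) h1).trans ((τ.pair_tmul hα hκ hM m₀ _ n).trans
      ((congrArg (pairCan hα hκ n) h3).trans ((pairCan_canL hα hκ hα' f n _).trans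
        (congrArg (σ f * ·) (τ.pair_tmul hα hκ hM m₀ m n).symm))))
  · intro a b ha hb
    simp only [map_add, mul_add, ha, hb]

end TensorIso

end PreprincipalBimodule

end Pairing

section Bimodule

set_option linter.unusedSectionVars false

variable {F : Type} [RCLike F] {d : ℕ} {E : Type*} [TopologicalSpace E]
  [ChartedSpace (EuclideanSpace ℝ (Fin d)) E] [T2Space E] [IsManifold (𝓡 d) ∞ E]
  {d' : ℕ} {E' : Type*} [TopologicalSpace E']
  [ChartedSpace (EuclideanSpace ℝ (Fin d')) E'] [T2Space E'] [IsManifold (𝓡 d') ∞ E']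
  {A : Type*} [NonUnitalRing A] [Module F A] [IsScalarTower F A A] [SMulCommClass F A A]
  {B : Type*} [NonUnitalRing B] [Module F B] [IsScalarTower F B B] [SMulCommClass F B B]
  {R'' : Type*} [NonUnitalCommRing R''] [Module F R'']
  {C : Type*} [NonUnitalRing C] [Module F C] [IsScalarTower F C C] [SMulCommClass F C C]

variable {X : Bialgebroid F (Cc F d E) A} {Y : Bialgebroid F (Cc F d' E') B}
  {Z : Bialgebroid F R'' C}

namespace PreprincipalBimodule

variable {M : PreprincipalBimodule.{u} X Y} {N : PreprincipalBimodule.{u} Y Z}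
  {T : PreprincipalBimodule.{u} X Z}

namespace TensorIso

variable {x : E} {y : E'} {θ : Stalk F d' y →ₐ[F] Stalk F d x} {m₀ : M.carrier}
  {α : M.carrier →ₗ[F] Stalk F d x} {κ : N.carrier →ₗ[F] Stalk F d x}
  (hM : Function.Bijective M.can) (τ : TensorIso M N T)

/-- At x the tensor m₀ ⊗ m₀ is Δ(m₀) = β_M(m₀ ⊗ r) with m₀r = m₀, so the value is α(m₀)κ(rn) =
θ(r_y)κ(n) = κ(n). -/
theorem pair_tmul_of_grouplike (hα : ∀ g m, α (M.smulR (Y.ι g) m) = θ (germ y g) * α m)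
    (hα' : ∀ f m, α (M.act f m) = germ x f * α m)
    (hκ : ∀ g n, κ (N.act g n) = θ (germ y g) * κ n) (hm₀ : LocalMod.mk M.act x m₀ ∈ M.coalg.grouplike x)
    (hθ : ∀ g, M.localR x (Y.ι g) (LocalMod.mk M.act x m₀) =
      θ (germ y g) • LocalMod.mk M.act x m₀) (hα₀ : α m₀ = 1) (n : N.carrier) :
    τ.pair hα hκ hM m₀ (τ.tmul m₀ n) = κ n := by
  obtain ⟨r, hr⟩ := M.unitaryR {m₀}
  have hr := hr m₀ (Finset.mem_singleton_self _)
  rw [pair_tmul]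
  have h1 : LocalMod.projTensor M.act x (Bal.tmul M.act M.act m₀ m₀) =
      LocalMod.projTensor M.act x (M.coalg.comul m₀) := by
    rw [LocalMod.projTensor_tmul]
    exact hm₀.1.symm
  -- The equality m₀ ⊗ m₀ = Δ(m₀) holds only after localization at x, but the functional is
  -- compatible with germs and does not see the difference.
  have h2 := LocalMod.congr_of_projTensor_eq (RingHom.id (Stalk F d x))
    (pairCan hα hκ n ∘ₗ canSymm hM).toAddMonoidHom (fun f z => by
      change pairCan hα hκ n (canSymm hM (balAct M.act f z)) =
        germ x f * pairCan hα hκ n (canSymm hM z)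
      rw [canSymm_balAct, pairCan_canL hα hκ hα']) h1
  refine h2.trans ?_
  change pairCan hα hκ n (canSymm hM (M.coalg.comul m₀)) = κ n
  have h3 : M.can (Bal.tmul (fun r => M.smulR (Y.ι r)) Y.act m₀ (Y.ι r)) = M.coalg.comul m₀ :=
    (M.mk_rep_eq_can (M.coalg.isRep_rep m₀) r hr).trans (M.coalg.mk_rep m₀)
  rw [← h3, canSymm_can, pairCan_tmul, ← N.act_apply, hκ, hα₀, one_mul,
    map_germ_eq_one hm₀ hθ (by rw [localR_mk, hr]), one_mul]

-- The pairings Λ i with α = w and κ = θ ∘ (i-th coordinate) are dual to the family: by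
-- `pair_tmul_of_grouplike`, Λ i takes the value θ(δᵢⱼ) on m₀ ⊗ β j.
include hM in
theorem linearIndependent_localTmulRight (hm₀ : LocalMod.mk M.act x m₀ ∈ M.coalg.grouplike x)
    (hθ : ∀ g, M.localR x (Y.ι g) (LocalMod.mk M.act x m₀) =
      θ (germ y g) • LocalMod.mk M.act x m₀)
    (w : LocalMod M.act x →ₗ[Stalk F d x] Stalk F d x) (hw : w (LocalMod.mk M.act x m₀) = 1)
    (hw' : ∀ g z, w (M.localR x (Y.ι g) z) = θ (germ y g) * w z)
    {ι : Type*} (β : Module.Basis ι (Stalk F d' y) (LocalMod N.act y)) :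
    LinearIndependent (Stalk F d x) (fun i => τ.localTmulRight hθ (β i)) := by
  classical
  let α : M.carrier →ₗ[F] Stalk F d x := (w.restrictScalars F) ∘ₗ LocalMod.mk M.act x
  let κ : ι → N.carrier →ₗ[F] Stalk F d x := fun i =>
    θ.toLinearMap ∘ₗ ((β.coord i).restrictScalars F) ∘ₗ LocalMod.mk N.act y
  have hα : ∀ g m, α (M.smulR (Y.ι g) m) = θ (germ y g) * α m := fun g m =>
    hw' g (LocalMod.mk M.act x m)
  have hα' : ∀ f m, α (M.act f m) = germ x f * α m := fun f m => by
    change w (LocalMod.mk M.act x (M.act f m)) = germ x f * w (LocalMod.mk M.act x m)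
    rw [← LocalMod.germ_smul_mk, map_smul, smul_eq_mul]
  have hκ : ∀ i g n, κ i (N.act g n) = θ (germ y g) * κ i n := fun i g n => by
    change θ (β.coord i (LocalMod.mk N.act y (N.act g n))) =
      θ (germ y g) * θ (β.coord i (LocalMod.mk N.act y n))
    rw [← LocalMod.germ_smul_mk, map_smul, smul_eq_mul, map_mul]
  let Λ : ι → Module.Dual (Stalk F d x) (LocalMod T.act x) := fun i =>
    LocalMod.lift (S := Stalk F d x) (act := T.act) (RingHom.id (Stalk F d x))
      (τ.pair hα (hκ i) hM m₀).toAddMonoidHom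
      (fun f t => τ.pair_act hα (hκ i) hM hα' m₀ f t)
  have key : ∀ i z, Λ i (τ.localTmulRight hθ z) = θ (β.coord i z) := fun i z => by
    obtain ⟨n, rfl⟩ := LocalMod.mk_surjective N.act y z
    exact τ.pair_tmul_of_grouplike hM hα hα' (hκ i) hm₀ hθ hw n
  refine LinearIndependent.of_pairwise_dual_eq_zero_one _ Λ (fun i j hij => ?_) fun i => ?_
  · change Λ i (τ.localTmulRight hθ (β j)) = 0
    rw [key, β.coord_apply, β.repr_self, Finsupp.single_eq_of_ne hij, map_zero]
  · change Λ i (τ.localTmulRight hθ (β i)) = 1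
    rw [key, β.coord_apply, β.repr_self, Finsupp.single_eq_same, map_one]

end TensorIso

end PreprincipalBimodule

end Bimodule

end Algd

/-! ### Grouplike elements of the tensor product -/

namespace Algd

section Shuffle

variable {F : Type*} [Field F] {R : Type*} [NonUnitalCommRing R] [Module F R]
  {A : Type*} [NonUnitalRing A] [Module F A] [IsScalarTower F A A] [SMulCommClass F A A]
  {R' : Type*} [NonUnitalCommRing R'] [Module F R']
  {B : Type*} [NonUnitalRing B] [Module F B] [IsScalarTower F B B] [SMulCommClass F B B]
  {R'' : Type*} [NonUnitalCommRing R''] [Module F R'']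
  {C : Type*} [NonUnitalRing C] [Module F C] [IsScalarTower F C C] [SMulCommClass F C C]

variable {X : Bialgebroid F R A} {Y : Bialgebroid F R' B} {Z : Bialgebroid F R'' C}

namespace PreprincipalBimodule

variable {M : PreprincipalBimodule.{u} X Y} {N : PreprincipalBimodule.{u} Y Z}
  {T : PreprincipalBimodule.{u} X Z}

namespace TensorIso

variable (τ : TensorIso M N T) {W : Type*} [AddCommGroup W] [Module F W]
  (q : T.carrier ⊗[F] T.carrier →ₗ[F] W)

/-- The map `m ⊗ m', n ⊗ n' ↦ q((m ⊗ n) ⊗ (m' ⊗ n'))`. -/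
noncomputable def mapShuffle : M.carrier ⊗[F] M.carrier →ₗ[F] N.carrier ⊗[F] N.carrier →ₗ[F] W :=
  (TensorProduct.map₂ τ.tmul τ.tmul).compr₂ q

variable {q} {σ : R → W →+ W} (hσ : ∀ f t t', q (T.act f t ⊗ₜ t') = σ f (q (t ⊗ₜ t')))
  (hσ' : ∀ f t t', q (t ⊗ₜ T.act f t') = σ f (q (t ⊗ₜ t')))

include hσ in
theorem mapShuffle_act_left (f : R) (m m' : M.carrier) (u : N.carrier ⊗[F] N.carrier) :
    τ.mapShuffle q (M.act f m ⊗ₜ m') u = σ f (τ.mapShuffle q (m ⊗ₜ m') u) := by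
  induction u with
  | zero => simp only [map_zero]
  | add a b ha hb => simp only [map_add, ha, hb]
  | tmul n n' =>
    exact (congrArg (fun t => q (t ⊗ₜ τ.tmul m' n')) (τ.smulL_tmul (X.ι f) m n)).symm.trans
      (hσ f _ _)

include hσ' in
theorem mapShuffle_act_right (f : R) (m m' : M.carrier) (u : N.carrier ⊗[F] N.carrier) :
    τ.mapShuffle q (m ⊗ₜ M.act f m') u = σ f (τ.mapShuffle q (m ⊗ₜ m') u) := by
  induction u with
  | zero => simp only [map_zero]
  | add a b ha hb => simp only [map_add, ha, hb]
  | tmul n n' =>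
    exact (congrArg (fun t => q (τ.tmul m n ⊗ₜ t)) (τ.smulL_tmul (X.ι f) m' n')).symm.trans
      (hσ' f _ _)

/-- The map `m ⊗ m' ↦ q((m ⊗ n) ⊗ (m' ⊗ n'))`, for `u = n ⊗ n'`. -/
noncomputable def mapShuffleLeft (u : N.carrier ⊗[F] N.carrier) : Bal M.act M.act →ₗ[F] W :=
  Bal.lift M.act M.act (TensorProduct.curry ((τ.mapShuffle q).flip u)) (fun f m m' =>
    (τ.mapShuffle_act_left hσ f m m' u).trans (τ.mapShuffle_act_right hσ' f m m' u).symm)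

theorem mapShuffleLeft_mk (t : M.carrier ⊗[F] M.carrier) (u : N.carrier ⊗[F] N.carrier) :
    τ.mapShuffleLeft hσ hσ' u (Bal.mk M.act M.act t) = τ.mapShuffle q t u := by
  induction t with
  | zero => simp only [map_zero, LinearMap.zero_apply]
  | add a b ha hb => simp only [map_add, LinearMap.add_apply, ha, hb]
  | tmul m m' => rfl

theorem mapShuffleLeft_balAct (f : R) (u : N.carrier ⊗[F] N.carrier) (z : Bal M.act M.act) :
    τ.mapShuffleLeft hσ hσ' u (balAct M.act f z) = σ f (τ.mapShuffleLeft hσ hσ' u z) := by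
  induction z using Bal.induction_on with
  | zero => simp only [map_zero]
  | add a b ha hb => simp only [map_add, ha, hb]
  | tmul m m' => exact τ.mapShuffle_act_left hσ f m m' u

variable {η : R' → W →+ W} {m₀ : M.carrier}
  (hη : ∀ g n n', q (τ.tmul m₀ (N.act g n) ⊗ₜ τ.tmul m₀ n') = η g (q (τ.tmul m₀ n ⊗ₜ τ.tmul m₀ n')))
  (hη' : ∀ g n n', q (τ.tmul m₀ n ⊗ₜ τ.tmul m₀ (N.act g n')) =
    η g (q (τ.tmul m₀ n ⊗ₜ τ.tmul m₀ n')))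

/-- The map `n ⊗ n' ↦ q((m₀ ⊗ n) ⊗ (m₀ ⊗ n'))`. -/
noncomputable def mapShuffleRight : Bal N.act N.act →ₗ[F] W :=
  Bal.lift N.act N.act (TensorProduct.curry (τ.mapShuffle q (m₀ ⊗ₜ m₀)))
    (fun g n n' => (hη g n n').trans (hη' g n n').symm)

theorem mapShuffleRight_mk (u : N.carrier ⊗[F] N.carrier) :
    τ.mapShuffleRight hη hη' (Bal.mk N.act N.act u) = τ.mapShuffle q (m₀ ⊗ₜ m₀) u := by
  induction u with
  | zero => simp only [map_zero]
  | add a b ha hb => simp only [map_add, ha, hb]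
  | tmul m m' => rfl

theorem mapShuffleRight_balAct (g : R') (z : Bal N.act N.act) :
    τ.mapShuffleRight hη hη' (balAct N.act g z) = η g (τ.mapShuffleRight hη hη' z) := by
  induction z using Bal.induction_on with
  | zero => simp only [map_zero]
  | add a b ha hb => simp only [map_add, ha, hb]
  | tmul m m' => exact hη g m m'

end TensorIso

end PreprincipalBimodule

end Shuffle

section Bimodule

set_option linter.unusedSectionVars false

variable {F : Type} [RCLike F] {d : ℕ} {E : Type*} [TopologicalSpace E]
  [ChartedSpace (EuclideanSpace ℝ (Fin d)) E] [T2Space E] [IsManifold (𝓡 d) ∞ E]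
  {d' : ℕ} {E' : Type*} [TopologicalSpace E']
  [ChartedSpace (EuclideanSpace ℝ (Fin d')) E'] [T2Space E'] [IsManifold (𝓡 d') ∞ E']
  {A : Type*} [NonUnitalRing A] [Module F A] [IsScalarTower F A A] [SMulCommClass F A A]
  {B : Type*} [NonUnitalRing B] [Module F B] [IsScalarTower F B B] [SMulCommClass F B B]
  {R'' : Type*} [NonUnitalCommRing R''] [Module F R'']
  {C : Type*} [NonUnitalRing C] [Module F C] [IsScalarTower F C C] [SMulCommClass F C C]

variable {X : Bialgebroid F (Cc F d E) A} {Y : Bialgebroid F (Cc F d' E') B}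
  {Z : Bialgebroid F R'' C}

namespace PreprincipalBimodule

variable {M : PreprincipalBimodule.{u} X Y} {N : PreprincipalBimodule.{u} Y Z}
  {T : PreprincipalBimodule.{u} X Z}

namespace TensorIso

variable (τ : TensorIso M N T) {x : E} {y : E'} {θ : Stalk F d' y →ₐ[F] Stalk F d x}
  {m₀ : M.carrier} (hθ : ∀ g, M.localR x (Y.ι g) (LocalMod.mk M.act x m₀) =
      θ (germ y g) • LocalMod.mk M.act x m₀)

/-- Δ(m₀ ⊗ n) is the shuffle of Δ(m₀) and Δ(n), which become m₀ ⊗ m₀ and n ⊗ n only after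
localization, at x and at y. The shuffle is compatible with germs at x in M and, along θ, with germs
at y in N. -/
theorem localTmulRight_mem_grouplike (hm₀ : LocalMod.mk M.act x m₀ ∈ M.coalg.grouplike x)
    {ν : LocalMod N.act y} (hν : ν ∈ N.coalg.grouplike y) :
    τ.localTmulRight hθ ν ∈ T.coalg.grouplike x := by
  obtain ⟨n, rfl⟩ := LocalMod.mk_surjective N.act y ν
  rw [localTmulRight_mk]
  constructor
  · let q := LocalMod.projTensor T.act x ∘ₗ Bal.mk T.act T.act
    let σ (s : Stalk F d x) := DistribSMul.toAddMonoidHom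
      (TensorProduct (Stalk F d x) (LocalMod T.act x) (LocalMod T.act x)) s
    have hq : ∀ t t', q (t ⊗ₜ t') =
        LocalMod.mk T.act x t ⊗ₜ[Stalk F d x] LocalMod.mk T.act x t' :=
      LocalMod.projTensor_tmul T.act x
    have hl : ∀ (s : Stalk F d x) {t₁ t : T.carrier} (t' : T.carrier),
        LocalMod.mk T.act x t₁ = s • LocalMod.mk T.act x t →
          q (t₁ ⊗ₜ t') = σ s (q (t ⊗ₜ t')) := fun s t₁ t t' h => by
      rw [hq, hq, h]
      exact (TensorProduct.smul_tmul' s _ _).symm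
    have hr : ∀ (s : Stalk F d x) {t₁ t' : T.carrier} (t : T.carrier),
        LocalMod.mk T.act x t₁ = s • LocalMod.mk T.act x t' →
          q (t ⊗ₜ t₁) = σ s (q (t ⊗ₜ t')) := fun s t₁ t' t h => by
      rw [hq, hq, h]
      exact TensorProduct.tmul_smul s _ _
    have hσ : ∀ f t t', q (T.act f t ⊗ₜ t') = σ (germ x f) (q (t ⊗ₜ t')) := fun f t t' =>
      hl _ t' (LocalMod.germ_smul_mk T.act x f t).symm
    have hσ' : ∀ f t t', q (t ⊗ₜ T.act f t') = σ (germ x f) (q (t ⊗ₜ t')) := fun f t t' =>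
      hr _ t (LocalMod.germ_smul_mk T.act x f t').symm
    have hη : ∀ g n n', q (τ.tmul m₀ (N.act g n) ⊗ₜ τ.tmul m₀ n') =
        σ (θ (germ y g)) (q (τ.tmul m₀ n ⊗ₜ τ.tmul m₀ n')) := fun g n n' =>
      hl _ _ (τ.mk_tmul_act hθ g n)
    have hη' : ∀ g n n', q (τ.tmul m₀ n ⊗ₜ τ.tmul m₀ (N.act g n')) =
        σ (θ (germ y g)) (q (τ.tmul m₀ n ⊗ₜ τ.tmul m₀ n')) := fun g n n' =>
      hr _ _ (τ.mk_tmul_act hθ g n')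
    have h1 : LocalMod.projTensor T.act x (T.coalg.comul (τ.tmul m₀ n)) =
        τ.mapShuffle q (M.coalg.rep m₀) (N.coalg.rep n) :=
      congrArg (LocalMod.projTensor T.act x)
        (τ.isRep_tmul (M.coalg.isRep_rep m₀) (N.coalg.isRep_rep n)).eq.symm
    have h2 : LocalMod.projTensor M.act x (M.coalg.comul m₀) =
        LocalMod.projTensor M.act x (Bal.tmul M.act M.act m₀ m₀) :=
      hm₀.1.trans (LocalMod.projTensor_tmul M.act x m₀ m₀).symm
    have h3 : LocalMod.projTensor N.act y (N.coalg.comul n) =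
        LocalMod.projTensor N.act y (Bal.tmul N.act N.act n n) :=
      hν.1.trans (LocalMod.projTensor_tmul N.act y n n).symm
    -- Δ(m₀) is replaced first: with m₀ in both legs, functions on the base of N act on either leg
    -- through θ, and Δ(n) can be replaced as well.
    have h4 := LocalMod.congr_of_projTensor_eq (RingHom.id (Stalk F d x))
      (τ.mapShuffleLeft hσ hσ' (N.coalg.rep n)).toAddMonoidHom
      (fun f z => τ.mapShuffleLeft_balAct hσ hσ' f _ z) h2
    have h5 := LocalMod.congr_of_projTensor_eq (θ : Stalk F d' y →+* Stalk F d x)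
      (τ.mapShuffleRight hη hη').toAddMonoidHom
      (fun g z => τ.mapShuffleRight_balAct hη hη' g z) h3
    have h6 := τ.mapShuffleLeft_mk hσ hσ' (M.coalg.rep m₀) (N.coalg.rep n)
    have h7 := τ.mapShuffleRight_mk hη hη' (N.coalg.rep n)
    rw [M.coalg.mk_rep] at h6
    rw [N.coalg.mk_rep] at h7
    exact h1.trans (h6.symm.trans (h4.trans (h7.symm.trans h5)))
  · have h1 : T.coalg.counit (τ.tmul m₀ n) =
      M.coalg.counit (M.smulR (Y.ι (N.coalg.counit n)) m₀) := τ.counit_tmul m₀ n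
    have h2 : germ y (N.coalg.counit n) = 1 := hν.2
    -- ε(m₀ ⊗ n) = ε(m₀ε(n)), and m₀ε(n) equals m₀ at x because θ(1) = 1.
    have h3 := congrArg (M.coalg.localCounitₗ x) (hθ (N.coalg.counit n))
    rw [h2, map_one, one_smul] at h3
    change germ x (T.coalg.counit (τ.tmul m₀ n)) = 1
    rw [h1]
    exact h3.trans (M.coalg.mem_grouplike_iff.1 hm₀).2

include τ in
/-- The tensor product of locally grouplike bimodules is locally grouplike. -/
theorem freelyGenerates_grouplike (hM : M.IsPrincipal)
    (hMx : FreelyGenerates (Stalk F d x) (M.coalg.grouplike x))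
    (hN : ∀ y, FreelyGenerates (Stalk F d' y) (N.coalg.grouplike y)) :
    FreelyGenerates (Stalk F d x) (T.coalg.grouplike x) := by
  rw [M.isPrincipal_iff] at hM
  have hβ : ∀ k, hMx.basis k ∈ M.coalg.grouplike x := fun k => by
    rw [hMx.basis_apply]
    exact k.2
  -- Without grouplike elements M_x would be 0, but surjectivity of ε gives an element with local
  -- counit 1.
  obtain ⟨i⟩ : Nonempty (M.coalg.grouplike x) := by
    by_contra h0
    rw [not_nonempty_iff] at h0
    obtain ⟨f, hf⟩ := germ_surjective (F := F) (d := d) x 1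
    obtain ⟨m, hm⟩ := hM.1 f
    have h1 : LocalMod.mk M.act x m = 0 := hMx.basis.ext_elem fun i => h0.elim i
    have h2 := congrArg (M.coalg.localCounitₗ x) h1
    have h3 : M.coalg.localCounitₗ x (LocalMod.mk M.act x m) = germ x (M.coalg.counit m) := rfl
    rw [h3, hm, hf, map_zero] at h2
    exact one_ne_zero h2
  obtain ⟨m₀, hm₀⟩ := LocalMod.mk_surjective M.act x (hMx.basis i)
  have hg : LocalMod.mk M.act x m₀ ∈ M.coalg.grouplike x := hm₀ ▸ hβ i
  obtain ⟨y, θ, hθ⟩ := exists_source hg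
  have hspan := span_localR_eq_top hMx.basis hβ i hM.2.2
  rw [← hm₀] at hspan
  have hw : hMx.basis.coord i (LocalMod.mk M.act x m₀) = 1 := by
    rw [hm₀, hMx.basis.coord_apply, hMx.basis.repr_self, Finsupp.single_eq_same]
  have hw' : ∀ g z, hMx.basis.coord i (M.localR x (Y.ι g) z) =
      θ (germ y g) * hMx.basis.coord i z :=
    coord_localR hMx.basis hβ i (fun g => by rw [← hm₀]; exact hθ g)
  refine T.coalg.freelyGenerates_grouplike (Module.Basis.mk
    (τ.linearIndependent_localTmulRight hM.2 hg hθ (hMx.basis.coord i) hw hw' (hN y).basis)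
    (τ.span_localTmulRight_eq_top hθ hspan (hN y).basis).ge) fun k => ?_
  rw [Module.Basis.mk_apply, (hN y).basis_apply]
  exact τ.localTmulRight_mem_grouplike hθ hg k.2

end TensorIso

end PreprincipalBimodule

end Bimodule

end Algd

/-! ### The subcategory of locally grouplike bimodules -/

namespace Algd

namespace PrHoALGD

variable {F : Type} [RCLike F]

theorem PrincipalBimodule.IsLocallyGrouplike.of_iso {X Y : PrHoALGD.{u, v} F}
    {M N : PrincipalBimodule X Y} (hM : M.IsLocallyGrouplike) (i : M.bimod.Iso N.bimod) :
    N.IsLocallyGrouplike := fun x =>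
  LeftCoalgebra.FreelyGenerates.of_equiv (hM x) i.toEquiv
    (fun f m => i.map_smulL (X.hopf.toBialgebroid.ι f) m) i.map_counit i.map_comul

theorem PrincipalBimodule.IsLocallyGrouplike.of_tensorIso {X Y Z : PrHoALGD.{u, v} F}
    {M : PrincipalBimodule X Y} {N : PrincipalBimodule Y Z} {P : PrincipalBimodule X Z}
    (hM : M.IsLocallyGrouplike) (hN : N.IsLocallyGrouplike)
    (τ : PreprincipalBimodule.TensorIso M.bimod N.bimod P.bimod) : P.IsLocallyGrouplike :=
  fun x => τ.freelyGenerates_grouplike M.isPrincipal (hM x) hN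

end PrHoALGD

end Algd

theorem mainTheorem2 (F : Type) [RCLike F] :
    -- every locally grouplike Hopf algebroid is an object of the Morita category
    (∀ X : Algd.SmoothHopfAlgebroid.{u, v} F, X.IsLocallyGrouplike →
      X.hopf.toBialgebroid.IsPrincipal) ∧
    -- being locally grouplike depends only on the isomorphism class of a bimodule
    (∀ (X Y : Algd.PrHoALGD.{u, v} F) (M N : X.PrincipalBimodule Y),
      Nonempty (M.bimod.Iso N.bimod) → (M.IsLocallyGrouplike ↔ N.IsLocallyGrouplike)) ∧
    -- the tensor product of locally grouplike principal bimodules is again one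
    (∀ (X Y Z : Algd.PrHoALGD.{u, v} F), X.lgObj → Y.lgObj → Z.lgObj →
      ∀ (M : X.PrincipalBimodule Y) (N : Y.PrincipalBimodule Z),
        M.IsLocallyGrouplike → N.IsLocallyGrouplike →
        (∃ P : X.PrincipalBimodule Z,
          Nonempty (Algd.PreprincipalBimodule.TensorIso M.bimod N.bimod P.bimod)) ∧
        ∀ P : X.PrincipalBimodule Z,
          Nonempty (Algd.PreprincipalBimodule.TensorIso M.bimod N.bimod P.bimod) →
          P.IsLocallyGrouplike) ∧
    -- with the composition induced by the tensor product, the principal smooth Hopf algebroids form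
    -- a category, in which the locally grouplike objects and morphisms form a subcategory
    ∃ (comp : ∀ X Y Z : Algd.PrHoALGD.{u, v} F, X.Hom Y → Y.Hom Z → X.Hom Z)
      (h : Algd.PrHoALGD.IsMoritaComposition comp),
      @Algd.IsSubcategory (Algd.PrHoALGD.{u, v} F) (Algd.PrHoALGD.moritaCategory h)
        Algd.PrHoALGD.lgObj Algd.PrHoALGD.lgHom := by
  refine ⟨fun X hX => hX.isPrincipal,
    fun X Y M N ⟨i⟩ => ⟨fun h => h.of_iso i, fun h => h.of_iso i.symm⟩,
    fun X Y Z _ _ _ M N hM hN =>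
      ⟨⟨M.tensor N, ⟨Algd.PreprincipalBimodule.tensorIso M.bimod N.bimod⟩⟩,
        fun P ⟨τ⟩ => hM.of_tensorIso hN τ⟩,
    Algd.PrHoALGD.comp, Algd.PrHoALGD.isMoritaComposition_comp, ?_⟩
  let _ := Algd.PrHoALGD.moritaCategory (Algd.PrHoALGD.isMoritaComposition_comp.{u, v} (F := F))
  refine ⟨fun X hX => ⟨_, rfl, fun y => Algd.SmoothHopfAlgebroid.IsLocallyGrouplike.freelyGenerates hX y⟩, ?_⟩
  rintro X Y Z _ _ _ _ _ ⟨M, rfl, hM⟩ ⟨N, rfl, hN⟩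
  exact ⟨M.tensor N, rfl,
    hM.of_tensorIso hN (Algd.PreprincipalBimodule.tensorIso M.bimod N.bimod)⟩
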